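/- Consider a generalized linear model in which, with respect to a dominating measure on $\mathbb R$, a response with canonical parameter $\theta$ has density $c(y,\phi)\exp\{(y\theta-b(\theta))/\phi\}$ ($\phi>0$ fixed, $\theta$ in the interior of the set of parameters for which this is a probability density), with mean $\mu(\theta)=b'(\theta)$ and variance $\sigma^2(\theta)=\phi b''(\theta)$. Let $h$, the inverse link, be strictly monotone on an open interval $D\subseteq\mathbb R$ with values in the range of $\mu$, let $u=\mu^{-1}\circ h$, let $v=\sigma^2\circ u$ be positive on $D$, and let $w=(h')^2/v$. For every $n$ let $z_1,\dots,z_n\in\mathbb R^{p_n}$ be known design vectors (they may depend on $n$), let $\mathcal B_n\subset\mathbb R^{p_n}$ be the parameter space with true parameter $\beta_{0n}\in\mathcal B_n$, and let $y_1,\dots,y_n$ be independent responses of the model, $y_i$ having canonical parameter $u(z_i^T\beta_{0n})$. Write $$S_n(\beta)=\frac1\phi\sum_{i=1}^n z_i\,u'(z_i^T\beta)\,[y_i-h(z_i^T\beta)],\qquad F_n(\beta)=\sum_{i=1}^n z_i\,w(z_i^T\beta)\,z_i^T$$ for the score function (the gradient of the log-likelihood) and the Fisher information matrix. Assume: 1.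 There are constants $0<C_{\min}\le C_{\max}<\infty$ such that for all large $n$ all eigenvalues of $\frac1n\sum_{i=1}^n z_iz_i^T$ lie in $[C_{\min},C_{\max}]$. 2. $\max_{1\le i\le n}\|z_i\|^2=O(p_n)$ and $\sup_{\|\alpha\|=1}\sum_{i=1}^n|\alpha^Tz_i|^4=O(n)$. 3. $E(e_i^2)$ is bounded uniformly in $i\le n$ and $n$, where $e_i=y_i-h(z_i^T\beta_{0n})$. 4. $\mathcal B_n$ is compact, $z_i^T\beta\in D$ for all $\beta\in\mathcal B_n$ and $i\le n$, and $\beta_{0n}$ is an interior point of $\mathcal B_n$ whose distance to the boundary is not too small: there are $r_n>0$ with $\sqrt{p_n/n}=o(r_n)$ such that $\mathcal B_n$ contains the closed ball of radius $r_n$ around $\beta_{0n}$ (for instance, $r_n=r>0$ constant when $p_n=o(n)$). 5. On $D$, $u$ has a continuous third derivative and $w$ a continuous first derivative; the values of $h,h',u',u'',u''',w,w'$ at $z_i^T\beta$ are bounded uniformly over $\beta\in\mathcal B_n$, $i\le n$ and $n$; and $w(z_i^T\beta_{0n})$ is bounded below by a positive constant uniformly in $i\le n$ and $n$. (i) If $p_n=o(n)$,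 then there is a sequence of estimators $\hat\beta_n$ (measurable functions of $(y_1,\dots,y_n)$) such that $$P\big(S_n(\hat\beta_n)=0\big)\to1\quad\text{and}\quad \|\hat\beta_n-\beta_{0n}\|\to0\ \text{in probability, as } n\to\infty.$$ (ii) If moreover $p_n=o(\sqrt n)$, then this sequence $\hat\beta_n$ satisfies, for all unit vectors $\alpha=\alpha_n\in\mathbb R^{p_n}$, $$\alpha^TF_n^{1/2}(\beta_{0n})(\hat\beta_n-\beta_{0n})\to_d N(0,1)\quad\text{as } n\to\infty.$$ -/

import Mathlib

open MeasureTheory ProbabilityTheory Filter Asymptotics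
open scoped Topology RealInnerProductSpace MatrixOrder

/-- The ingredients of a generalized linear model. The response density with respect to the
dominating measure `ν` (for instance Lebesgue or counting measure) is
`c(y, φ) exp ((y θ - b θ) / φ)`; `h` is the inverse link function, and `D` is the range of values
allowed for the linear predictor `zᵀβ` (for instance `D = ℝ`). -/
structure GLM where
  ν : Measure ℝ
  c : ℝ → ℝ → ℝ
  b : ℝ → ℝ
  φ : ℝ
  D : Set ℝ
  h : ℝ → ℝ

namespace GLM

noncomputable section

variable (m : GLM)

/-- The density `f(y | θ, φ)`. -/
def density (θ y : ℝ) : ℝ := m.c y m.φ * Real.exp ((y * θ - m.b θ) / m.φ)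

/-- The distribution of a response with canonical parameter `θ`. -/
def law (θ : ℝ) : Measure ℝ := m.ν.withDensity fun y => ENNReal.ofReal (m.density θ y)

/-- The canonical parameters: the interior of the set of all `θ` at which `f(· | θ, φ)` is
a probability density. -/
def canonicalSpace : Set ℝ := interior {θ | IsProbabilityMeasure (m.law θ)}

/-- The mean function `μ(θ) = b'(θ)`. -/
def mean (θ : ℝ) : ℝ := deriv m.b θ

/-- The variance function `σ²(θ) = φ b''(θ)`. -/
def variance (θ : ℝ) : ℝ := m.φ * deriv (deriv m.b) θ

/-- `u = μ⁻¹ ∘ h`: the canonical parameter as a function of the linear predictor. -/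
def u (t : ℝ) : ℝ := Function.invFunOn m.mean m.canonicalSpace (m.h t)

/-- `v = σ² ∘ u`: the response variance as a function of the linear predictor. -/
def v (t : ℝ) : ℝ := m.variance (m.u t)

/-- `w = (h')² / v`. -/
def w (t : ℝ) : ℝ := deriv m.h t ^ 2 / m.v t

/-- What is part of the notion of a generalized linear model: `c(·, φ)` is measurable and
nonnegative, `φ > 0`, linear predictors range over an open interval, `h` is strictly monotone
there, its values are means of the exponential family, and the variance is positive. -/
structure IsValid : Prop where
  measurable_c : Measurable fun y => m.c y m.φ
  c_nonneg : ∀ y, 0 ≤ m.c y m.φ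
  φ_pos : 0 < m.φ
  isOpen_D : IsOpen m.D
  ordConnected_D : m.D.OrdConnected
  h_strict : StrictMonoOn m.h m.D ∨ StrictAntiOn m.h m.D
  h_mapsTo : Set.MapsTo m.h m.D (m.mean '' m.canonicalSpace)
  v_pos : ∀ t ∈ m.D, 0 < m.v t

variable {n p : ℕ}

/-- The score function: the gradient in `β` of the log-likelihood
`∑ᵢ ((yᵢ u(zᵢᵀβ) - b(u(zᵢᵀβ))) / φ + log c(yᵢ, φ))`. -/
def score (z : Fin n → EuclideanSpace ℝ (Fin p)) (y : Fin n → ℝ)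
    (β : EuclideanSpace ℝ (Fin p)) : EuclideanSpace ℝ (Fin p) :=
  m.φ⁻¹ • ∑ i, (deriv m.u ⟪z i, β⟫ * (y i - m.h ⟪z i, β⟫)) • z i

/-- The Fisher information matrix `F(β) = ∑ᵢ zᵢ w(zᵢᵀβ) zᵢᵀ`. -/
def fisher (z : Fin n → EuclideanSpace ℝ (Fin p)) (β : EuclideanSpace ℝ (Fin p)) :
    Matrix (Fin p) (Fin p) ℝ :=
  ∑ i, m.w ⟪z i, β⟫ • Matrix.vecMulVec (z i).ofLp (z i).ofLp

/-- `Y 0, …, Y (n - 1)` are independent responses of the model with design vectors `z i` and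
true parameter `β₀`. -/
structure IsSample {Ω : Type*} [MeasurableSpace Ω] (P : Measure Ω)
    (z : Fin n → EuclideanSpace ℝ (Fin p)) (β₀ : EuclideanSpace ℝ (Fin p))
    (Y : Fin n → Ω → ℝ) : Prop where
  measurable : ∀ i, Measurable (Y i)
  indep : iIndepFun Y P
  law_eq : ∀ i, P.map (Y i) = m.law (m.u ⟪z i, β₀⟫)

end

end GLM

/-- The normalized Gram matrix `(1/n) ∑ᵢ zᵢ zᵢᵀ = ZᵀZ / n` of a design. -/
noncomputable def normalizedGram {n p : ℕ} (z : Fin n → EuclideanSpace ℝ (Fin p)) :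
    Matrix (Fin p) (Fin p) ℝ :=
  (n : ℝ)⁻¹ • ∑ i, Matrix.vecMulVec (z i).ofLp (z i).ofLp

/-! The score is, up to small terms, a strongly decreasing vector field on a small ball around the
true parameter, and at the centre it is small compared with its slope times the radius. So the
log-likelihood has a maximizer inside the ball, which is a root of the score, and linearizing the
score at this root gives the normal limit.

Slope. Differentiating the score at the true parameter gives minus the Fisher information, which is
at least of order `n`, plus the random form `∑ φ⁻¹ u'' eᵢ ⟪zᵢ, x⟫²`. This form is `o(n) ‖x‖²`
uniformly in `x` (`IsErrorArray.eventually_quadForm`): the errors are truncated, as are the numbers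
`⟪zᵢ, y⟫²` (at a cost controlled by the fourth moments of the design), Hoeffding's inequality bounds
the form at one point, and a union bound runs over a net of at most `5 ^ p` points; `p = o(n)` lets
the exponential bound win. Moving away from the centre changes the slope by `o(n)` if the radius `ρ
n` tends to zero.

Uniform integrability. Truncation needs uniformly integrable squared errors, although only second
moments are assumed bounded. Here the exponential family helps (`IsValid.exists_tail_bound`):
bounded means and variances bounded below keep the tilting parameters bounded (`exists_tilt_bound`),
and then all tilts are dominated by the two extreme ones.

Root. At the centre the score has norm `O_P(√(n p))`, which is `o(n ρ)` because `√(p / n) = o(ρ)`.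
Strong monotonicity keeps the maximizer over the closed ball off the sphere (`IsGood.exists_root`)
and makes the root unique and continuous in the responses, hence measurable. It also gives the rate
`O_P(√(p / n))`.

Normality. With `a = F^(-1/2) α`, the studentized error in direction `α` equals `⟪S(β₀), a⟫` up to
`O_P(p / √n)` (`IsRegular.tendsto_remainder`), which vanishes if `p = o(√n)`. The leading term is a
weighted sum of errors with variance one and uniformly small weights, so Lindeberg's theorem applies
(`IsErrorArray.tendstoInDistribution`). -/

namespace GLM

/-! ### Exponential families: cumulants, moments, and derivatives of the link -/

variable {m : GLM}

lemma IsValid.measurable_density (hm : m.IsValid) (θ : ℝ) : Measurable (m.density θ) := by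
  have := hm.measurable_c
  unfold density
  fun_prop

/-- The laws of the family are exponential tilts of each other. -/
lemma IsValid.law_eq_withDensity (hm : m.IsValid) (θ₀ θ : ℝ) :
    m.law θ = (m.law θ₀).withDensity fun y =>
      ENNReal.ofReal (Real.exp ((θ - θ₀) / m.φ * y - (m.b θ - m.b θ₀) / m.φ)) := by
  have hφ := hm.φ_pos
  unfold law
  rw [← withDensity_mul _ (hm.measurable_density θ₀).ennreal_ofReal (by fun_prop)]
  congr 1
  ext y
  have h0 : 0 ≤ m.density θ₀ y := mul_nonneg (hm.c_nonneg y) (Real.exp_nonneg _)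
  rw [Pi.mul_apply, ← ENNReal.ofReal_mul h0]
  congr 1
  unfold density
  rw [mul_assoc, ← Real.exp_add]
  congr 2
  field_simp
  ring

lemma IsValid.lintegral_exp (hm : m.IsValid) {θ₀ θ : ℝ} (hθ : IsProbabilityMeasure (m.law θ)) :
    ∫⁻ y, ENNReal.ofReal (Real.exp ((θ - θ₀) / m.φ * y)) ∂(m.law θ₀) =
      ENNReal.ofReal (Real.exp ((m.b θ - m.b θ₀) / m.φ)) := by
  have h1 := hθ.measure_univ
  rw [hm.law_eq_withDensity θ₀ θ, withDensity_apply _ MeasurableSet.univ,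
    Measure.restrict_univ] at h1
  have h2 : ∀ y, ENNReal.ofReal (Real.exp ((θ - θ₀) / m.φ * y)) =
      ENNReal.ofReal (Real.exp ((m.b θ - m.b θ₀) / m.φ)) *
      ENNReal.ofReal (Real.exp ((θ - θ₀) / m.φ * y - (m.b θ - m.b θ₀) / m.φ)) := by
    intro y
    rw [← ENNReal.ofReal_mul (Real.exp_nonneg _), ← Real.exp_add]
    congr 2
    ring
  simp_rw [h2]
  rw [lintegral_const_mul _ (by fun_prop), h1, mul_one]

lemma IsValid.integrable_exp (hm : m.IsValid) {θ₀ θ : ℝ} (hθ : IsProbabilityMeasure (m.law θ)) :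
    Integrable (fun y => Real.exp ((θ - θ₀) / m.φ * y)) (m.law θ₀) := by
  refine ⟨by fun_prop, ?_⟩
  rw [hasFiniteIntegral_iff_ofReal (ae_of_all _ fun y => Real.exp_nonneg _), hm.lintegral_exp hθ]
  exact ENNReal.ofReal_lt_top

lemma IsValid.integral_exp (hm : m.IsValid) {θ₀ θ : ℝ} (hθ : IsProbabilityMeasure (m.law θ)) :
    ∫ y, Real.exp ((θ - θ₀) / m.φ * y) ∂(m.law θ₀) = Real.exp ((m.b θ - m.b θ₀) / m.φ) := by
  rw [integral_eq_lintegral_of_nonneg_ae (ae_of_all _ fun y => Real.exp_nonneg _) (by fun_prop),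
    hm.lintegral_exp hθ, ENNReal.toReal_ofReal (Real.exp_nonneg _)]

lemma isProbabilityMeasure_law {θ : ℝ} (hθ : θ ∈ m.canonicalSpace) :
    IsProbabilityMeasure (m.law θ) :=
  interior_subset (s := {θ | IsProbabilityMeasure (m.law θ)}) hθ

lemma eventually_isProbabilityMeasure_law {θ : ℝ} (hθ : θ ∈ m.canonicalSpace) :
    ∀ᶠ θ' in 𝓝 θ, IsProbabilityMeasure (m.law θ') :=
  (isOpen_interior.eventually_mem hθ).mono fun _ h => isProbabilityMeasure_law h

/-- Tilting the law at `θ` by `s` gives, up to normalization, the law at `θ + φ s`, and this is a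
probability measure for all small `s` because the canonical space is open. -/
lemma IsValid.zero_mem_interior_integrableExpSet (hm : m.IsValid) {θ : ℝ}
    (hθ : θ ∈ m.canonicalSpace) : (0 : ℝ) ∈ interior (integrableExpSet id (m.law θ)) := by
  have hφ := hm.φ_pos
  rw [mem_interior_iff_mem_nhds]
  have hc : Tendsto (fun s : ℝ => θ + m.φ * s) (𝓝 0) (𝓝 θ) := by
    have : Continuous fun s : ℝ => θ + m.φ * s := by fun_prop
    simpa using this.tendsto 0
  filter_upwards [hc.eventually (eventually_isProbabilityMeasure_law hθ)] with s hs
  have := hm.integrable_exp (θ₀ := θ) hs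
  simpa [integrableExpSet, hφ.ne'] using this

/-- Normalization of the density forces this form. It makes `b` analytic and turns the moments of
the law into derivatives of `b`, with no smoothness assumed of `b`. -/
lemma IsValid.b_eventuallyEq (hm : m.IsValid) {θ : ℝ} (hθ : θ ∈ m.canonicalSpace) :
    m.b =ᶠ[𝓝 θ] fun x => m.b θ + m.φ * cgf id (m.law θ) ((x - θ) / m.φ) := by
  have hφ := hm.φ_pos
  filter_upwards [eventually_isProbabilityMeasure_law hθ] with x hx
  have := hm.integral_exp (θ₀ := θ) hx
  simp only [cgf, mgf, id]
  rw [this, Real.log_exp]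
  field_simp
  ring

lemma IsValid.deriv_b_eventuallyEq (hm : m.IsValid) {θ : ℝ} (hθ : θ ∈ m.canonicalSpace) :
    m.mean =ᶠ[𝓝 θ] fun x => deriv (cgf id (m.law θ)) ((x - θ) / m.φ) := by
  have hφ := hm.φ_pos
  have hc : Tendsto (fun x : ℝ => (x - θ) / m.φ) (𝓝 θ) (𝓝 0) := by
    have : Continuous fun x : ℝ => (x - θ) / m.φ := by fun_prop
    simpa using this.tendsto θ
  have h1 := hc.eventually (isOpen_interior.eventually_mem
    (hm.zero_mem_interior_integrableExpSet hθ))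
  filter_upwards [(hm.b_eventuallyEq hθ).eventuallyEq_nhds, h1] with x hx hx1
  unfold mean
  rw [hx.deriv_eq]
  have hd : HasDerivAt (fun x : ℝ => (x - θ) / m.φ) (1 / m.φ) x :=
    ((hasDerivAt_id x).sub_const θ).div_const _
  have h2 := ((((analyticAt_cgf hx1).differentiableAt.hasDerivAt.comp x hd).const_mul
    m.φ).const_add (m.b θ)).deriv
  simp only [Function.comp_def] at h2
  rw [h2]
  field_simp

lemma IsValid.differentiableAt_mean (hm : m.IsValid) {θ : ℝ} (hθ : θ ∈ m.canonicalSpace) :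
    DifferentiableAt ℝ m.mean θ := by
  rw [(hm.deriv_b_eventuallyEq hθ).differentiableAt_iff]
  have h0 : DifferentiableAt ℝ (deriv (cgf id (m.law θ))) ((θ - θ) / m.φ) := by
    rw [sub_self, zero_div]
    exact (analyticAt_cgf (hm.zero_mem_interior_integrableExpSet hθ)).deriv.differentiableAt
  have hd : DifferentiableAt ℝ (fun x : ℝ => (x - θ) / m.φ) θ := by fun_prop
  exact h0.comp θ hd

lemma IsValid.memLp_id_law (hm : m.IsValid) {θ : ℝ} (hθ : θ ∈ m.canonicalSpace) :
    MemLp id 2 (m.law θ) := by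
  have := isProbabilityMeasure_law hθ
  -- Tilting by the parameter `0` leaves the law unchanged.
  have := memLp_tilted_mul (hm.zero_mem_interior_integrableExpSet hθ) 2
  simpa using this

lemma IsValid.integral_id_law (hm : m.IsValid) {θ : ℝ} (hθ : θ ∈ m.canonicalSpace) :
    ∫ y, y ∂(m.law θ) = m.mean θ := by
  have := isProbabilityMeasure_law hθ
  have h := deriv_cgf_zero (hm.zero_mem_interior_integrableExpSet hθ)
  rw [(hm.deriv_b_eventuallyEq hθ).eq_of_nhds]
  simpa using h.symm

lemma IsValid.variance_id_law (hm : m.IsValid) {θ : ℝ} (hθ : θ ∈ m.canonicalSpace) :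
    Var[id; m.law θ] = m.variance θ := by
  have := isProbabilityMeasure_law hθ
  have hφ := hm.φ_pos
  have h := variance_tilted_mul (hm.zero_mem_interior_integrableExpSet hθ)
  simp only [zero_mul] at h
  rw [tilted_const, iteratedDeriv_succ, iteratedDeriv_one] at h
  rw [h, GLM.variance]
  have h1 : deriv (deriv m.b) θ = deriv m.mean θ := rfl
  rw [h1, (hm.deriv_b_eventuallyEq hθ).deriv_eq]
  have hd : HasDerivAt (fun x : ℝ => (x - θ) / m.φ) (1 / m.φ) θ :=
    ((hasDerivAt_id θ).sub_const θ).div_const _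
  have h0 : HasDerivAt (deriv (cgf id (m.law θ))) (deriv (deriv (cgf id (m.law θ))) 0)
      ((θ - θ) / m.φ) := by
    rw [sub_self, zero_div]
    exact (analyticAt_cgf
      (hm.zero_mem_interior_integrableExpSet hθ)).deriv.differentiableAt.hasDerivAt
  have h2 := (h0.comp θ hd).deriv
  simp only [Function.comp_def] at h2
  rw [h2]
  field_simp

lemma IsValid.u_mem (hm : m.IsValid) {t : ℝ} (ht : t ∈ m.D) : m.u t ∈ m.canonicalSpace :=
  Function.invFunOn_mem (hm.h_mapsTo ht)

lemma IsValid.mean_u (hm : m.IsValid) {t : ℝ} (ht : t ∈ m.D) : m.mean (m.u t) = m.h t :=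
  Function.invFunOn_eq (hm.h_mapsTo ht)

lemma IsValid.b_hasDerivAt (hm : m.IsValid) {t : ℝ} (ht : t ∈ m.D) :
    HasDerivAt m.b (m.h t) (m.u t) := by
  rw [← hm.mean_u ht]
  refine DifferentiableAt.hasDerivAt ?_
  rw [(hm.b_eventuallyEq (hm.u_mem ht)).differentiableAt_iff]
  have h0 : DifferentiableAt ℝ (cgf id (m.law (m.u t))) ((m.u t - m.u t) / m.φ) := by
    rw [sub_self, zero_div]
    exact (analyticAt_cgf (hm.zero_mem_interior_integrableExpSet (hm.u_mem ht))).differentiableAt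
  have hd : DifferentiableAt ℝ (fun x : ℝ => (x - m.u t) / m.φ) (m.u t) := by fun_prop
  exact ((h0.comp (m.u t) hd).const_mul m.φ).const_add _

lemma u_hasDerivAt (hD : IsOpen m.D) (hu : ContDiffOn ℝ 3 m.u m.D) {t : ℝ} (ht : t ∈ m.D) :
    HasDerivAt m.u (deriv m.u t) t :=
  ((hu.contDiffAt (hD.mem_nhds ht)).differentiableAt (by norm_num)).hasDerivAt

/-- On the open set `D` the inverse link is the composition of the mean function with `u`, so its
smoothness is inherited and the chain rule applies. -/
lemma IsValid.h_hasDerivAt (hm : m.IsValid) (hu : ContDiffOn ℝ 3 m.u m.D) {t : ℝ}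
    (ht : t ∈ m.D) : HasDerivAt m.h (m.v t / m.φ * deriv m.u t) t := by
  have h1 := (hm.differentiableAt_mean (hm.u_mem ht)).hasDerivAt.comp t
    (u_hasDerivAt hm.isOpen_D hu ht)
  have h2 : m.v t / m.φ = deriv m.mean (m.u t) := by
    have := hm.φ_pos
    unfold v GLM.variance mean
    field_simp
  rw [h2]
  refine h1.congr_of_eventuallyEq ?_
  filter_upwards [hm.isOpen_D.mem_nhds ht] with s hs
  exact (hm.mean_u hs).symm

lemma IsValid.deriv_h (hm : m.IsValid) (hu : ContDiffOn ℝ 3 m.u m.D) {t : ℝ} (ht : t ∈ m.D) :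
    deriv m.h t = m.v t / m.φ * deriv m.u t := (hm.h_hasDerivAt hu ht).deriv

lemma IsValid.w_eq (hm : m.IsValid) (hu : ContDiffOn ℝ 3 m.u m.D) {t : ℝ} (ht : t ∈ m.D) :
    m.w t = deriv m.u t * deriv m.h t / m.φ := by
  have := hm.φ_pos
  have := hm.v_pos t ht
  rw [w, hm.deriv_h hu ht]
  field_simp

/-- This is the information identity: the variance of the score of one response equals its Fisher
weight. It normalizes the variance in the central limit theorem and converts the lower bound on `w`
into one on `v`. -/
lemma IsValid.w_eq_v (hm : m.IsValid) (hu : ContDiffOn ℝ 3 m.u m.D) {t : ℝ} (ht : t ∈ m.D) :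
    m.w t = (deriv m.u t / m.φ) ^ 2 * m.v t := by
  have := hm.φ_pos
  rw [hm.w_eq hu ht, hm.deriv_h hu ht]
  field_simp

/-- The derivative of `t ↦ u'(t) (y - h t) / φ`, the score of a single response. -/
lemma IsValid.score_hasDerivAt (hm : m.IsValid) (hu : ContDiffOn ℝ 3 m.u m.D) (y : ℝ) {t : ℝ}
    (ht : t ∈ m.D) :
    HasDerivAt (fun s => m.φ⁻¹ * (deriv m.u s * (y - m.h s)))
      (m.φ⁻¹ * iteratedDeriv 2 m.u t * (y - m.h t) - m.w t) t := by
  have hφ := hm.φ_pos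
  have h2 : HasDerivAt (deriv m.u) (iteratedDeriv 2 m.u t) t := by
    have h : ContDiffAt ℝ 2 (deriv m.u) t :=
      (hu.contDiffAt (hm.isOpen_D.mem_nhds ht)).derivWithin (by norm_num)
    rw [iteratedDeriv_succ, iteratedDeriv_one]
    exact (h.differentiableAt (by norm_num)).hasDerivAt
  have h3 := ((h2.mul ((hm.h_hasDerivAt hu ht).const_sub y)).const_mul m.φ⁻¹)
  refine h3.congr_deriv ?_
  rw [hm.w_eq hu ht, hm.deriv_h hu ht]
  field_simp
  ring

lemma u_two_hasDerivAt (hD : IsOpen m.D) (hu : ContDiffOn ℝ 3 m.u m.D) {t : ℝ} (ht : t ∈ m.D) :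
    HasDerivAt (iteratedDeriv 2 m.u) (iteratedDeriv 3 m.u t) t := by
  have h1 : ContDiffAt ℝ 2 (deriv m.u) t := (hu.contDiffAt (hD.mem_nhds ht)).derivWithin (by norm_num)
  have h2 : ContDiffAt ℝ 1 (iteratedDeriv 2 m.u) t := by
    rw [iteratedDeriv_succ, iteratedDeriv_one]
    exact h1.derivWithin (by norm_num)
  rw [iteratedDeriv_succ (n := 2)]
  exact (h2.differentiableAt (by norm_num)).hasDerivAt

/-- The derivative of the log-likelihood of a single response. -/
lemma IsValid.loglik_hasDerivAt (hm : m.IsValid) (hu : ContDiffOn ℝ 3 m.u m.D) (y : ℝ) {t : ℝ}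
    (ht : t ∈ m.D) :
    HasDerivAt (fun s => m.φ⁻¹ * (y * m.u s - m.b (m.u s)))
      (m.φ⁻¹ * (deriv m.u t * (y - m.h t))) t := by
  have h1 := u_hasDerivAt hm.isOpen_D hu ht
  have h2 := (((h1.const_mul y).sub ((hm.b_hasDerivAt ht).comp t h1)).const_mul m.φ⁻¹)
  refine h2.congr_deriv ?_
  ring

end GLM

/-! ### Uniform integrability of the squared errors -/

/-- Exponential tilts `exp (s X - B) Q` with `B ≤ M s` and variance bounded below have bounded
tilting parameter `s`: as `s → ∞`, such tilts would concentrate at the right end of the support. -/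
lemma exists_tilt_bound {Ω : Type*} [MeasurableSpace Ω] (Q : Measure Ω) [IsProbabilityMeasure Q]
    {X : Ω → ℝ} (hX : Measurable X) (M : ℝ) {c : ℝ} (hc : 0 < c) :
    ∃ S : ℝ, ∀ s B : ℝ, Integrable (fun ω => Real.exp (s * X ω - B)) Q →
      ∫ ω, Real.exp (s * X ω - B) ∂Q = 1 → B ≤ M * s →
      (∀ L : ℝ, Integrable (fun ω => (X ω - L) ^ 2 * Real.exp (s * X ω - B)) Q ∧
        c ≤ ∫ ω, (X ω - L) ^ 2 * Real.exp (s * X ω - B) ∂Q) → s ≤ S := by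
  by_contra! hcon
  -- Markov's inequality: on `{l < X}` the tilted density is at least `exp (s l - B)`, and its total
  -- mass is one.
  have htail : ∀ l s B : ℝ, 0 ≤ s → Integrable (fun ω => Real.exp (s * X ω - B)) Q →
      ∫ ω, Real.exp (s * X ω - B) ∂Q = 1 →
      Q.real {ω | l < X ω} * Real.exp (s * l - B) ≤ 1 := by
    intro l s B hs hi h1
    have hm : MeasurableSet {ω | l < X ω} := measurableSet_lt measurable_const hX
    rw [← h1, ← smul_eq_mul, ← setIntegral_const]
    refine (setIntegral_mono_on (integrableOn_const (by simp)) hi.integrableOn hm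
      fun ω hω => ?_).trans
      (setIntegral_le_integral hi (ae_of_all _ fun ω => Real.exp_nonneg _))
    have : l < X ω := hω
    gcongr
  -- As `B ≤ M s`, the density beyond `M + η` is at least `exp (s η)` for arbitrarily large `s`, so
  -- no mass can lie there.
  have hM0 : ∀ η > 0, Q.real {ω | M + η < X ω} = 0 := by
    intro η hη
    have h1 : ∀ k : ℕ, Q.real {ω | M + η < X ω} ≤ Real.exp (-(k : ℝ) * η) := by
      intro k
      obtain ⟨s, B, hi, h1, hB, -, hs⟩ := hcon k
      have hs0 : (0 : ℝ) ≤ s := (Nat.cast_nonneg k).trans hs.le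
      have h2 := htail (M + η) s B hs0 hi h1
      have h3 : Real.exp (k * η) ≤ Real.exp (s * (M + η) - B) := by
        have : (k : ℝ) * η ≤ s * η := by gcongr
        gcongr
        linarith
      have h4 : Q.real {ω | M + η < X ω} * Real.exp (k * η) ≤ 1 :=
        (mul_le_mul_of_nonneg_left h3 measureReal_nonneg).trans h2
      rw [neg_mul, Real.exp_neg, ← one_div, le_div_iff₀ (Real.exp_pos _)]
      exact h4
    refine le_antisymm ?_ measureReal_nonneg
    refine ge_of_tendsto' (x := atTop) ?_ h1
    refine Real.tendsto_exp_atBot.comp ?_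
    have : Tendsto (fun k : ℕ => (k : ℝ) * η) atTop atTop :=
      tendsto_natCast_atTop_atTop.atTop_mul_const hη
    exact (tendsto_neg_atTop_atBot.comp this).congr fun k => (neg_mul _ _).symm
  obtain ⟨ε, hε, hεc⟩ : ∃ ε > 0, ε ^ 2 ≤ c / 2 :=
    ⟨√(c / 2), by positivity, (Real.sq_sqrt (by positivity)).le⟩
  have hex : ∃ k : ℕ, Q.real {ω | M + ε / 2 - k * (ε / 2) < X ω} ≠ 0 := by
    by_contra! hall
    have h1 : Q (⋃ k : ℕ, {ω | M + ε / 2 - k * (ε / 2) < X ω}) = 0 := by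
      refine measure_iUnion_null fun k => ?_
      have := hall k
      rwa [measureReal_eq_zero_iff] at this
    have h2 : (⋃ k : ℕ, {ω | M + ε / 2 - k * (ε / 2) < X ω}) = Set.univ := by
      refine Set.eq_univ_of_forall fun ω => Set.mem_iUnion.2 ?_
      obtain ⟨k, hk⟩ := exists_nat_gt ((M + ε / 2 - X ω) / (ε / 2))
      refine ⟨k, ?_⟩
      rw [div_lt_iff₀ (by positivity)] at hk
      simp only [Set.mem_ofPred_eq]
      linarith
    rw [h2, measure_univ] at h1
    exact one_ne_zero h1
  -- `L` approximates the essential supremum of `X` from above: walk down from `M + ε / 2` in steps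
  -- of `ε / 2` and stop just before mass first appears.
  obtain ⟨L, hL0, hq⟩ : ∃ L : ℝ, Q.real {ω | L < X ω} = 0 ∧ 0 < Q.real {ω | L - ε / 2 < X ω} := by
    classical
    have h1 := Nat.find_spec hex
    have h2 : Nat.find hex ≠ 0 := by
      intro h0
      rw [h0] at h1
      simp only [Nat.cast_zero, zero_mul, sub_zero] at h1
      exact h1 (hM0 _ (by positivity))
    obtain ⟨k, hk⟩ := Nat.exists_eq_succ_of_ne_zero h2
    refine ⟨M + ε / 2 - k * (ε / 2), ?_, ?_⟩
    · have := Nat.find_min hex (m := k) (by omega)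
      push Not at this
      exact this
    · rw [hk] at h1
      refine lt_of_le_of_ne measureReal_nonneg (Ne.symm ?_)
      convert! h1 using 5
      push_cast
      ring
  set q := Q.real {ω | L - ε / 2 < X ω}
  obtain ⟨k, hk⟩ : ∃ k : ℝ, 1 ≤ k ∧ ∀ s ≥ k, Real.exp (ε - s * (ε / 2)) < q * (c / 2) := by
    have h1 : Tendsto (fun s : ℝ => Real.exp (ε - s * (ε / 2))) atTop (𝓝 0) := by
      refine Real.tendsto_exp_atBot.comp (tendsto_atBot_add_const_left _ _ ?_)
      exact tendsto_neg_atTop_atBot.comp (tendsto_id.atTop_mul_const (by positivity))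
    have h2 := h1.eventually_lt_const (show 0 < q * (c / 2) by positivity)
    obtain ⟨k, hk⟩ := eventually_atTop.1 h2
    exact ⟨max k 1, le_max_right _ _, fun s hs => hk s ((le_max_left _ _).trans hs)⟩
  obtain ⟨s, B, hi, h1, hB, hv, hs⟩ := hcon k
  have hs1 : 1 ≤ s := hk.1.trans hs.le
  have h2 := htail (L - ε / 2) s B (by linarith) hi h1
  have hLs : ∀ᵐ ω ∂Q, X ω ≤ L := by
    rw [measureReal_eq_zero_iff] at hL0
    rw [ae_iff]
    simpa using hL0
  -- With `Z = L - X ≥ 0`, the part `Z ≤ ε` contributes at most `ε² ≤ c / 2` to the second moment.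
  -- On `Z > ε` the bound `Z² ≤ exp Z` costs one unit of `s`, leaving `exp (-(s - 1) ε)` up to the
  -- factor `exp (s L - B)`.
  have h3 : ∫ ω, (X ω - L) ^ 2 * Real.exp (s * X ω - B) ∂Q ≤
      ∫ ω, (ε ^ 2 * Real.exp (s * X ω - B) + Real.exp (-(s - 1) * ε + (s * L - B))) ∂Q := by
    refine integral_mono_ae (hv L).1 ((hi.const_mul _).add (integrable_const _)) ?_
    filter_upwards [hLs] with ω hω
    set Z := L - X ω
    have hZ : 0 ≤ Z := sub_nonneg.2 hω
    have hXZ : s * X ω - B = -s * Z + (s * L - B) := by simp only [Z]; ring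
    have hX2 : (X ω - L) ^ 2 = Z ^ 2 := by simp only [Z]; ring
    rw [hX2]
    by_cases hZε : Z ≤ ε
    · have : Z ^ 2 ≤ ε ^ 2 := by gcongr
      have := mul_le_mul_of_nonneg_right this (Real.exp_nonneg (s * X ω - B))
      have := Real.exp_nonneg (-(s - 1) * ε + (s * L - B))
      linarith
    · push Not at hZε
      have hz : Z ^ 2 ≤ Real.exp Z := by
        have := Real.quadratic_le_exp_of_nonneg hZ
        have h3 : Z / 2 + 1 ≤ Real.exp (Z / 2) := Real.add_one_le_exp _
        have h4 : Real.exp Z = Real.exp (Z / 4) ^ 4 := by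
          rw [← Real.exp_nat_mul]; congr 1; push_cast; ring
        have h5 : Z / 4 + 1 ≤ Real.exp (Z / 4) := Real.add_one_le_exp _
        have h6 : Z ≤ (Z / 4 + 1) ^ 2 := by nlinarith [sq_nonneg (Z / 4 - 1)]
        rw [h4]
        calc Z ^ 2 ≤ ((Z / 4 + 1) ^ 2) ^ 2 := by gcongr
          _ = (Z / 4 + 1) ^ 4 := by ring
          _ ≤ _ := by gcongr
      have h5 : Z ^ 2 * Real.exp (s * X ω - B) ≤ Real.exp (-(s - 1) * ε + (s * L - B)) := by
        calc Z ^ 2 * Real.exp (s * X ω - B) ≤ Real.exp Z * Real.exp (s * X ω - B) := by gcongr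
          _ = Real.exp (-(s - 1) * Z + (s * L - B)) := by
            rw [← Real.exp_add, hXZ]; congr 1; ring
          _ ≤ _ := by
            have := mul_le_mul_of_nonneg_left hZε.le (show 0 ≤ s - 1 by linarith)
            exact Real.exp_le_exp.2 (by linarith)
      have := Real.exp_nonneg (s * X ω - B)
      nlinarith [sq_nonneg ε]
  rw [integral_add (hi.const_mul _) (integrable_const _), integral_const_mul, h1] at h3
  simp only [integral_const, probReal_univ, one_smul, mul_one] at h3
  -- The unknown factor `exp (s L - B)` is controlled by the mass `q` near `L`, at the price of half
  -- of the exponent. Large `s` now contradicts the lower bound `c` on the second moment.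
  have h4 : q * Real.exp (-(s - 1) * ε + (s * L - B)) ≤ Real.exp (ε - s * (ε / 2)) := by
    have : Real.exp (-(s - 1) * ε + (s * L - B)) =
        Real.exp (s * (L - ε / 2) - B) * Real.exp (ε - s * (ε / 2)) := by
      rw [← Real.exp_add]; congr 1; ring
    rw [this, ← mul_assoc]
    exact mul_le_of_le_one_left (Real.exp_nonneg _) h2
  have h5 := hk.2 s hs.le
  have h6 := (hv L).2
  have h7 : c / 2 ≤ Real.exp (-(s - 1) * ε + (s * L - B)) := by linarith
  have := mul_le_mul_of_nonneg_left h7 hq.le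
  linarith

namespace GLM

variable {m : GLM}

lemma IsValid.integral_law_eq (hm : m.IsValid) (θ₀ θ : ℝ) (g : ℝ → ℝ) :
    ∫ y, g y ∂(m.law θ) =
      ∫ y, g y * Real.exp ((θ - θ₀) / m.φ * y - (m.b θ - m.b θ₀) / m.φ) ∂(m.law θ₀) := by
  rw [hm.law_eq_withDensity θ₀ θ, integral_withDensity_eq_integral_toReal_smul (by fun_prop)
    (ae_of_all _ fun y => ENNReal.ofReal_lt_top)]
  refine integral_congr_ae (ae_of_all _ fun y => ?_)
  simp only [smul_eq_mul]
  rw [ENNReal.toReal_ofReal (Real.exp_nonneg _), mul_comm]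

lemma IsValid.integrable_law_iff (hm : m.IsValid) (θ₀ θ : ℝ) (g : ℝ → ℝ) :
    Integrable g (m.law θ) ↔
      Integrable (fun y => g y * Real.exp ((θ - θ₀) / m.φ * y - (m.b θ - m.b θ₀) / m.φ))
        (m.law θ₀) := by
  rw [hm.law_eq_withDensity θ₀ θ, integrable_withDensity_iff (by fun_prop)
    (ae_of_all _ fun y => ENNReal.ofReal_lt_top)]
  simp_rw [ENNReal.toReal_ofReal (Real.exp_nonneg _)]

lemma IsValid.integrable_id_law (hm : m.IsValid) {θ : ℝ} (hθ : θ ∈ m.canonicalSpace) :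
    Integrable (fun y => y) (m.law θ) := by
  have := isProbabilityMeasure_law hθ
  exact (hm.memLp_id_law hθ).integrable (by norm_num)

lemma IsValid.integrable_sq_law (hm : m.IsValid) {θ : ℝ} (hθ : θ ∈ m.canonicalSpace) (a : ℝ) :
    Integrable (fun y => (y - a) ^ 2) (m.law θ) := by
  have := isProbabilityMeasure_law hθ
  exact ((hm.memLp_id_law hθ).sub (memLp_const a)).integrable_sq

/-- The convexity of the cumulant function. -/
lemma IsValid.le_b_sub (hm : m.IsValid) {θ₀ θ : ℝ} (hθ₀ : θ₀ ∈ m.canonicalSpace)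
    (hθ : θ ∈ m.canonicalSpace) :
    (θ - θ₀) / m.φ * m.mean θ₀ ≤ (m.b θ - m.b θ₀) / m.φ := by
  have := isProbabilityMeasure_law hθ₀
  have := isProbabilityMeasure_law hθ
  have h1 := hm.integral_law_eq θ₀ θ (fun _ => 1)
  have hi := (hm.integrable_law_iff θ₀ θ (fun _ => 1)).1 (integrable_const _)
  simp only [integral_const, probReal_univ, smul_eq_mul, one_mul] at h1 hi
  -- The tangent inequality `1 + x ≤ exp x`, integrated against a tilt of mass one.
  have h2 : ∫ y, (1 + ((θ - θ₀) / m.φ * y - (m.b θ - m.b θ₀) / m.φ)) ∂(m.law θ₀) ≤ 1 := by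
    nth_rewrite 2 [h1]
    refine integral_mono ?_ hi fun y => ?_
    · exact (integrable_const (1 : ℝ)).add
        (((hm.integrable_id_law hθ₀).const_mul _).sub (integrable_const _))
    · have := Real.add_one_le_exp ((θ - θ₀) / m.φ * y - (m.b θ - m.b θ₀) / m.φ)
      simp only at this ⊢
      linarith
  have hi3 : Integrable (fun y => (θ - θ₀) / m.φ * y - (m.b θ - m.b θ₀) / m.φ) (m.law θ₀) :=
    ((hm.integrable_id_law hθ₀).const_mul _).sub (integrable_const _)
  rw [integral_add (integrable_const _) hi3,
    integral_sub ((hm.integrable_id_law hθ₀).const_mul _) (integrable_const _),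
    integral_const_mul, hm.integral_id_law hθ₀] at h2
  simp only [integral_const, probReal_univ, smul_eq_mul, one_mul] at h2
  linarith

lemma IsValid.variance_le_integral_sq (hm : m.IsValid) {θ : ℝ} (hθ : θ ∈ m.canonicalSpace)
    (a : ℝ) : m.variance θ ≤ ∫ y, (y - a) ^ 2 ∂(m.law θ) := by
  have := isProbabilityMeasure_law hθ
  rw [← hm.variance_id_law hθ, ← variance_sub_const (c := a)
    (measurable_id.aestronglyMeasurable)]
  exact variance_le_expectation_sq (by fun_prop)

/-- Parameters of bounded mean and of variance bounded below form a bounded set. -/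
lemma IsValid.bounded_of_moment_bounds (hm : m.IsValid) {A : Set ℝ} (hA : A ⊆ m.canonicalSpace)
    {M c : ℝ} (hc : 0 < c) (hmean : ∀ θ ∈ A, |m.mean θ| ≤ M) (hvar : ∀ θ ∈ A, c ≤ m.variance θ)
    {θ₀ : ℝ} (hθ₀ : θ₀ ∈ A) : ∃ S : ℝ, ∀ θ ∈ A, |(θ - θ₀) / m.φ| ≤ S := by
  have := isProbabilityMeasure_law (hA hθ₀)
  obtain ⟨S₁, h1⟩ := exists_tilt_bound (m.law θ₀) measurable_id M hc
  obtain ⟨S₂, h2⟩ := exists_tilt_bound (m.law θ₀) measurable_neg M hc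
  refine ⟨max 0 (max S₁ S₂), fun θ hθ => ?_⟩
  have hP := isProbabilityMeasure_law (hA hθ)
  have hi := (hm.integrable_law_iff θ₀ θ (fun _ => 1)).1 (integrable_const _)
  have hi1 := hm.integral_law_eq θ₀ θ (fun _ => 1)
  simp only [integral_const, probReal_univ, smul_eq_mul, one_mul] at hi hi1
  have hB := hm.le_b_sub (hA hθ) (hA hθ₀)
  -- The tangent of `b` is taken at `θ`, whose mean is bounded; this supplies `B ≤ M s` for
  -- `exists_tilt_bound`.
  have hB' : (m.b θ - m.b θ₀) / m.φ ≤ (θ - θ₀) / m.φ * m.mean θ := by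
    have e1 : (m.b θ₀ - m.b θ) / m.φ = -((m.b θ - m.b θ₀) / m.φ) := by ring
    have e2 : (θ₀ - θ) / m.φ * m.mean θ = -((θ - θ₀) / m.φ * m.mean θ) := by ring
    linarith
  have hM := abs_le.1 (hmean θ hθ)
  rcases le_total 0 ((θ - θ₀) / m.φ) with hs | hs
  · rw [abs_of_nonneg hs]
    refine le_max_of_le_right (le_max_of_le_left (h1 _ ((m.b θ - m.b θ₀) / m.φ) hi hi1.symm
      (hB'.trans ?_) fun L => ⟨?_, ?_⟩))
    · rw [mul_comm M]; exact mul_le_mul_of_nonneg_left hM.2 hs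
    · exact (hm.integrable_law_iff θ₀ θ _).1 (hm.integrable_sq_law (hA hθ) L)
    · exact (hvar θ hθ).trans ((hm.variance_le_integral_sq (hA hθ) L).trans
        (hm.integral_law_eq θ₀ θ _).le)
  -- A negative tilt of the identity is a positive tilt of its negative.
  · rw [abs_of_nonpos hs]
    refine le_max_of_le_right (le_max_of_le_right (h2 _ ((m.b θ - m.b θ₀) / m.φ) ?_ ?_
      (hB'.trans ?_) fun L => ⟨?_, ?_⟩))
    · simpa only [neg_mul_neg] using hi
    · simpa only [neg_mul_neg] using hi1.symm
    · nlinarith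
    · have := (hm.integrable_law_iff θ₀ θ _).1 (hm.integrable_sq_law (hA hθ) (-L))
      refine this.congr (ae_of_all _ fun y => ?_)
      simp only [neg_mul_neg]
      ring
    · refine (hvar θ hθ).trans ((hm.variance_le_integral_sq (hA hθ) (-L)).trans
        ((hm.integral_law_eq θ₀ θ _).le.trans_eq (integral_congr_ae (ae_of_all _ fun y => ?_))))
      simp only [neg_mul_neg]
      ring

/-- The squares of the errors are uniformly integrable over parameters with bounded mean, bounded
variance, and variance bounded below. -/
lemma IsValid.exists_tail_bound (hm : m.IsValid) {A : Set ℝ} (hA : A ⊆ m.canonicalSpace)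
    {M c V : ℝ} (hc : 0 < c) (hmean : ∀ θ ∈ A, |m.mean θ| ≤ M)
    (hvar : ∀ θ ∈ A, c ≤ m.variance θ) (hvar' : ∀ θ ∈ A, m.variance θ ≤ V) {ε : ℝ} (hε : 0 < ε) :
    ∃ K : ℝ, 1 ≤ K ∧ ∀ θ ∈ A,
      ∫ y, {y | K < |y - m.mean θ|}.indicator (fun y => (y - m.mean θ) ^ 2) y ∂(m.law θ) ≤ ε := by
  rcases A.eq_empty_or_nonempty with rfl | ⟨θ₀, hθ₀⟩
  · exact ⟨1, le_rfl, by simp⟩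
  have hQ := isProbabilityMeasure_law (hA hθ₀)
  obtain ⟨S, hS⟩ := hm.bounded_of_moment_bounds hA hc hmean hvar hθ₀
  set Q := m.law θ₀
  set s : ℝ → ℝ := fun θ => (θ - θ₀) / m.φ with hs
  have hM0 : 0 ≤ M := (abs_nonneg _).trans (hmean θ₀ hθ₀)
  have hS0 : 0 ≤ S := (abs_nonneg _).trans (hS θ₀ hθ₀)
  have habs : ∀ {a b : ℝ}, |a| ≤ S → |b| ≤ M → a * b ≤ S * M ∧ -(S * M) ≤ a * b := by
    intro a b ha hb
    have h1 : |a * b| ≤ S * M := by rw [abs_mul]; gcongr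
    exact ⟨(abs_le.1 h1).2, (abs_le.1 h1).1⟩
  have hBle : ∀ θ ∈ A, (m.b θ - m.b θ₀) / m.φ ≤ S * M := by
    intro θ hθ
    have h1 := hm.le_b_sub (hA hθ) (hA hθ₀)
    have h2 := (habs (hS θ hθ) (hmean θ hθ)).1
    have e1 : (m.b θ₀ - m.b θ) / m.φ = -((m.b θ - m.b θ₀) / m.φ) := by ring
    have e2 : (θ₀ - θ) / m.φ * m.mean θ = -((θ - θ₀) / m.φ * m.mean θ) := by ring
    linarith
  have hBge : ∀ θ ∈ A, -(S * M) ≤ (m.b θ - m.b θ₀) / m.φ := fun θ hθ =>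
    ((habs (hS θ hθ) (hmean θ₀ hθ₀)).2).trans (hm.le_b_sub (hA hθ₀) (hA hθ))
  set C := Real.exp (S * M) * (V + M ^ 2 + 1) with hC
  -- A bound uniform over `A` for the unnormalized tilts, ready for Fatou's lemma.
  have hsq : ∀ θ ∈ A, ∫⁻ y, ENNReal.ofReal ((y ^ 2 + 1) * Real.exp (s θ * y)) ∂Q ≤
      ENNReal.ofReal C := by
    intro θ hθ
    have hP := isProbabilityMeasure_law (hA hθ)
    have hi : Integrable (fun y => y ^ 2 + 1) (m.law θ) := by
      simpa using (hm.integrable_sq_law (hA hθ) 0).add (integrable_const (1 : ℝ))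
    have hi2 := (hm.integrable_law_iff θ₀ θ _).1 hi
    have h1 := hm.integral_law_eq θ₀ θ (fun y => y ^ 2 + 1)
    have h2 : ∫ y, (y ^ 2 + 1) ∂(m.law θ) ≤ V + M ^ 2 + 1 := by
      have hv := hm.variance_id_law (hA hθ)
      rw [variance_eq_sub (hm.memLp_id_law (hA hθ))] at hv
      simp only [Pi.pow_apply, id, hm.integral_id_law (hA hθ)] at hv
      have h3 : Integrable (fun y : ℝ => y ^ 2) (m.law θ) := by
        simpa using hm.integrable_sq_law (hA hθ) 0
      rw [integral_add h3 (integrable_const _)]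
      simp only [integral_const, probReal_univ, smul_eq_mul, one_mul]
      have := hvar' θ hθ
      have h4 : m.mean θ ^ 2 ≤ M ^ 2 := sq_le_sq' (abs_le.1 (hmean θ hθ)).1
        (abs_le.1 (hmean θ hθ)).2
      linarith
    have h0 : ∀ y : ℝ, (y ^ 2 + 1) * Real.exp (s θ * y) = Real.exp ((m.b θ - m.b θ₀) / m.φ) *
        ((y ^ 2 + 1) * Real.exp ((θ - θ₀) / m.φ * y - (m.b θ - m.b θ₀) / m.φ)) := by
      intro y
      rw [mul_left_comm, ← Real.exp_add]
      congr 2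
      simp only [hs]
      ring
    simp_rw [h0]
    rw [← ofReal_integral_eq_lintegral_ofReal (hi2.const_mul _)
      (ae_of_all _ fun y => by positivity), integral_const_mul, ← h1]
    refine ENNReal.ofReal_le_ofReal ?_
    have h3 : 0 ≤ ∫ y, (y ^ 2 + 1) ∂(m.law θ) := integral_nonneg fun y => by positivity
    have := hBle θ hθ
    rw [hC]
    gcongr
  -- The infimum and supremum of the tilting parameters need not be attained, and may be boundary
  -- points of the canonical space; Fatou's lemma still gives integrability there.
  have hclosure : ∀ r ∈ closure (s '' A), Integrable (fun y => (y ^ 2 + 1) * Real.exp (r * y)) Q := by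
    intro r hr
    obtain ⟨x, hx, hxr⟩ := mem_closure_iff_seq_limit.1 hr
    refine ⟨by fun_prop, ?_⟩
    rw [hasFiniteIntegral_iff_ofReal (ae_of_all _ fun y => by positivity)]
    have h1 : ∀ y : ℝ, ENNReal.ofReal ((y ^ 2 + 1) * Real.exp (r * y)) =
        liminf (fun k => ENNReal.ofReal ((y ^ 2 + 1) * Real.exp (x k * y))) atTop := by
      intro y
      refine (Tendsto.liminf_eq ?_).symm
      refine (ENNReal.continuous_ofReal.tendsto _).comp ?_
      have : Continuous fun a : ℝ => (y ^ 2 + 1) * Real.exp (a * y) := by fun_prop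
      exact (this.tendsto r).comp hxr
    simp_rw [h1]
    refine (lintegral_liminf_le fun k => by fun_prop).trans_lt
      (lt_of_le_of_lt ?_ (ENNReal.ofReal_lt_top (r := C)))
    refine liminf_le_of_le (by isBoundedDefault) fun b hb => ?_
    obtain ⟨k, hk⟩ := hb.exists
    obtain ⟨θ, hθ, hθk⟩ := hx k
    refine hk.trans ?_
    rw [← hθk]
    exact hsq θ hθ
  have hbdd : Bornology.IsBounded (s '' A) := by
    refine (Metric.isBounded_iff_subset_closedBall 0).2 ⟨S, ?_⟩
    rintro _ ⟨θ, hθ, rfl⟩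
    simpa using hS θ hθ
  have hne : (s '' A).Nonempty := ⟨_, θ₀, hθ₀, rfl⟩
  set r₁ := sInf (s '' A)
  set r₂ := sSup (s '' A)
  have hr₁ := hclosure r₁ (csInf_mem_closure hne hbdd.bddBelow)
  have hr₂ := hclosure r₂ (csSup_mem_closure hne hbdd.bddAbove)
  -- For `s` between `r₁` and `r₂`, `exp (s y)` is at most `exp (r₂ y)` when `y ≥ 0` and at most
  -- `exp (r₁ y)` when `y ≤ 0`, so `G` is one envelope for all of `A`.
  set G : ℝ → ℝ := fun y => (|y| + M) ^ 2 * (Real.exp (r₁ * y) + Real.exp (r₂ * y)) with hG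
  have hGi : Integrable G Q := by
    refine ((hr₁.add hr₂).const_mul (2 * (1 + M ^ 2))).mono' (by fun_prop)
      (ae_of_all _ fun y => ?_)
    rw [Real.norm_of_nonneg (by positivity)]
    simp only [hG, Pi.add_apply]
    rw [← mul_add, ← mul_assoc]
    gcongr
    nlinarith [sq_nonneg (|y| - M), sq_abs y, sq_nonneg (M * y)]
  have hlim : Tendsto (fun k : ℕ => ∫ y, {y | (k : ℝ) < |y| + M}.indicator G y ∂Q) atTop
      (𝓝 (∫ _, (0 : ℝ) ∂Q)) := by
    refine tendsto_integral_of_dominated_convergence G (fun k => ?_) hGi (fun k => ?_) ?_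
    · exact hGi.aestronglyMeasurable.indicator
        (measurableSet_lt measurable_const (by fun_prop))
    · refine ae_of_all _ fun y => ?_
      refine (norm_indicator_le_norm_self _ _).trans_eq ?_
      rw [Real.norm_of_nonneg]
      simp only [hG]
      positivity
    · refine ae_of_all _ fun y => ?_
      refine tendsto_const_nhds.congr' ?_
      obtain ⟨k₀, hk₀⟩ := exists_nat_ge (|y| + M)
      filter_upwards [eventually_ge_atTop k₀] with k hk
      rw [Set.indicator_of_notMem]
      simp only [Set.mem_ofPred_eq, not_lt]
      exact hk₀.trans (by exact_mod_cast hk)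
  rw [integral_zero] at hlim
  -- The factor offsets `exp (S * M)`, the bound on the normalizing factors of the tilts.
  have hε' : 0 < ε * Real.exp (-(S * M)) := by positivity
  obtain ⟨k, hk, hk1⟩ := ((hlim.eventually_lt_const hε').and (eventually_ge_atTop 1)).exists
  refine ⟨k, by exact_mod_cast hk1, fun θ hθ => ?_⟩
  have hP := isProbabilityMeasure_law (hA hθ)
  rw [hm.integral_law_eq θ₀ θ]
  have hsθ : s θ ∈ s '' A := ⟨θ, hθ, rfl⟩
  have h1 := csInf_le hbdd.bddBelow hsθ
  have h2 := le_csSup hbdd.bddAbove hsθ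
  have hmM := hmean θ hθ
  calc _ ≤ ∫ y, Real.exp (S * M) * {y | (k : ℝ) < |y| + M}.indicator G y ∂Q := by
        refine integral_mono_of_nonneg (ae_of_all _ fun y => ?_) ?_ (ae_of_all _ fun y => ?_)
        · exact mul_nonneg (Set.indicator_nonneg (fun _ _ => sq_nonneg _) _) (Real.exp_nonneg _)
        · exact (hGi.indicator (measurableSet_lt measurable_const (by fun_prop))).const_mul _
        · have hle : |y - m.mean θ| ≤ |y| + M := (abs_sub _ _).trans (by gcongr)
          beta_reduce
          by_cases hy : (k : ℝ) < |y - m.mean θ|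
          · rw [Set.indicator_of_mem (by exact hy), Set.indicator_of_mem (by exact hy.trans_le hle)]
            have h3 : (y - m.mean θ) ^ 2 ≤ (|y| + M) ^ 2 := by
              rw [← sq_abs (y - m.mean θ)]
              gcongr
            have h4 : Real.exp ((θ - θ₀) / m.φ * y - (m.b θ - m.b θ₀) / m.φ) ≤
                Real.exp (S * M) * (Real.exp (r₁ * y) + Real.exp (r₂ * y)) := by
              rw [sub_eq_neg_add, Real.exp_add]
              have := hBge θ hθ
              gcongr
              · linarith
              · rcases le_total 0 y with h0 | h0
                · refine le_add_of_nonneg_of_le (Real.exp_nonneg _) (Real.exp_le_exp.2 ?_)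
                  exact mul_le_mul_of_nonneg_right h2 h0
                · refine le_add_of_le_of_nonneg (Real.exp_le_exp.2 ?_) (Real.exp_nonneg _)
                  exact mul_le_mul_of_nonpos_right h1 h0
            calc _ ≤ (|y| + M) ^ 2 * (Real.exp (S * M) * (Real.exp (r₁ * y) + Real.exp (r₂ * y))) := by
                  gcongr
              _ = _ := by simp only [hG]; ring
          · rw [Set.indicator_of_notMem (by exact hy), zero_mul]
            refine mul_nonneg (Real.exp_nonneg _) (Set.indicator_nonneg (fun y _ => ?_) _)
            simp only [hG]
            positivity
    _ = Real.exp (S * M) * ∫ y, {y | (k : ℝ) < |y| + M}.indicator G y ∂Q := integral_const_mul _ _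
    _ ≤ Real.exp (S * M) * (ε * Real.exp (-(S * M))) := by gcongr
    _ = ε := by rw [mul_left_comm, ← Real.exp_add, add_neg_cancel, Real.exp_zero, mul_one]

end GLM

/-! ### Nets and uniform bounds on random quadratic forms -/

section Net

variable {E : Type*} [NormedAddCommGroup E] [InnerProductSpace ℝ E] [FiniteDimensional ℝ E]

/-- The unit ball has a `1/2`-net of cardinality at most `5 ^ dim`. -/
lemma exists_half_net : ∃ N : Finset E, N.card ≤ 5 ^ Module.finrank ℝ E ∧ (∀ y ∈ N, ‖y‖ ≤ 1) ∧
    ∀ x : E, ‖x‖ ≤ 1 → ∃ y ∈ N, ‖x - y‖ ≤ 1 / 2 := by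
  classical
  -- Everything is scaled by two to fit `Besicovitch.card_le_of_separated`, the source of `5 ^ dim`.
  -- A separated set of greatest cardinality is a net, since a point far from it could be added.
  let sep (s : Finset E) : Prop := (∀ c ∈ s, ‖c‖ ≤ 2) ∧ ∀ c ∈ s, ∀ d ∈ s, c ≠ d → 1 ≤ ‖c - d‖
  let R (k : ℕ) : Prop := ∃ s : Finset E, s.card = k ∧ sep s
  have hR0 : R 0 := ⟨∅, rfl, by simp, by simp⟩
  obtain ⟨s, hs, hsep⟩ := Nat.findGreatest_spec (P := R) (Nat.zero_le (5 ^ Module.finrank ℝ E)) hR0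
  have hcard : s.card ≤ 5 ^ Module.finrank ℝ E := Besicovitch.card_le_of_separated s hsep.1 hsep.2
  refine ⟨s.image fun x => (1 / 2 : ℝ) • x, Finset.card_image_le.trans hcard, ?_, ?_⟩
  · intro y hy
    obtain ⟨c, hc, rfl⟩ := Finset.mem_image.1 hy
    have := hsep.1 c hc
    rw [norm_smul]
    norm_num
    linarith
  · intro x hx
    by_contra! hcon
    have hfar : ∀ c ∈ s, 1 < ‖(2 : ℝ) • x - c‖ := by
      intro c hc
      have h1 := hcon _ (Finset.mem_image_of_mem _ hc)
      have h2 : (2 : ℝ) • x - c = (2 : ℝ) • (x - (1 / 2 : ℝ) • c) := by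
        rw [smul_sub, smul_smul]; norm_num
      rw [h2, norm_smul]
      norm_num
      norm_num at h1
      linarith
    have hnot : (2 : ℝ) • x ∉ s := by
      intro h
      have := hfar _ h
      simp at this
      linarith
    have hsep' : sep (insert ((2 : ℝ) • x) s) := by
      refine ⟨?_, ?_⟩
      · intro c hc
        rcases Finset.mem_insert.1 hc with rfl | hc
        · rw [norm_smul]; norm_num; exact hx
        · exact hsep.1 c hc
      · intro c hc d hd hcd
        rcases Finset.mem_insert.1 hc with rfl | hc <;> rcases Finset.mem_insert.1 hd with rfl | hd
        · exact absurd rfl hcd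
        · exact (hfar d hd).le
        · rw [norm_sub_rev]; exact (hfar c hc).le
        · exact hsep.2 c hc d hd hcd
    have h1 := Nat.le_findGreatest (P := R)
      (Besicovitch.card_le_of_separated _ hsep'.1 hsep'.2) ⟨_, rfl, hsep'⟩
    rw [Finset.card_insert_of_notMem hnot] at h1
    omega

variable {ι : Type*} [Fintype ι]

/-- A quadratic form is controlled by its values on a `1/2`-net. -/
lemma abs_quadForm_le_of_net {N : Finset E} (hN : ∀ y ∈ N, ‖y‖ ≤ 1)
    (hN' : ∀ x : E, ‖x‖ ≤ 1 → ∃ y ∈ N, ‖x - y‖ ≤ 1 / 2) (a : ι → ℝ) (z : ι → E) {τ : ℝ}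
    (hτ : ∀ y ∈ N, |∑ i, a i * ⟪z i, y⟫ ^ 2| ≤ τ) (x : E) :
    |∑ i, a i * ⟪z i, x⟫ ^ 2| ≤ 32 * τ * ‖x‖ ^ 2 := by
  set q : E → ℝ := fun x => ∑ i, a i * ⟪z i, x⟫ ^ 2 with hq
  have hqc : Continuous q := by fun_prop
  have hqs : ∀ (r : ℝ) (x : E), q (r • x) = r ^ 2 * q x := by
    intro r x
    simp only [hq, inner_smul_right, Finset.mul_sum]
    exact Finset.sum_congr rfl fun i _ => by ring
  -- The net is compared with a maximizer of `|q|`, so that errors are measured by the maximum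
  -- itself and can be absorbed.
  obtain ⟨x₀, hx₀, hmax⟩ := (isCompact_closedBall (0 : E) 1).exists_isMaxOn
    ⟨0, by simp⟩ (hqc.abs.continuousOn)
  have hmax' : ∀ x : E, |q x| ≤ |q x₀| * ‖x‖ ^ 2 := by
    intro x
    rcases eq_or_ne x 0 with rfl | hx
    · simp [hq]
    have h1 : x = ‖x‖ • (‖x‖⁻¹ • x) := by
      rw [smul_smul, mul_inv_cancel₀ (norm_ne_zero_iff.2 hx), one_smul]
    have h2 : |q (‖x‖⁻¹ • x)| ≤ |q x₀| := by
      refine isMaxOn_iff.1 hmax _ ?_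
      simp [norm_smul, norm_ne_zero_iff.2 hx]
    rw [h1, hqs, abs_mul, abs_of_nonneg (sq_nonneg ‖x‖), ← h1, mul_comm]
    gcongr
  have hx1 : ‖x₀‖ ≤ 1 := by simpa using hx₀
  obtain ⟨y, hy, hd⟩ := hN' x₀ hx1
  have hy1 := hN y hy
  -- The cross terms cancel, and the two new points have squared norms adding up to at most `31 /
  -- 8`. Hence the error is at most `31 / 32` of the maximum; absorbing it gives the factor `32`.
  have hid : q x₀ - q y =
      (q ((5 / 2 : ℝ) • x₀ - (3 / 2 : ℝ) • y) - q ((3 / 2 : ℝ) • x₀ - (5 / 2 : ℝ) • y)) / 4 := by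
    simp only [hq, inner_sub_right, inner_smul_right, ← Finset.sum_sub_distrib, Finset.sum_div]
    exact Finset.sum_congr rfl fun i _ => by ring
  have hnn : ‖(5 / 2 : ℝ) • x₀ - (3 / 2 : ℝ) • y‖ ^ 2 + ‖(3 / 2 : ℝ) • x₀ - (5 / 2 : ℝ) • y‖ ^ 2 =
      ‖x₀‖ ^ 2 + ‖y‖ ^ 2 + 15 / 2 * ‖x₀ - y‖ ^ 2 := by
    simp only [@norm_sub_sq_real, norm_smul, inner_smul_left, inner_smul_right, mul_pow]
    norm_num
    ring
  have h1 := hmax' ((5 / 2 : ℝ) • x₀ - (3 / 2 : ℝ) • y)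
  have h2 := hmax' ((3 / 2 : ℝ) • x₀ - (5 / 2 : ℝ) • y)
  have h3 : ‖x₀‖ ^ 2 + ‖y‖ ^ 2 + 15 / 2 * ‖x₀ - y‖ ^ 2 ≤ 31 / 8 := by
    have e1 : ‖x₀‖ ^ 2 ≤ 1 := pow_le_one₀ (norm_nonneg _) hx1
    have e2 : ‖y‖ ^ 2 ≤ 1 := pow_le_one₀ (norm_nonneg _) hy1
    have e3 : ‖x₀ - y‖ ^ 2 ≤ (1 / 2) ^ 2 := by gcongr
    linarith
  have h4 : |q x₀| ≤ |q y| + |q x₀| * (31 / 8) / 4 := by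
    have e1 : |q x₀| ≤ |q y| + |q x₀ - q y| := by
      have := abs_add_le (q y) (q x₀ - q y)
      rwa [add_sub_cancel] at this
    have e2 : |q x₀ - q y| ≤ |q x₀| * (31 / 8) / 4 := by
      rw [hid, abs_div, abs_of_pos (by norm_num : (0 : ℝ) < 4)]
      gcongr
      refine (abs_sub _ _).trans ((add_le_add h1 h2).trans ?_)
      rw [← mul_add, hnn]
      gcongr
    linarith
  have h5 : |q x₀| ≤ 32 * τ := by linarith [hτ y hy]
  exact (hmax' x).trans (by gcongr)

/-- A uniform bound on a random quadratic form with bounded independent centred weights, by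
truncation, Hoeffding's inequality and a union bound over a net. -/
lemma measureReal_quadForm_bounded {n : ℕ} {Ω : Type*} [MeasurableSpace Ω] (P : Measure Ω)
    [IsProbabilityMeasure P] (z : Fin n → E) {ζ : Fin n → Ω → ℝ} (hζ : ∀ i, Measurable (ζ i))
    (hind : iIndepFun ζ P) (hmean : ∀ i, ∫ ω, ζ i ω ∂P = 0) {K : ℝ} (hK : 0 < K)
    (hbd : ∀ i ω, |ζ i ω| ≤ K) {C : ℝ}
    (hC : ∀ x : E, ‖x‖ ≤ 1 → ∑ i, ⟪z i, x⟫ ^ 4 ≤ C * n) {T τ : ℝ} (hT : 0 < T) (hτ : 0 < τ) :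
    P.real {ω | ¬ ∀ x : E, |∑ i, ζ i ω * ⟪z i, x⟫ ^ 2| ≤ 32 * ((τ + K * C / T) * n) * ‖x‖ ^ 2} ≤
      5 ^ Module.finrank ℝ E * (2 * Real.exp (-τ ^ 2 * n / (2 * (T * K) ^ 2))) := by
  classical
  obtain ⟨N, hNc, hN, hN'⟩ := exists_half_net (E := E)
  -- Hoeffding's inequality needs bounded summands, hence the truncation at `T`. The discarded part
  -- is deterministically small, since `⟪z i, y⟫ ^ 2 ≤ ⟪z i, y⟫ ^ 4 / T` where it lives.
  set b : E → Fin n → ℝ := fun y i => if ⟪z i, y⟫ ^ 2 ≤ T then ⟪z i, y⟫ ^ 2 else 0 with hb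
  have hb0 : ∀ y i, 0 ≤ b y i := by
    intro y i; simp only [hb]; split_ifs <;> positivity
  have hbT : ∀ y i, b y i ≤ T := by
    intro y i; simp only [hb]; split_ifs with h
    · exact h
    · exact hT.le
  have hrest : ∀ y ∈ N, ∀ ω, |∑ i, ζ i ω * (⟪z i, y⟫ ^ 2 - b y i)| ≤ K * C / T * n := by
    intro y hy ω
    calc _ ≤ ∑ i, |ζ i ω * (⟪z i, y⟫ ^ 2 - b y i)| := Finset.abs_sum_le_sum_abs _ _
      _ ≤ ∑ i, K * (⟪z i, y⟫ ^ 4 / T) := by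
        refine Finset.sum_le_sum fun i _ => ?_
        rw [abs_mul]
        refine mul_le_mul (hbd i ω) ?_ (abs_nonneg _) hK.le
        simp only [hb]
        split_ifs with h
        · rw [sub_self, abs_zero]; positivity
        · push Not at h
          rw [sub_zero, abs_of_nonneg (sq_nonneg _), le_div_iff₀ hT]
          nlinarith [sq_nonneg ⟪z i, y⟫]
      _ = K / T * ∑ i, ⟪z i, y⟫ ^ 4 := by
        rw [Finset.mul_sum]; exact Finset.sum_congr rfl fun i _ => by ring
      _ ≤ K / T * (C * n) := by gcongr; exact hC y (hN y hy)
      _ = _ := by ring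
  -- The sign `σ` treats both tails at once.
  have hside : ∀ σ : ℝ, |σ| = 1 → ∀ y, P.real {ω | τ * n ≤ ∑ i, σ * b y i * ζ i ω} ≤
      Real.exp (-τ ^ 2 * n / (2 * (T * K) ^ 2)) := by
    intro σ hσ y
    have h1 : iIndepFun (fun i ω => σ * b y i * ζ i ω) P :=
      hind.comp (fun i x => σ * b y i * x) fun i => by fun_prop
    have h2 : ∀ i ∈ Finset.univ, HasSubgaussianMGF (fun ω => σ * b y i * ζ i ω)
        ((‖T * K - (-(T * K))‖₊ / 2) ^ 2) P := by
      intro i _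
      refine hasSubgaussianMGF_of_mem_Icc_of_integral_eq_zero
        ((hζ i).const_mul _).aemeasurable (ae_of_all _ fun ω => ?_) ?_
      · refine abs_le.1 ?_
        rw [abs_mul, abs_mul, hσ, one_mul, abs_of_nonneg (hb0 y i)]
        exact mul_le_mul (hbT y i) (hbd i ω) (abs_nonneg _) hT.le
      · rw [integral_const_mul, hmean, mul_zero]
    refine (HasSubgaussianMGF.measure_sum_ge_le_of_iIndepFun h1 h2 (by positivity)).trans_eq ?_
    congr 1
    have h3 : ((∑ _i : Fin n, ((‖T * K - (-(T * K))‖₊ / 2) ^ 2) : NNReal) : ℝ) =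
        n * (T * K) ^ 2 := by
      simp only [Finset.sum_const, Finset.card_univ, Fintype.card_fin, nsmul_eq_mul]
      push_cast
      rw [Real.norm_of_nonneg (by have := mul_pos hT hK; linarith)]
      ring
    push_cast at h3 ⊢
    rw [h3]
    rcases Nat.eq_zero_or_pos n with rfl | hn
    · simp
    · have : (0 : ℝ) < n := by exact_mod_cast hn
      field_simp
  set Bad : E → Set Ω := fun y => {ω | τ * n ≤ ∑ i, 1 * b y i * ζ i ω} ∪
    {ω | τ * n ≤ ∑ i, (-1) * b y i * ζ i ω}
  have hsub : {ω | ¬ ∀ x : E, |∑ i, ζ i ω * ⟪z i, x⟫ ^ 2| ≤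
      32 * ((τ + K * C / T) * n) * ‖x‖ ^ 2} ⊆ ⋃ y ∈ N, Bad y := by
    intro ω hω
    by_contra hnot
    refine hω fun x => abs_quadForm_le_of_net hN hN' _ z (fun y hy => ?_) x
    simp only [Set.mem_iUnion, not_exists] at hnot
    have h1 := hnot y hy
    simp only [Bad, Set.mem_union, Set.mem_ofPred_eq, not_or, not_le] at h1
    have h2 := hrest y hy ω
    have h3 : |∑ i, ζ i ω * b y i| ≤ τ * n := by
      refine abs_le.2 ⟨?_, ?_⟩
      · have : ∑ i, (-1) * b y i * ζ i ω = -∑ i, ζ i ω * b y i := by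
          rw [← Finset.sum_neg_distrib]; exact Finset.sum_congr rfl fun i _ => by ring
        rw [this] at h1
        linarith [h1.2]
      · have : ∑ i, 1 * b y i * ζ i ω = ∑ i, ζ i ω * b y i :=
          Finset.sum_congr rfl fun i _ => by ring
        rw [this] at h1
        linarith [h1.1]
    have h4 : ∑ i, ζ i ω * ⟪z i, y⟫ ^ 2 =
        ∑ i, ζ i ω * b y i + ∑ i, ζ i ω * (⟪z i, y⟫ ^ 2 - b y i) := by
      rw [← Finset.sum_add_distrib]; exact Finset.sum_congr rfl fun i _ => by ring
    rw [h4]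
    refine (abs_add_le _ _).trans ?_
    linarith
  calc _ ≤ P.real (⋃ y ∈ N, Bad y) := measureReal_mono hsub (measure_ne_top _ _)
    _ ≤ ∑ y ∈ N, P.real (Bad y) := measureReal_biUnion_finset_le _ _
    _ ≤ ∑ _y ∈ N, 2 * Real.exp (-τ ^ 2 * n / (2 * (T * K) ^ 2)) := by
      refine Finset.sum_le_sum fun y _ => (measureReal_union_le _ _).trans ?_
      have e1 := hside 1 (by simp) y
      have e2 := hside (-1) (by simp) y
      linarith
    _ = N.card * (2 * Real.exp (-τ ^ 2 * n / (2 * (T * K) ^ 2))) := by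
      rw [Finset.sum_const, nsmul_eq_mul]
    _ ≤ _ := by
      gcongr
      exact_mod_cast hNc

end Net

/-- Rows of independent centred errors with uniformly integrable squares. -/
structure IsErrorArray {Ω : ℕ → Type*} [∀ n, MeasurableSpace (Ω n)] (P : ∀ n, Measure (Ω n))
    (e : ∀ n, Fin n → Ω n → ℝ) (V : ℝ) : Prop where
  measurable : ∀ n i, Measurable (e n i)
  indep : ∀ n, iIndepFun (e n) (P n)
  memLp : ∀ n i, MemLp (e n i) 2 (P n)
  integral_eq_zero : ∀ n i, ∫ ω, e n i ω ∂(P n) = 0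
  integral_sq_le : ∀ n i, ∫ ω, e n i ω ^ 2 ∂(P n) ≤ V
  tail : ∀ ε > 0, ∃ K : ℝ, 1 ≤ K ∧ ∀ n i,
    ∫ ω, {ω | K < |e n i ω|}.indicator (fun ω => e n i ω ^ 2) ω ∂(P n) ≤ ε

section QuadForm

variable {E : Type*} [NormedAddCommGroup E] [InnerProductSpace ℝ E]

/-- Cauchy-Schwarz for a weighted quadratic form. -/
lemma sum_abs_mul_sq_le {n : ℕ} (z : Fin n → E) (f : Fin n → ℝ) {C σ : ℝ} (hC0 : 0 ≤ C)
    (hσ : 0 ≤ σ) {x : E} (hC : ∑ i, ⟪z i, x⟫ ^ 4 ≤ C * n * ‖x‖ ^ 4) (hf : ∑ i, f i ^ 2 ≤ σ * n) :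
    ∑ i, |f i| * ⟪z i, x⟫ ^ 2 ≤ √(C * σ) * n * ‖x‖ ^ 2 := by
  refine abs_le_of_sq_le_sq' ?_ (by positivity) |>.2
  refine (Finset.sum_mul_sq_le_sq_mul_sq _ _ _).trans ?_
  simp only [sq_abs, ← pow_mul]
  calc _ ≤ σ * n * (C * n * ‖x‖ ^ 4) :=
        mul_le_mul hf hC (Finset.sum_nonneg fun i _ => by positivity) (by positivity)
    _ = _ := by rw [mul_pow, mul_pow, Real.sq_sqrt (by positivity)]; ring

lemma sum_abs_mul_sq_le' {n : ℕ} (z : Fin n → E) (f g : Fin n → ℝ) {C σ M : ℝ} (hC0 : 0 ≤ C)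
    (hσ : 0 ≤ σ) (hM : 0 ≤ M) {x : E} (hC : ∑ i, ⟪z i, x⟫ ^ 4 ≤ C * n * ‖x‖ ^ 4)
    (hf : ∑ i, f i ^ 2 ≤ σ * n) (hg : ∀ i, |g i| ≤ M) :
    |∑ i, g i * f i * ⟪z i, x⟫ ^ 2| ≤ M * √(C * σ) * n * ‖x‖ ^ 2 := by
  calc _ ≤ ∑ i, |g i * f i * ⟪z i, x⟫ ^ 2| := Finset.abs_sum_le_sum_abs _ _
    _ ≤ ∑ i, M * (|f i| * ⟪z i, x⟫ ^ 2) := by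
      refine Finset.sum_le_sum fun i _ => ?_
      rw [abs_mul, abs_mul, abs_of_nonneg (sq_nonneg ⟪z i, x⟫), mul_assoc]
      gcongr
      exact hg i
    _ = M * ∑ i, |f i| * ⟪z i, x⟫ ^ 2 := by rw [Finset.mul_sum]
    _ ≤ M * (√(C * σ) * n * ‖x‖ ^ 2) := by
      gcongr
      exact sum_abs_mul_sq_le z f hC0 hσ hC hf
    _ = _ := by ring

/-- Markov's inequality for the sum of the squared tails of the errors. -/
lemma measureReal_tail_le {n : ℕ} {Ω : Type*} [MeasurableSpace Ω] (P : Measure Ω)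
    [IsProbabilityMeasure P] {e : Fin n → Ω → ℝ} (he : ∀ i, Measurable (e i))
    (hL : ∀ i, MemLp (e i) 2 P) {K ε σ : ℝ} (hε : 0 ≤ ε) (hσ : 0 < σ)
    (htail : ∀ i, ∫ ω, {ω | K < |e i ω|}.indicator (fun ω => e i ω ^ 2) ω ∂P ≤ ε) :
    P.real {ω | ¬ ∑ i, ({ω | K < |e i ω|}.indicator (e i) ω) ^ 2 ≤ σ * n} ≤ ε / σ := by
  rcases Nat.eq_zero_or_pos n with rfl | hn
  · simp
    positivity
  have hn' : (0 : ℝ) < n := by exact_mod_cast hn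
  have hms : ∀ i, MeasurableSet {ω | K < |e i ω|} := fun i =>
    measurableSet_lt measurable_const (he i).abs
  have hsq : ∀ i ω, ({ω | K < |e i ω|}.indicator (e i) ω) ^ 2 =
      {ω | K < |e i ω|}.indicator (fun ω => e i ω ^ 2) ω := by
    intro i ω
    by_cases h : ω ∈ {ω | K < |e i ω|} <;> simp [h]
  simp_rw [hsq]
  have hi : ∀ i, Integrable ({ω | K < |e i ω|}.indicator (fun ω => e i ω ^ 2)) P := fun i =>
    (hL i).integrable_sq.indicator (hms i)
  have h1 := mul_meas_ge_le_integral_of_nonneg (μ := P)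
    (f := fun ω => ∑ i, {ω | K < |e i ω|}.indicator (fun ω => e i ω ^ 2) ω)
    (ae_of_all _ fun ω => Finset.sum_nonneg fun i _ =>
      Set.indicator_nonneg (fun _ _ => sq_nonneg _) _)
    (integrable_finsetSum _ fun i _ => hi i) (σ * n)
  rw [integral_finsetSum _ fun i _ => hi i] at h1
  have h2 : ∑ i, ∫ ω, {ω | K < |e i ω|}.indicator (fun ω => e i ω ^ 2) ω ∂P ≤ n * ε := by
    refine (Finset.sum_le_sum fun i _ => htail i).trans_eq ?_
    simp
  rw [le_div_iff₀ hσ]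
  refine le_of_mul_le_mul_left ?_ hn'
  refine le_trans ?_ (h1.trans h2)
  have h3 : P.real {ω | ¬ ∑ i, {ω | K < |e i ω|}.indicator (fun ω => e i ω ^ 2) ω ≤ σ * n} ≤
      P.real {ω | σ * n ≤ ∑ i, {ω | K < |e i ω|}.indicator (fun ω => e i ω ^ 2) ω} :=
    measureReal_mono (fun ω hω => (not_le.1 hω).le) (measure_ne_top _ _)
  nlinarith [mul_le_mul_of_nonneg_left h3 (mul_pos hσ hn').le]

variable [FiniteDimensional ℝ E]

/-- A uniform bound on a random quadratic form whose weights are centred errors. -/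
lemma measureReal_quadForm {n : ℕ} {Ω : Type*} [MeasurableSpace Ω] (P : Measure Ω)
    [IsProbabilityMeasure P] (z : Fin n → E) {e : Fin n → Ω → ℝ} (he : ∀ i, Measurable (e i))
    (hind : iIndepFun e P) (hL : ∀ i, MemLp (e i) 2 P) (hmean : ∀ i, ∫ ω, e i ω ∂P = 0)
    {K ε σ : ℝ} (hK : 1 ≤ K) (hε : 0 ≤ ε) (hσ : 0 < σ)
    (htail : ∀ i, ∫ ω, {ω | K < |e i ω|}.indicator (fun ω => e i ω ^ 2) ω ∂P ≤ ε)
    {M : ℝ} (hM : 0 < M) (g : Fin n → ℝ) (hg : ∀ i, |g i| ≤ M) {C : ℝ} (hC0 : 0 ≤ C)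
    (hC2 : ∀ x : E, ∑ i, ⟪z i, x⟫ ^ 2 ≤ C * n * ‖x‖ ^ 2)
    (hC4 : ∀ x : E, ∑ i, ⟪z i, x⟫ ^ 4 ≤ C * n * ‖x‖ ^ 4) {T τ : ℝ} (hT : 0 < T) (hτ : 0 < τ) :
    P.real {ω | ¬ ∀ x : E, |∑ i, g i * e i ω * ⟪z i, x⟫ ^ 2| ≤
        (32 * (τ + M * (2 * K) * C / T) + M * √(C * σ) + M * ε * C) * n * ‖x‖ ^ 2} ≤
      5 ^ Module.finrank ℝ E * (2 * Real.exp (-τ ^ 2 * n / (2 * (T * (M * (2 * K))) ^ 2))) +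
        ε / σ := by
  classical
  have hK0 : 0 < K := by linarith
  have hms : ∀ i, MeasurableSet {ω | K < |e i ω|} := fun i =>
    measurableSet_lt measurable_const (he i).abs
  -- Each error is split into a recentred truncation, handled by the bounded case with bound `2 K`;
  -- its tail, handled by Markov's inequality and Cauchy-Schwarz; and the mean of the truncation.
  set ef : ℝ → ℝ := fun x => if K < |x| then 0 else x with hef
  have hefm : Measurable ef := Measurable.ite (measurableSet_lt measurable_const (by fun_prop))
    measurable_const measurable_id
  have hefK : ∀ x, |ef x| ≤ K := by
    intro x
    simp only [hef]
    split_ifs with h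
    · simpa using hK0.le
    · exact not_lt.1 h
  set μ : Fin n → ℝ := fun i => ∫ ω, ef (e i ω) ∂P with hμ
  have hefi : ∀ i, Integrable (fun ω => ef (e i ω)) P := fun i =>
    Integrable.of_bound (hefm.comp (he i)).aestronglyMeasurable K (ae_of_all _ fun ω => hefK _)
  have hμK : ∀ i, |μ i| ≤ K := by
    intro i
    have := norm_integral_le_of_norm_le_const (μ := P) (f := fun ω => ef (e i ω)) (C := K)
      (ae_of_all _ fun ω => hefK _)
    simpa using this
  have hsplit : ∀ i ω, e i ω = ef (e i ω) + {ω | K < |e i ω|}.indicator (e i) ω := by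
    intro i ω
    simp only [hef, Set.indicator_apply, Set.mem_ofPred_eq]
    split_ifs <;> simp
  have hei : ∀ i, Integrable (e i) P := fun i => (hL i).integrable (by norm_num)
  -- The error is centred, so the mean of its truncation is minus the mean of its tail; there `|e| ≤
  -- e²` because `K ≥ 1`.
  have hμε : ∀ i, |μ i| ≤ ε := by
    intro i
    have h1 : μ i = -∫ ω, {ω | K < |e i ω|}.indicator (e i) ω ∂P := by
      have h2 := hmean i
      have h3 : ∫ ω, e i ω ∂P = ∫ ω, (ef (e i ω) + {ω | K < |e i ω|}.indicator (e i) ω) ∂P :=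
        integral_congr_ae (ae_of_all _ fun ω => hsplit i ω)
      rw [h3, integral_add (hefi i) ((hei i).indicator (hms i))] at h2
      simp only [hμ]
      linarith
    rw [h1, abs_neg]
    refine (abs_integral_le_integral_abs).trans ((integral_mono ?_ ?_ fun ω => ?_).trans (htail i))
    · exact ((hei i).indicator (hms i)).abs
    · exact (hL i).integrable_sq.indicator (hms i)
    · by_cases h : K < |e i ω|
      · simp only [Set.indicator_apply, Set.mem_ofPred_eq, h, if_true]
        rw [← sq_abs (e i ω)]
        nlinarith
      · simp [h]
  have hb := measureReal_quadForm_bounded P z (ζ := fun i ω => g i * (ef (e i ω) - μ i))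
    (fun i => ((hefm.comp (he i)).sub_const _).const_mul _)
    (hind.comp (fun i x => g i * (ef x - μ i)) fun i => (hefm.sub_const _).const_mul _)
    (fun i => by
      rw [integral_const_mul, integral_sub (hefi i) (integrable_const _)]
      simp [hμ])
    (K := M * (2 * K)) (by positivity)
    (fun i ω => by
      rw [abs_mul]
      refine mul_le_mul (hg i) ((abs_sub _ _).trans ?_) (abs_nonneg _) hM.le
      linarith [hefK (e i ω), hμK i])
    (C := C) (fun x hx => (hC4 x).trans (by
      have : ‖x‖ ^ 4 ≤ 1 := pow_le_one₀ (norm_nonneg _) hx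
      have : 0 ≤ C * n := by positivity
      nlinarith)) hT hτ
  have htl := measureReal_tail_le P he hL hε hσ htail
  refine le_trans ?_ (add_le_add hb htl)
  refine le_trans (measureReal_mono ?_ (measure_ne_top _ _)) (measureReal_union_le _ _)
  intro ω hω
  by_contra hnot
  simp only [Set.mem_union, Set.mem_ofPred_eq, not_or, not_not] at hnot
  refine hω fun x => ?_
  have h1 := hnot.1 x
  have h2 := sum_abs_mul_sq_le' z _ g hC0 hσ.le hM.le (hC4 x) hnot.2 hg
  have h3 : |∑ i, g i * μ i * ⟪z i, x⟫ ^ 2| ≤ M * ε * C * n * ‖x‖ ^ 2 := by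
    calc _ ≤ ∑ i, |g i * μ i * ⟪z i, x⟫ ^ 2| := Finset.abs_sum_le_sum_abs _ _
      _ ≤ ∑ i, M * ε * ⟪z i, x⟫ ^ 2 := by
        refine Finset.sum_le_sum fun i _ => ?_
        rw [abs_mul, abs_mul, abs_of_nonneg (sq_nonneg ⟪z i, x⟫)]
        gcongr
        · exact hg i
        · exact hμε i
      _ = M * ε * ∑ i, ⟪z i, x⟫ ^ 2 := by rw [Finset.mul_sum]
      _ ≤ M * ε * (C * n * ‖x‖ ^ 2) := by gcongr; exact hC2 x
      _ = _ := by ring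
  have h4 : ∑ i, g i * e i ω * ⟪z i, x⟫ ^ 2 =
      ∑ i, g i * (ef (e i ω) - μ i) * ⟪z i, x⟫ ^ 2 +
      ∑ i, g i * {ω | K < |e i ω|}.indicator (e i) ω * ⟪z i, x⟫ ^ 2 +
      ∑ i, g i * μ i * ⟪z i, x⟫ ^ 2 := by
    rw [← Finset.sum_add_distrib, ← Finset.sum_add_distrib]
    refine Finset.sum_congr rfl fun i _ => ?_
    linear_combination (g i * ⟪z i, x⟫ ^ 2) * hsplit i ω
  rw [h4]
  refine (abs_add_three _ _ _).trans ?_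
  linarith

end QuadForm

/-- If `p = o(n)`, the random quadratic form is uniformly `o(n)` with probability tending to one. -/
lemma IsErrorArray.eventually_quadForm {Ω : ℕ → Type*} [∀ n, MeasurableSpace (Ω n)]
    {P : ∀ n, Measure (Ω n)} [∀ n, IsProbabilityMeasure (P n)] {e : ∀ n, Fin n → Ω n → ℝ} {V : ℝ}
    (h : IsErrorArray P e V) {p : ℕ → ℕ} (z : ∀ n, Fin n → EuclideanSpace ℝ (Fin (p n)))
    (g : ∀ n, Fin n → ℝ) {M C : ℝ} (hM : 0 < M) (hC : 0 ≤ C) (hg : ∀ n i, |g n i| ≤ M)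
    (hC2 : ∀ᶠ n in atTop, ∀ x, ∑ i, ⟪z n i, x⟫ ^ 2 ≤ C * n * ‖x‖ ^ 2)
    (hC4 : ∀ᶠ n in atTop, ∀ x, ∑ i, ⟪z n i, x⟫ ^ 4 ≤ C * n * ‖x‖ ^ 4)
    (hp : (fun n => (p n : ℝ)) =o[atTop] fun n => (n : ℝ)) {η κ : ℝ} (hη : 0 < η) (hκ : 0 < κ) :
    ∀ᶠ n in atTop, (P n).real {ω | ¬ ∀ x, |∑ i, g n i * e n i ω * ⟪z n i, x⟫ ^ 2| ≤
      η * n * ‖x‖ ^ 2} ≤ κ := by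
  -- The constants are chosen in the order `σ`, `ε`, `K`, `T`, each of the four contributions
  -- receiving `η / 4`; then `ε / σ` is small as well.
  obtain ⟨σ, hσ, hσ'⟩ : ∃ σ > 0, M * √(C * σ) ≤ η / 4 := by
    have : Tendsto (fun σ : ℝ => M * √(C * σ)) (𝓝[>] 0) (𝓝 0) := by
      have : Continuous fun σ : ℝ => M * √(C * σ) := by fun_prop
      simpa using (this.tendsto 0).mono_left nhdsWithin_le_nhds
    obtain ⟨σ, h1, h2⟩ := ((this.eventually_le_const (show 0 < η / 4 by positivity)).and
      self_mem_nhdsWithin).exists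
    exact ⟨σ, h2, h1⟩
  obtain ⟨ε, hε, hε1, hε2⟩ : ∃ ε > 0, ε / σ ≤ κ / 2 ∧ M * ε * C ≤ η / 4 := by
    have t1 : Tendsto (fun ε : ℝ => ε / σ) (𝓝[>] 0) (𝓝 0) := by
      have : Continuous fun ε : ℝ => ε / σ := by fun_prop
      simpa using (this.tendsto 0).mono_left nhdsWithin_le_nhds
    have t2 : Tendsto (fun ε : ℝ => M * ε * C) (𝓝[>] 0) (𝓝 0) := by
      have : Continuous fun ε : ℝ => M * ε * C := by fun_prop
      simpa using (this.tendsto 0).mono_left nhdsWithin_le_nhds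
    obtain ⟨ε, h1, h2, h3⟩ := ((t1.eventually_le_const (show 0 < κ / 2 by positivity)).and
      ((t2.eventually_le_const (show 0 < η / 4 by positivity)).and self_mem_nhdsWithin)).exists
    exact ⟨ε, h3, h1, h2⟩
  obtain ⟨K, hK, htail⟩ := h.tail ε hε
  have hK0 : 0 < K := by linarith
  obtain ⟨T, hT, hT'⟩ : ∃ T > 0, 32 * (M * (2 * K) * C / T) ≤ η / 4 := by
    refine ⟨1 + 128 * (M * (2 * K) * C) / η, by positivity, ?_⟩
    rw [← mul_div_assoc, div_le_iff₀ (by positivity)]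
    field_simp
    nlinarith
  set τ := η / 128 with hτ
  have hτ0 : 0 < τ := by positivity
  set a := τ ^ 2 / (2 * (T * (M * (2 * K))) ^ 2) with ha
  have ha0 : 0 < a := by positivity
  have hlog : 0 < Real.log 5 := Real.log_pos (by norm_num)
  -- The entropy `p log 5` of the net is eventually at most half of the exponent `a n`; here `p =
  -- o(n)` is decisive.
  have hexp : ∀ᶠ n : ℕ in atTop, (5 : ℝ) ^ p n * (2 * Real.exp (-(a * n))) ≤ κ / 2 := by
    have h1 := hp.bound (c := a / (2 * Real.log 5)) (by positivity)
    have h2 : Tendsto (fun n : ℕ => 2 * Real.exp (-(a / 2 * (n : ℝ)))) atTop (𝓝 (2 * 0)) := by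
      refine (Real.tendsto_exp_atBot.comp (tendsto_neg_atTop_atBot.comp ?_)).const_mul 2
      exact tendsto_natCast_atTop_atTop.const_mul_atTop (by positivity)
    rw [mul_zero] at h2
    filter_upwards [h1, h2.eventually_le_const (show 0 < κ / 2 by positivity)] with n hn1 hn2
    refine le_trans ?_ hn2
    rw [Real.norm_natCast, Real.norm_natCast] at hn1
    have h3 : (5 : ℝ) ^ p n = Real.exp (p n * Real.log 5) := by
      rw [mul_comm, Real.exp_mul, Real.exp_log (by norm_num), Real.rpow_natCast]
    rw [h3, mul_left_comm, ← Real.exp_add]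
    gcongr
    have h4 : (p n : ℝ) * Real.log 5 ≤ a / (2 * Real.log 5) * n * Real.log 5 := by gcongr
    have h5 : a / (2 * Real.log 5) * n * Real.log 5 = a / 2 * n := by field_simp
    linarith
  filter_upwards [hC2, hC4, hexp] with n h2 h4 hx
  have hmain := measureReal_quadForm (P n) (z n) (h.measurable n) (h.indep n) (h.memLp n)
    (h.integral_eq_zero n) hK hε.le hσ (htail n) hM (g n) (hg n) hC h2 h4 hT hτ0
  rw [finrank_euclideanSpace_fin] at hmain
  have e1 : -τ ^ 2 * (n : ℝ) / (2 * (T * (M * (2 * K))) ^ 2) = -(a * n) := by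
    rw [ha]; ring
  rw [e1] at hmain
  refine le_trans (measureReal_mono ?_ (measure_ne_top _ _)) (hmain.trans (by linarith))
  intro ω hω hall
  refine hω fun x => (hall x).trans ?_
  gcongr
  have : 32 * (τ + M * (2 * K) * C / T) = η / 4 + 32 * (M * (2 * K) * C / T) := by
    rw [hτ]; ring
  linarith

/-! ### Linearization of the score and a measurable root -/

/-- The mean value theorem on a convex set, without an order on the end points. -/
lemma exists_mem_uIcc_sub_eq {s : Set ℝ} (hs : Convex ℝ s) {f f' : ℝ → ℝ}
    (hf : ∀ t ∈ s, HasDerivAt f (f' t) t) {a b : ℝ} (ha : a ∈ s) (hb : b ∈ s) :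
    ∃ ξ ∈ Set.uIcc a b, f a - f b = f' ξ * (a - b) := by
  wlog hab : a < b generalizing a b
  · rcases eq_or_lt_of_le (not_lt.1 hab) with rfl | h
    · exact ⟨b, by simp, by simp⟩
    · obtain ⟨ξ, hξ, h1⟩ := this hb ha h
      exact ⟨ξ, Set.uIcc_comm a b ▸ hξ, by linarith⟩
  have hsub : Set.Icc a b ⊆ s := by
    rw [← segment_eq_Icc hab.le]; exact hs.segment_subset ha hb
  obtain ⟨ξ, hξ, h1⟩ := exists_hasDerivAt_eq_slope f f' hab
    (fun t ht => (hf t (hsub ht)).continuousAt.continuousWithinAt)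
    (fun t ht => hf t (hsub (Set.Ioo_subset_Icc_self ht)))
  refine ⟨ξ, by rw [Set.uIcc_of_le hab.le]; exact Set.Ioo_subset_Icc_self hξ, ?_⟩
  have : b - a ≠ 0 := by linarith
  rw [eq_div_iff this] at h1
  linarith

lemma abs_sub_le_of_hasDerivAt {s : Set ℝ} (hs : Convex ℝ s) {f f' : ℝ → ℝ}
    (hf : ∀ t ∈ s, HasDerivAt f (f' t) t) {M : ℝ} (hM : ∀ t ∈ s, |f' t| ≤ M) {a b : ℝ}
    (ha : a ∈ s) (hb : b ∈ s) : |f a - f b| ≤ M * |a - b| :=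
  hs.norm_image_sub_le_of_norm_hasDerivWithin_le (fun t ht => (hf t ht).hasDerivWithinAt) hM hb ha

namespace GLM

variable {m : GLM}

/-- The contribution of a single response to the score. -/
noncomputable def psi (m : GLM) (y t : ℝ) : ℝ := m.φ⁻¹ * (deriv m.u t * (y - m.h t))

/-- Bounds on the ingredients of the model over a set of linear predictors. -/
structure BoundedOn (m : GLM) (s : Set ℝ) (M : ℝ) : Prop where
  subset : s ⊆ m.D
  convex : Convex ℝ s
  h' : ∀ t ∈ s, |deriv m.h t| ≤ M
  u' : ∀ t ∈ s, |deriv m.u t| ≤ M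
  u'' : ∀ t ∈ s, |iteratedDeriv 2 m.u t| ≤ M
  u''' : ∀ t ∈ s, |iteratedDeriv 3 m.u t| ≤ M
  w' : ∀ t ∈ s, |deriv m.w t| ≤ M

/-- Linearization of the score of a single response around the true linear predictor `t₀`. -/
lemma BoundedOn.exists_psi_sub {s : Set ℝ} {M : ℝ} (hb : m.BoundedOn s M) (hm : m.IsValid)
    (hu : ContDiffOn ℝ 3 m.u m.D) (hw : ContDiffOn ℝ 1 m.w m.D) {t₀ t₁ t₂ : ℝ} (h₀ : t₀ ∈ s)
    (h₁ : t₁ ∈ s) (h₂ : t₂ ∈ s) (y : ℝ) : ∃ r : ℝ,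
      m.psi y t₁ - m.psi y t₂ =
        (m.φ⁻¹ * iteratedDeriv 2 m.u t₀ * (y - m.h t₀) - m.w t₀ + r) * (t₁ - t₂) ∧
      ∀ e₁ e₂ : ℝ, y - m.h t₀ = e₁ + e₂ →
        |r| ≤ (m.φ⁻¹ * M * |e₁| + (m.φ⁻¹ * M ^ 2 + M)) * (|t₁ - t₀| + |t₂ - t₀|) +
          2 * (m.φ⁻¹ * M) * |e₂| := by
  have hφ := hm.φ_pos
  have hM : 0 ≤ M := (abs_nonneg _).trans (hb.h' t₀ h₀)
  obtain ⟨ξ, hξ, hξ'⟩ := exists_mem_uIcc_sub_eq hb.convex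
    (fun t ht => hm.score_hasDerivAt hu y (hb.subset ht)) h₁ h₂
  have hξs : ξ ∈ s := by
    rw [← segment_eq_uIcc] at hξ
    exact hb.convex.segment_subset h₁ h₂ hξ
  have hd : |ξ - t₀| ≤ |t₁ - t₀| + |t₂ - t₀| := by
    rcases Set.mem_uIcc.1 hξ with h | h
    · refine abs_le.2 ⟨?_, ?_⟩
      · linarith [neg_abs_le (t₁ - t₀), abs_nonneg (t₂ - t₀)]
      · linarith [le_abs_self (t₂ - t₀), abs_nonneg (t₁ - t₀)]
    · refine abs_le.2 ⟨?_, ?_⟩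
      · linarith [neg_abs_le (t₂ - t₀), abs_nonneg (t₁ - t₀)]
      · linarith [le_abs_self (t₁ - t₀), abs_nonneg (t₂ - t₀)]
  set d := |t₁ - t₀| + |t₂ - t₀|
  have d1 : |iteratedDeriv 2 m.u ξ - iteratedDeriv 2 m.u t₀| ≤ M * d :=
    (abs_sub_le_of_hasDerivAt hb.convex (fun t ht => u_two_hasDerivAt hm.isOpen_D hu
      (hb.subset ht)) hb.u''' hξs h₀).trans (by gcongr)
  have d2 : |m.h t₀ - m.h ξ| ≤ M * d := by
    rw [abs_sub_comm]
    refine (abs_sub_le_of_hasDerivAt hb.convex (f' := deriv m.h) (fun t ht => ?_) hb.h'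
      hξs h₀).trans (by gcongr)
    exact (hm.h_hasDerivAt hu (hb.subset ht)).differentiableAt.hasDerivAt
  have d3 : |m.w t₀ - m.w ξ| ≤ M * d := by
    rw [abs_sub_comm]
    refine (abs_sub_le_of_hasDerivAt hb.convex (f' := deriv m.w) (fun t ht => ?_) hb.w'
      hξs h₀).trans (by gcongr)
    exact ((hw.contDiffAt (hm.isOpen_D.mem_nhds (hb.subset ht))).differentiableAt
      (by norm_num)).hasDerivAt
  -- The Lipschitz bound `d1` serves the part `e₁` of the error; for the part `e₂` this crude bound
  -- is used, because smallness will come from `e₂` itself.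
  have d4 : |iteratedDeriv 2 m.u ξ - iteratedDeriv 2 m.u t₀| ≤ 2 * M :=
    (abs_sub _ _).trans (by linarith [hb.u'' ξ hξs, hb.u'' t₀ h₀])
  refine ⟨m.φ⁻¹ * (iteratedDeriv 2 m.u ξ - iteratedDeriv 2 m.u t₀) * (y - m.h t₀) +
    m.φ⁻¹ * iteratedDeriv 2 m.u ξ * (m.h t₀ - m.h ξ) + (m.w t₀ - m.w ξ), ?_, ?_⟩
  · unfold psi
    rw [hξ']
    ring
  · intro e₁ e₂ he
    have hi : 0 ≤ m.φ⁻¹ := by positivity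
    calc _ = |m.φ⁻¹ * (iteratedDeriv 2 m.u ξ - iteratedDeriv 2 m.u t₀) * e₁ +
          m.φ⁻¹ * (iteratedDeriv 2 m.u ξ - iteratedDeriv 2 m.u t₀) * e₂ +
          m.φ⁻¹ * iteratedDeriv 2 m.u ξ * (m.h t₀ - m.h ξ) + (m.w t₀ - m.w ξ)| := by
          rw [he]; congr 1; ring
      _ ≤ |m.φ⁻¹ * (iteratedDeriv 2 m.u ξ - iteratedDeriv 2 m.u t₀) * e₁| +
          |m.φ⁻¹ * (iteratedDeriv 2 m.u ξ - iteratedDeriv 2 m.u t₀) * e₂| +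
          |m.φ⁻¹ * iteratedDeriv 2 m.u ξ * (m.h t₀ - m.h ξ)| + |m.w t₀ - m.w ξ| := by
          refine (abs_add_le _ _).trans (add_le_add_left ?_ _)
          exact abs_add_three _ _ _
      _ ≤ m.φ⁻¹ * (M * d) * |e₁| + m.φ⁻¹ * (2 * M) * |e₂| + m.φ⁻¹ * M * (M * d) + M * d := by
          simp only [abs_mul, abs_of_nonneg hi]
          gcongr
          exact hb.u'' ξ hξs
      _ = _ := by ring

variable {n p : ℕ}

lemma inner_score (z : Fin n → EuclideanSpace ℝ (Fin p)) (y : Fin n → ℝ)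
    (β x : EuclideanSpace ℝ (Fin p)) :
    ⟪m.score z y β, x⟫ = ∑ i, m.psi (y i) ⟪z i, β⟫ * ⟪z i, x⟫ := by
  simp only [score, psi, real_inner_smul_left, sum_inner, Finset.mul_sum]
  exact Finset.sum_congr rfl fun i _ => by ring

lemma continuous_score (z : Fin n → EuclideanSpace ℝ (Fin p)) (β : EuclideanSpace ℝ (Fin p)) :
    Continuous fun y => m.score z y β := by
  unfold score
  fun_prop

/-- A variational inequality at a maximizer of the log-likelihood over a closed ball. -/
lemma IsValid.exists_variational (hm : m.IsValid) (hu : ContDiffOn ℝ 3 m.u m.D)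
    (z : Fin n → EuclideanSpace ℝ (Fin p)) (y : Fin n → ℝ) (β₀ : EuclideanSpace ℝ (Fin p))
    {ρ : ℝ} (hρ : 0 ≤ ρ) (hD : ∀ β ∈ Metric.closedBall β₀ ρ, ∀ i, ⟪z i, β⟫ ∈ m.D) :
    ∃ β ∈ Metric.closedBall β₀ ρ, ∀ x ∈ Metric.closedBall β₀ ρ, ⟪m.score z y β, x - β⟫ ≤ 0 := by
  set l : EuclideanSpace ℝ (Fin p) → ℝ := fun β =>
    ∑ i, m.φ⁻¹ * (y i * m.u ⟪z i, β⟫ - m.b (m.u ⟪z i, β⟫)) with hl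
  have hd : ∀ β ∈ Metric.closedBall β₀ ρ,
      HasFDerivAt l (∑ i, m.psi (y i) ⟪z i, β⟫ • innerSL ℝ (z i)) β := by
    intro β hβ
    refine HasFDerivAt.fun_sum fun i _ => ?_
    have h1 := hm.loglik_hasDerivAt hu (y i) (hD β hβ i)
    exact h1.comp_hasFDerivAt β (innerSL ℝ (z i)).hasFDerivAt
  obtain ⟨β, hβ, hmax⟩ := (isCompact_closedBall β₀ ρ).exists_isMaxOn ⟨β₀, by simpa using hρ⟩
    (fun β hβ => (hd β hβ).continuousAt.continuousWithinAt)
  refine ⟨β, hβ, fun x hx => ?_⟩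
  -- The ball is convex, so `x - β` is a tangent direction at `β`, in which the log-likelihood
  -- cannot increase to first order.
  have h1 := hmax.localize.hasFDerivWithinAt_nonpos (hd β hβ).hasFDerivWithinAt
    (sub_mem_posTangentConeAt_of_segment_subset
      ((convex_closedBall β₀ ρ).segment_subset hβ hx))
  rw [inner_score]
  simpa using h1

/-- The score is strongly monotone on the ball of radius `ρ` and small at its centre. -/
def IsGood (m : GLM) (z : Fin n → EuclideanSpace ℝ (Fin p)) (β₀ : EuclideanSpace ℝ (Fin p))
    (ρ c : ℝ) (y : Fin n → ℝ) : Prop :=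
  (∀ β₁ ∈ Metric.closedBall β₀ ρ, ∀ β₂ ∈ Metric.closedBall β₀ ρ,
    ⟪m.score z y β₁ - m.score z y β₂, β₁ - β₂⟫ ≤ -(c * ‖β₁ - β₂‖ ^ 2)) ∧
  ‖m.score z y β₀‖ < c * ρ

/-- For fixed `β` the score is continuous in the responses. Hence strong monotonicity, even over
uncountably many pairs, is a closed condition, and smallness at the centre is an open one. -/
lemma measurableSet_isGood (z : Fin n → EuclideanSpace ℝ (Fin p))
    (β₀ : EuclideanSpace ℝ (Fin p)) (ρ c : ℝ) : MeasurableSet {y | m.IsGood z β₀ ρ c y} := by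
  refine MeasurableSet.inter (IsClosed.measurableSet ?_) (IsOpen.measurableSet ?_)
  · have : {y : Fin n → ℝ | ∀ β₁ ∈ Metric.closedBall β₀ ρ, ∀ β₂ ∈ Metric.closedBall β₀ ρ,
        ⟪m.score z y β₁ - m.score z y β₂, β₁ - β₂⟫ ≤ -(c * ‖β₁ - β₂‖ ^ 2)} =
        ⋂ β₁ ∈ Metric.closedBall β₀ ρ, ⋂ β₂ ∈ Metric.closedBall β₀ ρ,
        {y | ⟪m.score z y β₁ - m.score z y β₂, β₁ - β₂⟫ ≤ -(c * ‖β₁ - β₂‖ ^ 2)} := by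
      ext y; simp
    change IsClosed {y : Fin n → ℝ | ∀ β₁ ∈ Metric.closedBall β₀ ρ,
      ∀ β₂ ∈ Metric.closedBall β₀ ρ, _}
    rw [this]
    refine isClosed_biInter fun β₁ _ => isClosed_biInter fun β₂ _ => ?_
    refine isClosed_le ?_ continuous_const
    exact ((continuous_score z β₁).sub (continuous_score z β₂)).inner continuous_const
  · exact isOpen_lt (continuous_score z β₀).norm continuous_const

/-- Monotonicity between a maximizer and the centre, together with the variational inequality there,
bounds the distance to the centre strictly below `ρ`. An interior maximizer has vanishing score. -/
lemma IsGood.exists_root (hm : m.IsValid) (hu : ContDiffOn ℝ 3 m.u m.D)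
    {z : Fin n → EuclideanSpace ℝ (Fin p)} {y : Fin n → ℝ} {β₀ : EuclideanSpace ℝ (Fin p)}
    {ρ c : ℝ} (hρ : 0 < ρ) (hc : 0 < c)
    (hD : ∀ β ∈ Metric.closedBall β₀ ρ, ∀ i, ⟪z i, β⟫ ∈ m.D) (hy : m.IsGood z β₀ ρ c y) :
    ∃ β ∈ Metric.closedBall β₀ ρ, m.score z y β = 0 ∧ c * ‖β - β₀‖ ≤ ‖m.score z y β₀‖ := by
  obtain ⟨β, hβ, hvar⟩ := hm.exists_variational hu z y β₀ hρ.le hD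
  have h0 : β₀ ∈ Metric.closedBall β₀ ρ := by simpa using hρ.le
  have h1 := hvar β₀ h0
  have h2 := hy.1 β hβ β₀ h0
  rw [inner_sub_left] at h2
  have h3 : ⟪m.score z y β, β₀ - β⟫ = -⟪m.score z y β, β - β₀⟫ := by
    rw [← inner_neg_right, neg_sub]
  have h4 := real_inner_le_norm (m.score z y β₀) (β - β₀)
  have h5 : c * ‖β - β₀‖ ≤ ‖m.score z y β₀‖ := by
    rcases eq_or_lt_of_le (norm_nonneg (β - β₀)) with h | h
    · rw [← h]; simp
    · refine le_of_mul_le_mul_right ?_ h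
      nlinarith
  refine ⟨β, hβ, ?_, h5⟩
  have h6 : ‖β - β₀‖ < ρ := lt_of_mul_lt_mul_left (h5.trans_lt hy.2) hc.le
  by_contra hne
  have hS : 0 < ‖m.score z y β‖ := norm_pos_iff.2 hne
  -- A step of this length along the score stays in the ball, by the triangle inequality.
  set ε := (ρ - ‖β - β₀‖) / ‖m.score z y β‖ with hε
  have hε0 : 0 < ε := div_pos (by linarith) hS
  have h7 := hvar (β + ε • m.score z y β) (by
    rw [mem_closedBall_iff_norm]
    calc _ = ‖(β - β₀) + ε • m.score z y β‖ := by congr 1; abel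
      _ ≤ ‖β - β₀‖ + ‖ε • m.score z y β‖ := norm_add_le _ _
      _ = ρ := by
        rw [norm_smul, Real.norm_of_nonneg hε0.le, hε, div_mul_cancel₀ _ hS.ne']
        ring)
  rw [add_sub_cancel_left, inner_smul_right, real_inner_self_eq_norm_sq] at h7
  have : 0 < ε * ‖m.score z y β‖ ^ 2 := by positivity
  linarith

/-- Strong monotonicity makes the root stable under changes of the responses. This gives continuity
of the root on good responses. -/
lemma IsGood.dist_root_le {z : Fin n → EuclideanSpace ℝ (Fin p)} {y y' : Fin n → ℝ}
    {β₀ β β' : EuclideanSpace ℝ (Fin p)} {ρ c : ℝ}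
    (hy : m.IsGood z β₀ ρ c y') (hβ : β ∈ Metric.closedBall β₀ ρ)
    (hβ' : β' ∈ Metric.closedBall β₀ ρ) (h : m.score z y β = 0) (h' : m.score z y' β' = 0) :
    c * dist β' β ≤ ‖m.score z y' β - m.score z y β‖ := by
  have h1 := hy.1 β hβ β' hβ'
  rw [h', sub_zero] at h1
  rw [h, sub_zero, dist_eq_norm, norm_sub_rev]
  have h2 := abs_real_inner_le_norm (m.score z y' β) (β - β')
  have h3 := neg_abs_le ⟪m.score z y' β, β - β'⟫
  rcases eq_or_lt_of_le (norm_nonneg (β - β')) with h | h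
  · rw [← h]; simp
  · refine le_of_mul_le_mul_right ?_ h
    nlinarith

/-- A measurable root of the score on the set of good responses. -/
lemma IsValid.exists_measurable_root (hm : m.IsValid) (hu : ContDiffOn ℝ 3 m.u m.D)
    (z : Fin n → EuclideanSpace ℝ (Fin p)) (β₀ : EuclideanSpace ℝ (Fin p))
    {ρ c : ℝ} (hρ : 0 < ρ) (hc : 0 < c)
    (hD : ∀ β ∈ Metric.closedBall β₀ ρ, ∀ i, ⟪z i, β⟫ ∈ m.D) :
    ∃ βhat : (Fin n → ℝ) → EuclideanSpace ℝ (Fin p), Measurable βhat ∧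
      ∀ y, m.IsGood z β₀ ρ c y → βhat y ∈ Metric.closedBall β₀ ρ ∧ m.score z y (βhat y) = 0 ∧
        c * ‖βhat y - β₀‖ ≤ ‖m.score z y β₀‖ := by
  classical
  choose! r hr using fun y (hy : m.IsGood z β₀ ρ c y) => hy.exists_root hm hu hρ hc hD
  set G := {y | m.IsGood z β₀ ρ c y} with hG
  refine ⟨G.piecewise r fun _ => β₀, ?_, fun y hy => ?_⟩
  -- The roots come from the axiom of choice, yet the choice is continuous on `G` by
  -- `IsGood.dist_root_le`.
  · refine ContinuousOn.measurable_piecewise (fun y hy => ?_) continuousOn_const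
      (measurableSet_isGood z β₀ ρ c)
    rw [ContinuousWithinAt, tendsto_iff_dist_tendsto_zero]
    have h1 : Tendsto (fun y' => c⁻¹ * ‖m.score z y' (r y) - m.score z y (r y)‖) (𝓝[G] y)
        (𝓝 0) := by
      have : Continuous fun y' => c⁻¹ * ‖m.score z y' (r y) - m.score z y (r y)‖ :=
        (((continuous_score z (r y)).sub continuous_const).norm).const_mul _
      have := (this.tendsto y).mono_left (nhdsWithin_le_nhds (s := G))
      simpa using this
    refine squeeze_zero' (Eventually.of_forall fun _ => dist_nonneg) ?_ h1
    filter_upwards [self_mem_nhdsWithin] with y' hy'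
    have := IsGood.dist_root_le hy' (hr y hy).1 (hr y' hy').1 (hr y hy).2.1 (hr y' hy').2.1
    rw [inv_mul_eq_div, le_div_iff₀ hc, mul_comm]
    exact this
  · rw [Set.piecewise_eq_of_mem _ _ _ (show y ∈ G from hy)]
    exact hr y hy

/-- The images of the ball under the linear predictors. -/
lemma inner_mem_image {z : Fin n → EuclideanSpace ℝ (Fin p)} {β₀ β : EuclideanSpace ℝ (Fin p)}
    {ρ : ℝ} (hβ : β ∈ Metric.closedBall β₀ ρ) (i : Fin n) :
    ⟪z i, β⟫ ∈ (fun β => ⟪z i, β⟫) '' Metric.closedBall β₀ ρ := ⟨β, hβ, rfl⟩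

/-- Strong monotonicity of the score, given control of the errors. -/
lemma IsValid.score_strongly_monotone (hm : m.IsValid) (hu : ContDiffOn ℝ 3 m.u m.D)
    (hw : ContDiffOn ℝ 1 m.w m.D) (z : Fin n → EuclideanSpace ℝ (Fin p))
    (β₀ : EuclideanSpace ℝ (Fin p)) {ρ M : ℝ} (hρ : 0 ≤ ρ) (hM : 0 ≤ M)
    (hb : ∀ i, m.BoundedOn ((fun β => ⟪z i, β⟫) '' Metric.closedBall β₀ ρ) M)
    {C c W : ℝ} (hC : 0 ≤ C) (hW : 0 ≤ W)
    (hc : ∀ x : EuclideanSpace ℝ (Fin p), c * n * ‖x‖ ^ 2 ≤ ∑ i, ⟪z i, x⟫ ^ 2)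
    (hC2 : ∀ x : EuclideanSpace ℝ (Fin p), ∑ i, ⟪z i, x⟫ ^ 2 ≤ C * n * ‖x‖ ^ 2)
    (hC4 : ∀ x : EuclideanSpace ℝ (Fin p), ∑ i, ⟪z i, x⟫ ^ 4 ≤ C * n * ‖x‖ ^ 4)
    (hwW : ∀ i, W ≤ m.w ⟪z i, β₀⟫) {y : Fin n → ℝ} {η K σ : ℝ} (hK : 0 ≤ K) (hσ : 0 ≤ σ)
    (hquad : ∀ x : EuclideanSpace ℝ (Fin p),
      |∑ i, m.φ⁻¹ * iteratedDeriv 2 m.u ⟪z i, β₀⟫ * (y i - m.h ⟪z i, β₀⟫) * ⟪z i, x⟫ ^ 2| ≤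
        η * n * ‖x‖ ^ 2)
    (htail : ∑ i, (if K < |y i - m.h ⟪z i, β₀⟫| then y i - m.h ⟪z i, β₀⟫ else 0) ^ 2 ≤ σ * n)
    {β₁ β₂ : EuclideanSpace ℝ (Fin p)} (h₁ : β₁ ∈ Metric.closedBall β₀ ρ)
    (h₂ : β₂ ∈ Metric.closedBall β₀ ρ) :
    ⟪m.score z y β₁ - m.score z y β₂, β₁ - β₂⟫ ≤
      -((W * c - η - (m.φ⁻¹ * M * K + (m.φ⁻¹ * M ^ 2 + M)) * (2 * C * ρ) -
        2 * (m.φ⁻¹ * M) * √(C * σ)) * n * ‖β₁ - β₂‖ ^ 2) := by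
  classical
  have hφ := hm.φ_pos
  have h₀ : β₀ ∈ Metric.closedBall β₀ ρ := by simpa using hρ
  choose r hr hr' using fun i => (hb i).exists_psi_sub hm hu hw (inner_mem_image h₀ i)
    (inner_mem_image h₁ i) (inner_mem_image h₂ i) (y i)
  set δ := β₁ - β₂ with hδ
  set e : Fin n → ℝ := fun i => y i - m.h ⟪z i, β₀⟫ with he
  -- The part of the error beyond `K`; the rest is at most `K`, so its share of the remainder is
  -- small with `ρ`.
  set e₂ : Fin n → ℝ := fun i => if K < |e i| then e i else 0 with he₂
  set d : Fin n → ℝ := fun i => |⟪z i, β₁ - β₀⟫| + |⟪z i, β₂ - β₀⟫| with hd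
  set L := m.φ⁻¹ * M * K + (m.φ⁻¹ * M ^ 2 + M) with hL
  have hL0 : 0 ≤ L := by positivity
  have hrb : ∀ i, |r i| ≤ L * d i + 2 * (m.φ⁻¹ * M) * |e₂ i| := by
    intro i
    refine (hr' i (e i - e₂ i) (e₂ i) (by simp [he])).trans ?_
    have h1 : |e i - e₂ i| ≤ K := by
      simp only [he₂]
      split_ifs with h
      · simpa using hK
      · simpa using not_lt.1 h
    simp only [hd, inner_sub_right, hL]
    gcongr
  have hexp : ⟪m.score z y β₁ - m.score z y β₂, δ⟫ =
      ∑ i, m.φ⁻¹ * iteratedDeriv 2 m.u ⟪z i, β₀⟫ * e i * ⟪z i, δ⟫ ^ 2 -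
      ∑ i, m.w ⟪z i, β₀⟫ * ⟪z i, δ⟫ ^ 2 + ∑ i, r i * ⟪z i, δ⟫ ^ 2 := by
    rw [inner_sub_left, inner_score, inner_score, ← Finset.sum_sub_distrib,
      ← Finset.sum_sub_distrib, ← Finset.sum_add_distrib]
    refine Finset.sum_congr rfl fun i _ => ?_
    rw [← sub_mul, hr i, ← inner_sub_right]
    ring
  have hwsum : W * c * n * ‖δ‖ ^ 2 ≤ ∑ i, m.w ⟪z i, β₀⟫ * ⟪z i, δ⟫ ^ 2 := by
    calc _ = W * (c * n * ‖δ‖ ^ 2) := by ring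
      _ ≤ W * ∑ i, ⟪z i, δ⟫ ^ 2 := by gcongr; exact hc δ
      _ = ∑ i, W * ⟪z i, δ⟫ ^ 2 := Finset.mul_sum _ _ _
      _ ≤ _ := Finset.sum_le_sum fun i _ => by gcongr; exact hwW i
  have hball : ∀ β ∈ Metric.closedBall β₀ ρ, ∑ i, ⟪z i, β - β₀⟫ ^ 2 ≤ C * n * ρ ^ 2 := by
    intro β hβ
    refine (hC2 _).trans ?_
    have := mem_closedBall_iff_norm.1 hβ
    gcongr
  have hdsum : ∑ i, d i ^ 2 ≤ 4 * C * ρ ^ 2 * n := by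
    calc _ ≤ ∑ i, (2 * ⟪z i, β₁ - β₀⟫ ^ 2 + 2 * ⟪z i, β₂ - β₀⟫ ^ 2) := by
          refine Finset.sum_le_sum fun i _ => ?_
          simp only [hd]
          nlinarith [sq_abs ⟪z i, β₁ - β₀⟫, sq_abs ⟪z i, β₂ - β₀⟫,
            sq_nonneg (|⟪z i, β₁ - β₀⟫| - |⟪z i, β₂ - β₀⟫|)]
      _ = 2 * ∑ i, ⟪z i, β₁ - β₀⟫ ^ 2 + 2 * ∑ i, ⟪z i, β₂ - β₀⟫ ^ 2 := by
          rw [Finset.sum_add_distrib, Finset.mul_sum, Finset.mul_sum]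
      _ ≤ _ := by linarith [hball β₁ h₁, hball β₂ h₂]
  have hd0 : ∀ i, |d i| = d i := fun i => abs_of_nonneg (by simp only [hd]; positivity)
  -- The displacements `d i` are small only in mean square, not uniformly in `i`; Cauchy-Schwarz
  -- against the fourth moments of the design makes that suffice.
  have hs1 := sum_abs_mul_sq_le z d hC (by positivity) (hC4 δ) hdsum
  have hs2 := sum_abs_mul_sq_le z e₂ hC hσ (hC4 δ) htail
  simp only [hd0] at hs1
  have hsq : √(C * (4 * C * ρ ^ 2)) = 2 * C * ρ := by
    rw [show C * (4 * C * ρ ^ 2) = (2 * C * ρ) ^ 2 by ring, Real.sqrt_sq (by positivity)]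
  rw [hsq] at hs1
  have hrsum : ∑ i, r i * ⟪z i, δ⟫ ^ 2 ≤ L * (2 * C * ρ * n * ‖δ‖ ^ 2) +
      2 * (m.φ⁻¹ * M) * (√(C * σ) * n * ‖δ‖ ^ 2) := by
    calc _ ≤ ∑ i, (L * (d i * ⟪z i, δ⟫ ^ 2) + 2 * (m.φ⁻¹ * M) * (|e₂ i| * ⟪z i, δ⟫ ^ 2)) := by
          refine Finset.sum_le_sum fun i _ => ?_
          have := mul_le_mul_of_nonneg_right ((le_abs_self _).trans (hrb i))
            (sq_nonneg ⟪z i, δ⟫)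
          linarith
      _ = L * ∑ i, d i * ⟪z i, δ⟫ ^ 2 + 2 * (m.φ⁻¹ * M) * ∑ i, |e₂ i| * ⟪z i, δ⟫ ^ 2 := by
          rw [Finset.sum_add_distrib, Finset.mul_sum, Finset.mul_sum]
      _ ≤ _ := by gcongr
  have hq := (le_abs_self _).trans (hquad δ)
  rw [hexp]
  linarith

/-- First-order expansion of the score around the true parameter. -/
lemma IsValid.score_expansion (hm : m.IsValid) (hu : ContDiffOn ℝ 3 m.u m.D)
    (hw : ContDiffOn ℝ 1 m.w m.D) (z : Fin n → EuclideanSpace ℝ (Fin p))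
    (β₀ : EuclideanSpace ℝ (Fin p)) {ρ M : ℝ} (hρ : 0 ≤ ρ) (hM : 0 ≤ M)
    (hb : ∀ i, m.BoundedOn ((fun β => ⟪z i, β⟫) '' Metric.closedBall β₀ ρ) M)
    {C : ℝ} (hC : 0 ≤ C)
    (hC4 : ∀ x : EuclideanSpace ℝ (Fin p), ∑ i, ⟪z i, x⟫ ^ 4 ≤ C * n * ‖x‖ ^ 4)
    (y : Fin n → ℝ) {β : EuclideanSpace ℝ (Fin p)} (hβ : β ∈ Metric.closedBall β₀ ρ)
    (a : EuclideanSpace ℝ (Fin p)) :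
    |⟪m.score z y β, a⟫ - ⟪m.score z y β₀, a⟫ +
      ∑ i, m.w ⟪z i, β₀⟫ * ⟪z i, a⟫ * ⟪z i, β - β₀⟫| ≤
    ‖∑ i, (m.φ⁻¹ * iteratedDeriv 2 m.u ⟪z i, β₀⟫ * (y i - m.h ⟪z i, β₀⟫) * ⟪z i, a⟫) • z i‖ *
      ‖β - β₀‖ + (m.φ⁻¹ * M + (m.φ⁻¹ * M ^ 2 + M)) *
        (√(∑ i, ⟪z i, a⟫ ^ 2 * (|y i - m.h ⟪z i, β₀⟫| + 1) ^ 2) * (√(C * n) * ‖β - β₀‖ ^ 2)) := by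
  have hφ := hm.φ_pos
  have h₀ : β₀ ∈ Metric.closedBall β₀ ρ := by simpa using hρ
  choose r hr hr' using fun i => (hb i).exists_psi_sub hm hu hw (inner_mem_image h₀ i)
    (inner_mem_image hβ i) (inner_mem_image h₀ i) (y i)
  set δ := β - β₀ with hδ
  set e : Fin n → ℝ := fun i => y i - m.h ⟪z i, β₀⟫ with he
  set L := m.φ⁻¹ * M + (m.φ⁻¹ * M ^ 2 + M) with hL
  have hrb : ∀ i, |r i| ≤ L * (|e i| + 1) * |⟪z i, δ⟫| := by
    intro i
    -- Here the whole error goes into `e₁`, so that the remainder is of second order in `δ`.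
    refine (hr' i (e i) 0 (by simp [he])).trans ?_
    rw [← inner_sub_right, ← inner_sub_right, sub_self, inner_zero_right, abs_zero, mul_zero,
      add_zero, add_zero]
    gcongr
    have h1 : 0 ≤ m.φ⁻¹ * M := by positivity
    have h2 : 0 ≤ m.φ⁻¹ * M ^ 2 + M := by positivity
    have := abs_nonneg (e i)
    simp only [hL]
    nlinarith
  have hexp : ⟪m.score z y β, a⟫ - ⟪m.score z y β₀, a⟫ +
      ∑ i, m.w ⟪z i, β₀⟫ * ⟪z i, a⟫ * ⟪z i, δ⟫ =
      ⟪∑ i, (m.φ⁻¹ * iteratedDeriv 2 m.u ⟪z i, β₀⟫ * e i * ⟪z i, a⟫) • z i, δ⟫ +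
      ∑ i, r i * ⟪z i, a⟫ * ⟪z i, δ⟫ := by
    simp only [inner_score, sum_inner, real_inner_smul_left]
    rw [← Finset.sum_sub_distrib, ← Finset.sum_add_distrib, ← Finset.sum_add_distrib]
    refine Finset.sum_congr rfl fun i _ => ?_
    rw [← sub_mul, hr i, ← inner_sub_right]
    ring
  rw [hexp]
  refine (abs_add_le _ _).trans (add_le_add (abs_real_inner_le_norm _ _) ?_)
  calc _ ≤ ∑ i, |r i * ⟪z i, a⟫ * ⟪z i, δ⟫| := Finset.abs_sum_le_sum_abs _ _
    _ ≤ ∑ i, L * ((|⟪z i, a⟫| * (|e i| + 1)) * ⟪z i, δ⟫ ^ 2) := by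
      refine Finset.sum_le_sum fun i _ => ?_
      rw [abs_mul, abs_mul]
      calc _ ≤ L * (|e i| + 1) * |⟪z i, δ⟫| * |⟪z i, a⟫| * |⟪z i, δ⟫| := by
            gcongr; exact hrb i
        _ = _ := by rw [← sq_abs ⟪z i, δ⟫]; ring
    _ = L * ∑ i, (|⟪z i, a⟫| * (|e i| + 1)) * ⟪z i, δ⟫ ^ 2 := by rw [Finset.mul_sum]
    _ ≤ _ := by
      gcongr
      refine (Real.sum_mul_le_sqrt_mul_sqrt _ _ _).trans ?_
      simp only [mul_pow, sq_abs, ← pow_mul]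
      gcongr
      refine Real.sqrt_le_iff.2 ⟨by positivity, ?_⟩
      rw [mul_pow, Real.sq_sqrt (by positivity), ← pow_mul]
      exact hC4 δ

end GLM

/-! ### Lindeberg's theorem through characteristic functions -/

/-- Exchange the factors one at a time: the others lie in the unit disc and do not enlarge the
difference. -/
lemma norm_prod_sub_prod_le {ι : Type*} (s : Finset ι) (a b : ι → ℂ) (ha : ∀ i, ‖a i‖ ≤ 1)
    (hb : ∀ i, ‖b i‖ ≤ 1) : ‖∏ i ∈ s, a i - ∏ i ∈ s, b i‖ ≤ ∑ i ∈ s, ‖a i - b i‖ := by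
  classical
  induction s using Finset.induction_on with
  | empty => simp
  | insert j s hj ih =>
    rw [Finset.prod_insert hj, Finset.prod_insert hj, Finset.sum_insert hj]
    have hp : ‖∏ i ∈ s, b i‖ ≤ 1 := by
      rw [norm_prod]
      exact Finset.prod_le_one (fun _ _ => norm_nonneg _) fun i _ => hb i
    have h1 : a j * ∏ i ∈ s, a i - b j * ∏ i ∈ s, b i =
        (a j - b j) * ∏ i ∈ s, b i + a j * (∏ i ∈ s, a i - ∏ i ∈ s, b i) := by ring
    rw [h1]
    refine (norm_add_le _ _).trans (add_le_add ?_ ?_)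
    · rw [norm_mul]
      exact mul_le_of_le_one_right (norm_nonneg _) hp
    · rw [norm_mul]
      exact (mul_le_of_le_one_left (norm_nonneg _) (ha j)).trans ih

/-- Second-order Taylor expansion of `exp (i x)` with two competing remainder bounds. -/
lemma norm_exp_mul_I_sub_taylor_two_le (x : ℝ) :
    ‖Complex.exp (x * Complex.I) - (1 + x * Complex.I - x ^ 2 / 2)‖ ≤ 4 * |x| ^ 3 ∧
    ‖Complex.exp (x * Complex.I) - (1 + x * Complex.I - x ^ 2 / 2)‖ ≤ 4 * x ^ 2 := by
  have hnorm : ‖(x : ℂ) * Complex.I‖ = |x| := by simp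
  rcases le_total |x| 1 with h | h
  · have h1 := Complex.exp_bound (x := x * Complex.I) (by rw [hnorm]; exact h)
      (n := 3) (by norm_num)
    have h2 : ∑ k ∈ Finset.range 3, ((x : ℂ) * Complex.I) ^ k / (k.factorial : ℂ) =
        1 + x * Complex.I - x ^ 2 / 2 := by
      simp only [Finset.sum_range_succ, Finset.sum_range_zero, Nat.factorial, mul_pow,
        Complex.I_sq]
      push_cast
      ring
    rw [h2, hnorm] at h1
    have h3 : |x| ^ 3 * (((Nat.succ 3 : ℕ) : ℝ) * (((Nat.factorial 3 : ℕ) : ℝ) * ((3 : ℕ) : ℝ))⁻¹) ≤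
        |x| ^ 3 := by
      refine mul_le_of_le_one_right (by positivity) ?_
      norm_num [Nat.factorial]
    have h4 : |x| ^ 3 ≤ x ^ 2 := by
      rw [← sq_abs x, pow_succ]
      exact mul_le_of_le_one_right (by positivity) h
    have h5 : 0 ≤ |x| ^ 3 := by positivity
    have h6 := h1.trans h3
    exact ⟨by linarith, by nlinarith⟩
  · have h1 : ‖Complex.exp (x * Complex.I) - (1 + x * Complex.I - x ^ 2 / 2)‖ ≤
        1 + (1 + |x| + x ^ 2 / 2) := by
      refine (norm_sub_le _ _).trans (add_le_add (Complex.norm_exp_ofReal_mul_I x).le ?_)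
      refine (norm_sub_le _ _).trans (add_le_add ((norm_add_le _ _).trans ?_) ?_)
      · rw [hnorm]; simp
      · rw [norm_div, norm_pow, Complex.norm_real, Real.norm_eq_abs, sq_abs]
        simp
    have h2 : x ^ 2 = |x| ^ 2 := (sq_abs x).symm
    have h3 : |x| ≤ |x| ^ 2 := by nlinarith
    have h4 : |x| ^ 2 ≤ |x| ^ 3 := by
      rw [pow_succ |x| 2]
      exact le_mul_of_one_le_right (by positivity) h
    exact ⟨by linarith, by linarith⟩

/-- A quantitative expansion of the characteristic function of a centred random variable. -/
lemma norm_charFun_sub_le {Ω : Type*} [MeasurableSpace Ω] (P : Measure Ω) [IsProbabilityMeasure P]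
    {e : Ω → ℝ} (he : Measurable e) (hL : MemLp e 2 P) (h0 : ∫ ω, e ω ∂P = 0) {K ε : ℝ}
    (hK : 0 ≤ K) (htail : ∫ ω, {ω | K < |e ω|}.indicator (fun ω => e ω ^ 2) ω ∂P ≤ ε) (s : ℝ) :
    ‖charFun (P.map e) s - ((1 - s ^ 2 * (∫ ω, e ω ^ 2 ∂P) / 2 : ℝ) : ℂ)‖ ≤
      4 * |s| ^ 3 * K * (∫ ω, e ω ^ 2 ∂P) + 4 * s ^ 2 * ε := by
  have hi1 : Integrable e P := hL.integrable (by norm_num)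
  have hi2 : Integrable (fun ω => e ω ^ 2) P := hL.integrable_sq
  have hi3 : Integrable ({ω | K < |e ω|}.indicator (fun ω => e ω ^ 2)) P :=
    hi2.indicator (measurableSet_lt measurable_const he.abs)
  have hexp : Integrable (fun ω => Complex.exp ((s * e ω : ℝ) * Complex.I)) P := by
    refine Integrable.of_bound (by fun_prop) 1 (ae_of_all _ fun ω => ?_)
    rw [Complex.norm_exp_ofReal_mul_I]
  have hq : Integrable (fun ω => ((1 - s ^ 2 * e ω ^ 2 / 2 : ℝ) : ℂ) +
      ((s * e ω : ℝ) : ℂ) * Complex.I) P :=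
    (((integrable_const _).sub ((hi2.const_mul _).div_const 2)).ofReal).add
      ((hi1.const_mul s).ofReal.mul_const _)
  have h1 : charFun (P.map e) s = ∫ ω, Complex.exp ((s * e ω : ℝ) * Complex.I) ∂P := by
    rw [charFun_apply_real, integral_map he.aemeasurable (by fun_prop)]
    simp
  have h2 : ((1 - s ^ 2 * (∫ ω, e ω ^ 2 ∂P) / 2 : ℝ) : ℂ) =
      ∫ ω, (((1 - s ^ 2 * e ω ^ 2 / 2 : ℝ) : ℂ) + ((s * e ω : ℝ) : ℂ) * Complex.I) ∂P := by
    rw [integral_add (((integrable_const _).sub ((hi2.const_mul _).div_const 2)).ofReal)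
      ((hi1.const_mul s).ofReal.mul_const _), integral_complex_ofReal, integral_mul_const,
      integral_complex_ofReal, integral_const_mul, h0,
      integral_sub (integrable_const _) ((hi2.const_mul _).div_const 2), integral_div,
      integral_const_mul]
    simp
  rw [h1, h2, ← integral_sub hexp hq]
  refine (norm_integral_le_of_norm_le (g := fun ω => 4 * |s| ^ 3 * K * e ω ^ 2 +
    4 * s ^ 2 * {ω | K < |e ω|}.indicator (fun ω => e ω ^ 2) ω)
    ((hi2.const_mul _).add (hi3.const_mul _)) (ae_of_all _ fun ω => ?_)).trans ?_
  · have h3 := norm_exp_mul_I_sub_taylor_two_le (s * e ω)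
    have h4 : Complex.exp ((s * e ω : ℝ) * Complex.I) -
        (((1 - s ^ 2 * e ω ^ 2 / 2 : ℝ) : ℂ) + ((s * e ω : ℝ) : ℂ) * Complex.I) =
        Complex.exp ((s * e ω : ℝ) * Complex.I) -
        (1 + (s * e ω : ℝ) * Complex.I - ((s * e ω : ℝ) : ℂ) ^ 2 / 2) := by
      push_cast; ring
    rw [h4]
    -- The quadratic bound serves the tail, where no third moment is available; elsewhere the cubic
    -- bound gains a factor `|s|`.
    by_cases hKe : K < |e ω|
    · rw [Set.indicator_of_mem (by exact hKe)]
      refine h3.2.trans ?_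
      have : 0 ≤ 4 * |s| ^ 3 * K * e ω ^ 2 := by positivity
      rw [mul_pow]
      linarith
    · rw [Set.indicator_of_notMem (by exact hKe), mul_zero, add_zero]
      refine h3.1.trans ?_
      rw [abs_mul, mul_pow, pow_succ |e ω| 2, sq_abs]
      push Not at hKe
      calc 4 * (|s| ^ 3 * (e ω ^ 2 * |e ω|)) ≤ 4 * (|s| ^ 3 * (e ω ^ 2 * K)) := by gcongr
        _ = _ := by ring
  · rw [integral_add (hi2.const_mul _) (hi3.const_mul _), integral_const_mul, integral_const_mul]
    gcongr

section CentralLimit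

variable {Ω : ℕ → Type*} [∀ n, MeasurableSpace (Ω n)] {P : ∀ n, Measure (Ω n)}
  [∀ n, IsProbabilityMeasure (P n)]

/-- Lindeberg's central limit theorem for weighted sums, in terms of characteristic functions. -/
lemma IsErrorArray.tendsto_charFun {e : ∀ n, Fin n → Ω n → ℝ} {V : ℝ} (h : IsErrorArray P e V)
    (c : ∀ n, Fin n → ℝ) {L : ℝ}
    (hvar : ∀ᶠ n in atTop, ∑ i, c n i ^ 2 * ∫ ω, e n i ω ^ 2 ∂(P n) = 1)
    (hsum : ∀ᶠ n in atTop, ∑ i, c n i ^ 2 ≤ L)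
    (hmax : ∀ κ > 0, ∀ᶠ n in atTop, ∀ i, |c n i| ≤ κ) (t : ℝ) :
    Tendsto (fun n => charFun ((P n).map fun ω => ∑ i, c n i * e n i ω) t) atTop
      (𝓝 (Complex.exp (-(t ^ 2 / 2 : ℝ)))) := by
  set v : ∀ n, Fin n → ℝ := fun n i => ∫ ω, e n i ω ^ 2 ∂(P n) with hv
  have hv0 : ∀ n i, 0 ≤ v n i := fun n i => integral_nonneg fun ω => sq_nonneg _
  have hvV : ∀ n i, v n i ≤ V := h.integral_sq_le
  have hbound : ∀ ε > 0, ∀ K : ℝ, 1 ≤ K → (∀ n i,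
      ∫ ω, {ω | K < |e n i ω|}.indicator (fun ω => e n i ω ^ 2) ω ∂(P n) ≤ ε) → ∀ κ > 0,
      ∀ᶠ n in atTop, ‖charFun ((P n).map fun ω => ∑ i, c n i * e n i ω) t -
        Complex.exp (-(t ^ 2 / 2 : ℝ))‖ ≤
        4 * |t| ^ 3 * K * κ + 4 * t ^ 2 * ε * L + t ^ 4 * V * κ ^ 2 := by
    intro ε hε K hK htail κ hκ
    -- This second threshold brings the exponents into the range where `|exp x - 1 - x| ≤ x²`.
    obtain ⟨κ', hκ', hκ'1⟩ : ∃ κ' > 0, t ^ 2 * κ' ^ 2 * V / 2 ≤ 1 := by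
      have : Tendsto (fun κ' : ℝ => t ^ 2 * κ' ^ 2 * V / 2) (𝓝[>] 0) (𝓝 0) := by
        have : Continuous fun κ' : ℝ => t ^ 2 * κ' ^ 2 * V / 2 := by fun_prop
        simpa using (this.tendsto 0).mono_left nhdsWithin_le_nhds
      obtain ⟨κ', h1, h2⟩ := ((this.eventually_le_const one_pos).and self_mem_nhdsWithin).exists
      exact ⟨κ', h2, h1⟩
    filter_upwards [hvar, hsum, hmax κ hκ, hmax κ' hκ'] with n h1 h2 h3 h4
    have hprod : charFun ((P n).map fun ω => ∑ i, c n i * e n i ω) t =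
        ∏ i, charFun ((P n).map (e n i)) (c n i * t) := by
      have hind : iIndepFun (fun i ω => c n i * e n i ω) (P n) :=
        (h.indep n).comp (fun i x => c n i * x) fun i => by fun_prop
      rw [hind.charFun_map_fun_sum_eq_prod
        fun i => ((h.measurable n i).const_mul _).aemeasurable]
      rw [Finset.prod_apply]
      exact Finset.prod_congr rfl fun i _ => charFun_map_mul_comp (h.measurable n i).aemeasurable _ _
    -- The variances of the summands add up to one, so the Gaussian limit factors into the
    -- characteristic functions of matching Gaussians.
    have hexp : Complex.exp (-(t ^ 2 / 2 : ℝ)) =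
        ∏ i, ((Real.exp (-((c n i * t) ^ 2 * v n i / 2)) : ℝ) : ℂ) := by
      rw [← Complex.ofReal_prod, ← Real.exp_sum, ← Complex.ofReal_neg, ← Complex.ofReal_exp]
      congr 2
      rw [Finset.sum_neg_distrib]
      congr 1
      calc t ^ 2 / 2 = t ^ 2 / 2 * ∑ i, c n i ^ 2 * v n i := by rw [h1, mul_one]
        _ = _ := by rw [Finset.mul_sum]; exact Finset.sum_congr rfl fun i _ => by ring
    have hpm : ∀ i, IsProbabilityMeasure ((P n).map (e n i)) := fun i =>
      Measure.isProbabilityMeasure_map (h.measurable n i).aemeasurable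
    rw [hprod, hexp]
    refine (norm_prod_sub_prod_le _ _ _ (fun i => norm_charFun_le_one _) fun i => ?_).trans ?_
    · rw [Complex.norm_real, Real.norm_of_nonneg (Real.exp_nonneg _)]
      refine Real.exp_le_one_iff.2 ?_
      have := hv0 n i
      have : 0 ≤ (c n i * t) ^ 2 * v n i / 2 := by positivity
      linarith
    calc _ ≤ ∑ i, (4 * |t| ^ 3 * K * κ * (c n i ^ 2 * v n i) + 4 * t ^ 2 * ε * c n i ^ 2 +
          t ^ 4 * V * κ ^ 2 * (c n i ^ 2 * v n i)) := by
          refine Finset.sum_le_sum fun i _ => ?_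
          have e1 := norm_charFun_sub_le (P n) (h.measurable n i) (h.memLp n i)
            (h.integral_eq_zero n i) (by linarith) (htail n i) (c n i * t)
          have hv0i := hv0 n i
          have hVi := hvV n i
          have hV0 : 0 ≤ V := hv0i.trans hVi
          have hc4 : c n i ^ 2 ≤ κ' ^ 2 := by rw [← sq_abs]; gcongr; exact h4 i
          have hc3 : c n i ^ 2 ≤ κ ^ 2 := by rw [← sq_abs]; gcongr; exact h3 i
          have hx0 : 0 ≤ (c n i * t) ^ 2 * v n i / 2 := by positivity
          have hx1 : (c n i * t) ^ 2 * v n i / 2 ≤ 1 := by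
            refine le_trans ?_ hκ'1
            rw [mul_pow, mul_comm (c n i ^ 2)]
            gcongr
          have e2 : ‖((1 - (c n i * t) ^ 2 * v n i / 2 : ℝ) : ℂ) -
              ((Real.exp (-((c n i * t) ^ 2 * v n i / 2)) : ℝ) : ℂ)‖ ≤
              ((c n i * t) ^ 2 * v n i / 2) ^ 2 := by
            rw [← Complex.ofReal_sub, Complex.norm_real, norm_sub_rev]
            have := Real.norm_exp_sub_one_sub_id_le (x := -((c n i * t) ^ 2 * v n i / 2))
              (by rw [norm_neg, Real.norm_of_nonneg hx0]; exact hx1)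
            rw [norm_neg, Real.norm_of_nonneg hx0] at this
            rwa [show Real.exp (-((c n i * t) ^ 2 * v n i / 2)) - 1 -
              -((c n i * t) ^ 2 * v n i / 2) = Real.exp (-((c n i * t) ^ 2 * v n i / 2)) -
              (1 - (c n i * t) ^ 2 * v n i / 2) by ring] at this
          refine (norm_sub_le_norm_sub_add_norm_sub _ _ _).trans ((add_le_add e1 e2).trans ?_)
          have e3 : |c n i * t| ^ 3 = |t| ^ 3 * (|c n i| * c n i ^ 2) := by
            rw [abs_mul, mul_pow, ← sq_abs (c n i)]; ring
          have e4 : ((c n i * t) ^ 2 * v n i / 2) ^ 2 ≤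
              t ^ 4 * V * κ ^ 2 * (c n i ^ 2 * v n i) := by
            calc _ = t ^ 4 * (v n i * (c n i ^ 2 / 4)) * (c n i ^ 2 * v n i) := by ring
              _ ≤ t ^ 4 * (V * κ ^ 2) * (c n i ^ 2 * v n i) := by
                gcongr
                linarith [sq_nonneg (c n i)]
              _ = _ := by ring
          have e5 : 4 * |c n i * t| ^ 3 * K * v n i ≤
              4 * |t| ^ 3 * K * κ * (c n i ^ 2 * v n i) := by
            rw [e3]
            calc _ = 4 * |t| ^ 3 * K * |c n i| * (c n i ^ 2 * v n i) := by ring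
              _ ≤ _ := by
                gcongr
                exact h3 i
          have e6 : 4 * (c n i * t) ^ 2 * ε = 4 * t ^ 2 * ε * c n i ^ 2 := by ring
          linarith
      _ = 4 * |t| ^ 3 * K * κ * ∑ i, c n i ^ 2 * v n i + 4 * t ^ 2 * ε * ∑ i, c n i ^ 2 +
          t ^ 4 * V * κ ^ 2 * ∑ i, c n i ^ 2 * v n i := by
          rw [Finset.sum_add_distrib, Finset.sum_add_distrib, Finset.mul_sum, Finset.mul_sum,
            Finset.mul_sum]
      _ ≤ _ := by
          rw [h1, mul_one, mul_one]
          gcongr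
  rw [tendsto_iff_norm_sub_tendsto_zero]
  refine tendsto_order.2 ⟨fun a ha => Eventually.of_forall fun n => ha.trans_le (norm_nonneg _),
    fun ζ hζ => ?_⟩
  -- The tail level `ε` comes first; it determines `K`, and only then can `κ` be small relative to
  -- `K`.
  have t1 : Tendsto (fun ε : ℝ => 4 * t ^ 2 * ε * L) (𝓝[>] 0) (𝓝 0) := by
    have : Continuous fun ε : ℝ => 4 * t ^ 2 * ε * L := by fun_prop
    simpa using (this.tendsto 0).mono_left nhdsWithin_le_nhds
  obtain ⟨ε, hε1, hε⟩ := ((t1.eventually_lt_const (show 0 < ζ / 2 by positivity)).and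
    self_mem_nhdsWithin).exists
  obtain ⟨K, hK, htail⟩ := h.tail ε hε
  have t2 : Tendsto (fun κ : ℝ => 4 * |t| ^ 3 * K * κ + t ^ 4 * V * κ ^ 2) (𝓝[>] 0) (𝓝 0) := by
    have : Continuous fun κ : ℝ => 4 * |t| ^ 3 * K * κ + t ^ 4 * V * κ ^ 2 := by fun_prop
    simpa using (this.tendsto 0).mono_left nhdsWithin_le_nhds
  obtain ⟨κ, hκ1, hκ⟩ := ((t2.eventually_lt_const (show 0 < ζ / 2 by positivity)).and
    self_mem_nhdsWithin).exists
  filter_upwards [hbound ε hε K hK htail κ hκ] with n hn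
  linarith

/-- Slutsky's theorem for characteristic functions, on varying probability spaces. -/
lemma tendsto_charFun_of_tendsto_measureReal {X S : ∀ n, Ω n → ℝ} (hX : ∀ n, Measurable (X n))
    (hS : ∀ n, Measurable (S n))
    (hXS : ∀ ε > 0, Tendsto (fun n => (P n).real {ω | ε ≤ |X n ω - S n ω|}) atTop (𝓝 0))
    {t : ℝ} {a : ℂ} (h : Tendsto (fun n => charFun ((P n).map (S n)) t) atTop (𝓝 a)) :
    Tendsto (fun n => charFun ((P n).map (X n)) t) atTop (𝓝 a) := by
  have hle : ∀ ε > 0, ∀ n, ‖charFun ((P n).map (X n)) t - charFun ((P n).map (S n)) t‖ ≤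
      |t| * ε + 2 * (P n).real {ω | ε ≤ |X n ω - S n ω|} := by
    intro ε hε n
    have hms : MeasurableSet {ω | ε ≤ |X n ω - S n ω|} :=
      measurableSet_le measurable_const ((hX n).sub (hS n)).abs
    have hi : ∀ Z : Ω n → ℝ, Measurable Z →
        Integrable (fun ω => Complex.exp (Complex.I * (t * Z ω : ℝ))) (P n) := by
      intro Z hZ
      refine Integrable.of_bound (by fun_prop) 1 (ae_of_all _ fun ω => ?_)
      rw [mul_comm, Complex.norm_exp_ofReal_mul_I]
    have hcf : ∀ Z : Ω n → ℝ, Measurable Z → charFun ((P n).map Z) t =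
        ∫ ω, Complex.exp (Complex.I * (t * Z ω : ℝ)) ∂(P n) := by
      intro Z hZ
      rw [charFun_apply_real, integral_map hZ.aemeasurable (by fun_prop)]
      refine integral_congr_ae (ae_of_all _ fun ω => ?_)
      push_cast
      ring_nf
    rw [hcf _ (hX n), hcf _ (hS n), ← integral_sub (hi _ (hX n)) (hi _ (hS n))]
    refine (norm_integral_le_of_norm_le (g := fun ω => |t| * ε +
      {ω | ε ≤ |X n ω - S n ω|}.indicator (fun _ => (2 : ℝ)) ω)
      ((integrable_const _).add ((integrable_const _).indicator hms))
      (ae_of_all _ fun ω => ?_)).trans_eq ?_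
    · by_cases hω : ε ≤ |X n ω - S n ω|
      · rw [Set.indicator_of_mem (by exact hω)]
        refine (norm_sub_le _ _).trans ?_
        rw [mul_comm, Complex.norm_exp_ofReal_mul_I, mul_comm, Complex.norm_exp_ofReal_mul_I]
        have : 0 ≤ |t| * ε := by positivity
        linarith
      · rw [Set.indicator_of_notMem (by exact hω), add_zero]
        push Not at hω
        have h1 : Complex.exp (Complex.I * (t * X n ω : ℝ)) -
            Complex.exp (Complex.I * (t * S n ω : ℝ)) =
            Complex.exp ((t * S n ω : ℝ) * Complex.I) *
            (Complex.exp (Complex.I * (t * (X n ω - S n ω) : ℝ)) - 1) := by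
          rw [mul_sub, ← Complex.exp_add, mul_one]
          congr 2
          · push_cast; ring
          · rw [mul_comm]
        rw [h1, norm_mul, Complex.norm_exp_ofReal_mul_I, one_mul]
        refine Real.norm_exp_I_mul_ofReal_sub_one_le.trans ?_
        rw [Real.norm_eq_abs, abs_mul]
        gcongr
    · rw [integral_add (integrable_const _) ((integrable_const _).indicator hms),
        integral_indicator_const _ hms]
      simp [mul_comm]
  rw [tendsto_iff_norm_sub_tendsto_zero] at h ⊢
  refine tendsto_order.2 ⟨fun b hb => Eventually.of_forall fun n => hb.trans_le (norm_nonneg _),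
    fun ζ hζ => ?_⟩
  set ε := ζ / (4 * (|t| + 1)) with hεd
  have hε : 0 < ε := by positivity
  have hε' : |t| * ε ≤ ζ / 4 := by
    rw [hεd, ← mul_div_assoc, div_le_div_iff₀ (by positivity) (by norm_num)]
    nlinarith [abs_nonneg t]
  filter_upwards [(hXS ε hε).eventually_lt_const (show 0 < ζ / 8 by positivity),
    h.eventually_lt_const (show 0 < ζ / 4 by positivity)] with n h1 h2
  have h3 := hle ε hε n
  have h4 := norm_sub_le_norm_sub_add_norm_sub (charFun ((P n).map (X n)) t)
    (charFun ((P n).map (S n)) t) a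
  linarith

/-- The central limit theorem with a negligible remainder. -/
lemma IsErrorArray.tendstoInDistribution {e : ∀ n, Fin n → Ω n → ℝ} {V : ℝ}
    (h : IsErrorArray P e V) (c : ∀ n, Fin n → ℝ) {L : ℝ}
    (hvar : ∀ᶠ n in atTop, ∑ i, c n i ^ 2 * ∫ ω, e n i ω ^ 2 ∂(P n) = 1)
    (hsum : ∀ᶠ n in atTop, ∑ i, c n i ^ 2 ≤ L)
    (hmax : ∀ κ > 0, ∀ᶠ n in atTop, ∀ i, |c n i| ≤ κ)
    {X : ∀ n, Ω n → ℝ} (hX : ∀ n, Measurable (X n))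
    (hrem : ∀ ε > 0, Tendsto (fun n => (P n).real {ω | ε ≤ |X n ω - ∑ i, c n i * e n i ω|}) atTop
      (𝓝 0)) : TendstoInDistribution X atTop (id : ℝ → ℝ) P (gaussianReal 0 1) where
  forall_aemeasurable n := (hX n).aemeasurable
  tendsto := by
    refine ProbabilityMeasure.tendsto_iff_tendsto_charFun.2 fun t => ?_
    have h1 := tendsto_charFun_of_tendsto_measureReal hX
      (fun n => Finset.measurable_sum _ fun i _ => (h.measurable n i).const_mul _) hrem
      (h.tendsto_charFun c hvar hsum hmax t)
    have h2 : charFun ((gaussianReal 0 1).map id) t = Complex.exp (-(t ^ 2 / 2 : ℝ)) := by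
      rw [Measure.map_id, charFun_gaussianReal]
      congr 1
      push_cast
      ring
    simp only [ProbabilityMeasure.coe_mk]
    rw [h2]
    exact h1

end CentralLimit

/-! ### Gram matrices and the square root of the Fisher information -/

section LinearAlgebra

variable {n p : ℕ}

lemma EuclideanSpace.dotProduct_eq_inner (x y : EuclideanSpace ℝ (Fin p)) :
    x.ofLp ⬝ᵥ y.ofLp = ⟪x, y⟫ := by
  rw [EuclideanSpace.inner_eq_star_dotProduct, star_trivial, dotProduct_comm]

/-- The bilinear form of a weighted Gram matrix. -/
lemma dotProduct_sum_vecMulVec_mulVec (k : Fin n → ℝ) (z : Fin n → EuclideanSpace ℝ (Fin p))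
    (x y : EuclideanSpace ℝ (Fin p)) :
    x.ofLp ⬝ᵥ (∑ i, k i • Matrix.vecMulVec (z i).ofLp (z i).ofLp).mulVec y.ofLp =
      ∑ i, k i * ⟪z i, x⟫ * ⟪z i, y⟫ := by
  rw [Matrix.sum_mulVec, dotProduct_sum]
  refine Finset.sum_congr rfl fun i _ => ?_
  rw [Matrix.smul_mulVec, Matrix.vecMulVec_mulVec, dotProduct_smul, op_smul_eq_smul,
    dotProduct_smul, EuclideanSpace.dotProduct_eq_inner, EuclideanSpace.dotProduct_eq_inner,
    real_inner_comm (z i) x]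
  simp only [smul_eq_mul]
  ring

lemma isHermitian_sum_vecMulVec (k : Fin n → ℝ) (z : Fin n → EuclideanSpace ℝ (Fin p)) :
    (∑ i, k i • Matrix.vecMulVec (z i).ofLp (z i).ofLp).IsHermitian := by
  unfold Matrix.IsHermitian
  rw [Matrix.conjTranspose_sum]
  refine Finset.sum_congr rfl fun i _ => ?_
  rw [Matrix.conjTranspose_smul, Matrix.conjTranspose_vecMulVec]
  simp

lemma Matrix.IsHermitian.posSemidef_sub_of_spectrum {A : Matrix (Fin p) (Fin p) ℝ}
    (hA : A.IsHermitian) {c : ℝ} (h : ∀ x ∈ spectrum ℝ A, c ≤ x) :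
    (A - algebraMap ℝ _ c).PosSemidef := by
  have hc : (algebraMap ℝ (Matrix (Fin p) (Fin p) ℝ) c).IsHermitian := by
    rw [Algebra.algebraMap_eq_smul_one]
    unfold Matrix.IsHermitian
    rw [Matrix.conjTranspose_smul, Matrix.conjTranspose_one, star_trivial]
  have hH := hA.sub hc
  rw [hH.posSemidef_iff_eigenvalues_nonneg]
  intro i
  have h1 := hH.eigenvalues_mem_spectrum_real i
  rw [← spectrum.sub_singleton_eq] at h1
  obtain ⟨x, hx, y, hy, hxy⟩ := Set.mem_sub.1 h1
  rw [Set.mem_singleton_iff] at hy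
  have := h x hx
  simp only [Pi.zero_apply]
  linarith

lemma Matrix.IsHermitian.posSemidef_sub_of_spectrum' {A : Matrix (Fin p) (Fin p) ℝ}
    (hA : A.IsHermitian) {c : ℝ} (h : ∀ x ∈ spectrum ℝ A, x ≤ c) :
    (algebraMap ℝ _ c - A).PosSemidef := by
  have h1 := hA.neg.posSemidef_sub_of_spectrum (c := -c) (fun x hx => by
    rw [← spectrum.neg_eq, Set.mem_neg] at hx
    linarith [h _ hx])
  rw [map_neg] at h1
  convert h1 using 1
  abel

/-- Bounds on the spectrum of the normalized Gram matrix as bounds on its quadratic form. -/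
lemma quadForm_bounds_of_spectrum (hn : 0 < n) (z : Fin n → EuclideanSpace ℝ (Fin p)) {c C : ℝ}
    (h : spectrum ℝ (normalizedGram z) ⊆ Set.Icc c C) (x : EuclideanSpace ℝ (Fin p)) :
    c * n * ‖x‖ ^ 2 ≤ ∑ i, ⟪z i, x⟫ ^ 2 ∧ ∑ i, ⟪z i, x⟫ ^ 2 ≤ C * n * ‖x‖ ^ 2 := by
  have hn' : (0 : ℝ) < n := by exact_mod_cast hn
  have hform : normalizedGram z =
      ∑ i, (n : ℝ)⁻¹ • Matrix.vecMulVec (z i).ofLp (z i).ofLp := by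
    rw [normalizedGram, Finset.smul_sum]
  have hH : (normalizedGram z).IsHermitian := by
    rw [hform]; exact isHermitian_sum_vecMulVec _ _
  have hq : x.ofLp ⬝ᵥ (normalizedGram z).mulVec x.ofLp = (n : ℝ)⁻¹ * ∑ i, ⟪z i, x⟫ ^ 2 := by
    rw [hform, dotProduct_sum_vecMulVec_mulVec, Finset.mul_sum]
    exact Finset.sum_congr rfl fun i _ => by ring
  have hs : ∀ k : ℝ, x.ofLp ⬝ᵥ (algebraMap ℝ (Matrix (Fin p) (Fin p) ℝ) k).mulVec x.ofLp =
      k * ‖x‖ ^ 2 := by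
    intro k
    rw [Algebra.algebraMap_eq_smul_one, Matrix.smul_mulVec, Matrix.one_mulVec, dotProduct_smul,
      EuclideanSpace.dotProduct_eq_inner, real_inner_self_eq_norm_sq, smul_eq_mul]
  have h1 := (hH.posSemidef_sub_of_spectrum fun y hy => (h hy).1).dotProduct_mulVec_nonneg x.ofLp
  have h2 := (hH.posSemidef_sub_of_spectrum' fun y hy => (h hy).2).dotProduct_mulVec_nonneg x.ofLp
  rw [star_trivial, Matrix.sub_mulVec, dotProduct_sub, hq, hs, sub_nonneg] at h1 h2
  rw [le_inv_mul_iff₀ hn'] at h1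
  rw [inv_mul_le_iff₀ hn'] at h2
  exact ⟨by linarith, by linarith⟩

/-- The square root of a positive definite Fisher matrix can be solved for. -/
lemma GLM.exists_sqrt_fisher (m : GLM) (z : Fin n → EuclideanSpace ℝ (Fin p))
    (β₀ : EuclideanSpace ℝ (Fin p)) {c : ℝ} (hc : 0 < c)
    (hpos : ∀ x : EuclideanSpace ℝ (Fin p), c * ‖x‖ ^ 2 ≤ ∑ i, m.w ⟪z i, β₀⟫ * ⟪z i, x⟫ ^ 2)
    (α : EuclideanSpace ℝ (Fin p)) : ∃ a : EuclideanSpace ℝ (Fin p),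
      (∀ d : EuclideanSpace ℝ (Fin p),
        α.ofLp ⬝ᵥ (CFC.sqrt (m.fisher z β₀)).mulVec d.ofLp =
          ∑ i, m.w ⟪z i, β₀⟫ * ⟪z i, a⟫ * ⟪z i, d⟫) ∧
      ∑ i, m.w ⟪z i, β₀⟫ * ⟪z i, a⟫ ^ 2 = ‖α‖ ^ 2 := by
  set F := m.fisher z β₀ with hF
  have hbil : ∀ x y : EuclideanSpace ℝ (Fin p), x.ofLp ⬝ᵥ F.mulVec y.ofLp =
      ∑ i, m.w ⟪z i, β₀⟫ * ⟪z i, x⟫ * ⟪z i, y⟫ := dotProduct_sum_vecMulVec_mulVec _ z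
  have hH : F.IsHermitian := isHermitian_sum_vecMulVec _ z
  have hPD : F.PosDef := by
    refine Matrix.PosDef.of_dotProduct_mulVec_pos hH fun x hx => ?_
    rw [star_trivial, show x = (WithLp.toLp 2 x : EuclideanSpace ℝ (Fin p)).ofLp from rfl, hbil]
    have h1 := hpos (WithLp.toLp 2 x)
    have h2 : 0 < ‖(WithLp.toLp 2 x : EuclideanSpace ℝ (Fin p))‖ := by
      rw [norm_pos_iff]
      intro h0
      exact hx (by simpa using congrArg WithLp.ofLp h0)
    have h3 : 0 < c * ‖(WithLp.toLp 2 x : EuclideanSpace ℝ (Fin p))‖ ^ 2 := by positivity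
    refine h3.trans_le (h1.trans_eq (Finset.sum_congr rfl fun i _ => by ring))
  have hnn : 0 ≤ F := hPD.posSemidef.nonneg
  set s := CFC.sqrt F with hs
  have hss : s * s = F := CFC.sqrt_mul_sqrt_self F hnn
  have hsT : s.transpose = s := by
    have h1 : s.IsHermitian := (Matrix.nonneg_iff_posSemidef.1 (CFC.sqrt_nonneg F)).isHermitian
    rw [← Matrix.conjTranspose_eq_transpose_of_trivial]
    exact h1
  have hsu : IsUnit s.det := by
    have h1 : IsUnit F.det := (Matrix.isUnit_iff_isUnit_det _).1 hPD.isUnit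
    rw [← hss, Matrix.det_mul] at h1
    exact isUnit_of_mul_isUnit_left h1
  -- With `a = F^(-1/2) α` one has `αᵀ F^(1/2) d = aᵀ F d`, and `aᵀ F a = ‖α‖²`, so the square root
  -- disappears from the later analysis.
  set a : EuclideanSpace ℝ (Fin p) := WithLp.toLp 2 (s⁻¹.mulVec α.ofLp) with ha
  have hsa : s.mulVec a.ofLp = α.ofLp := by
    rw [ha, Matrix.mulVec_mulVec, Matrix.mul_nonsing_inv _ hsu, Matrix.one_mulVec]
  have h1 : ∀ d : EuclideanSpace ℝ (Fin p), α.ofLp ⬝ᵥ s.mulVec d.ofLp =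
      ∑ i, m.w ⟪z i, β₀⟫ * ⟪z i, a⟫ * ⟪z i, d⟫ := by
    intro d
    rw [← hbil, ← hss, ← Matrix.mulVec_mulVec, Matrix.dotProduct_mulVec a.ofLp,
      ← Matrix.mulVec_transpose, hsT, hsa]
  refine ⟨a, h1, ?_⟩
  have h2 := h1 a
  rw [hsa, EuclideanSpace.dotProduct_eq_inner, real_inner_self_eq_norm_sq] at h2
  rw [h2]
  exact Finset.sum_congr rfl fun i _ => by ring

end LinearAlgebra

/-! ### Second moments, and the errors of the model -/

/-- The second moment of a weighted sum of vectors with independent centred weights. -/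
lemma integral_norm_sq_sum {E : Type*} [NormedAddCommGroup E] [InnerProductSpace ℝ E] {n : ℕ}
    {Ω : Type*} [MeasurableSpace Ω] (P : Measure Ω) [IsProbabilityMeasure P] {e : Fin n → Ω → ℝ}
    (hind : iIndepFun e P) (hL : ∀ i, MemLp (e i) 2 P) (h0 : ∀ i, ∫ ω, e i ω ∂P = 0)
    (k : Fin n → ℝ) (z : Fin n → E) :
    Integrable (fun ω => ‖∑ i, (k i * e i ω) • z i‖ ^ 2) P ∧
    ∫ ω, ‖∑ i, (k i * e i ω) • z i‖ ^ 2 ∂P =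
      ∑ i, k i ^ 2 * ‖z i‖ ^ 2 * ∫ ω, e i ω ^ 2 ∂P := by
  have hexp : ∀ ω, ‖∑ i, (k i * e i ω) • z i‖ ^ 2 =
      ∑ i, ∑ j, (k i * k j * ⟪z i, z j⟫) * (e i ω * e j ω) := by
    intro ω
    rw [← real_inner_self_eq_norm_sq, sum_inner]
    refine Finset.sum_congr rfl fun i _ => ?_
    rw [inner_sum]
    refine Finset.sum_congr rfl fun j _ => ?_
    rw [real_inner_smul_left, real_inner_smul_right]
    ring
  have hij : ∀ i j, Integrable (fun ω => e i ω * e j ω) P := fun i j =>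
    (hL i).integrable_mul (hL j)
  have hi : ∀ i j, Integrable (fun ω => (k i * k j * ⟪z i, z j⟫) * (e i ω * e j ω)) P :=
    fun i j => (hij i j).const_mul _
  simp_rw [hexp]
  refine ⟨integrable_finsetSum _ fun i _ => integrable_finsetSum _ fun j _ => hi i j, ?_⟩
  rw [integral_finsetSum _ fun i _ => integrable_finsetSum _ fun j _ => hi i j]
  refine Finset.sum_congr rfl fun i _ => ?_
  rw [integral_finsetSum _ fun j _ => hi i j, Finset.sum_eq_single i]
  · rw [integral_const_mul, real_inner_self_eq_norm_sq]
    simp only [← pow_two]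
  · intro j _ hji
    have h1 := (hind.indepFun hji.symm).integral_fun_mul_eq_mul_integral
      (hL i).aestronglyMeasurable (hL j).aestronglyMeasurable
    rw [integral_const_mul, h1, h0 i, zero_mul, mul_zero]
  · simp

/-- Markov's inequality in the form `P (T ≤ X) ≤ E X / T`. -/
lemma measureReal_ge_le_div {Ω : Type*} [MeasurableSpace Ω] (P : Measure Ω)
    [IsProbabilityMeasure P] {X : Ω → ℝ} (hX : Integrable X P) (h0 : ∀ ω, 0 ≤ X ω) {A T : ℝ}
    (hA : ∫ ω, X ω ∂P ≤ A) (hT : 0 < T) : P.real {ω | T ≤ X ω} ≤ A / T := by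
  rw [le_div_iff₀ hT, mul_comm]
  exact (mul_meas_ge_le_integral_of_nonneg (ae_of_all _ h0) hX T).trans hA

namespace GLM

variable {m : GLM}

/-- The errors of the responses of a generalized linear model form an error array. -/
lemma IsValid.isErrorArray (hm : m.IsValid) {p : ℕ → ℕ}
    {z : ∀ n, Fin n → EuclideanSpace ℝ (Fin (p n))} {β₀ : ∀ n, EuclideanSpace ℝ (Fin (p n))}
    {Ω : ℕ → Type*} [∀ n, MeasurableSpace (Ω n)] {P : ∀ n, Measure (Ω n)}
    [∀ n, IsProbabilityMeasure (P n)] {Y : ∀ n, Fin n → Ω n → ℝ}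
    (hY : ∀ n, m.IsSample (P n) (z n) (β₀ n) (Y n)) (hD : ∀ n i, ⟪z n i, β₀ n⟫ ∈ m.D)
    (hu : ContDiffOn ℝ 3 m.u m.D) {V M W : ℝ}
    (hV : ∀ n i, ∫ ω, (Y n i ω - m.h ⟪z n i, β₀ n⟫) ^ 2 ∂(P n) ≤ V) (hW : 0 < W) (hM : 0 < M)
    (hw : ∀ n i, W ≤ m.w ⟪z n i, β₀ n⟫) (hh : ∀ n i, |m.h ⟪z n i, β₀ n⟫| ≤ M)
    (hu' : ∀ n i, |deriv m.u ⟪z n i, β₀ n⟫| ≤ M) :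
    IsErrorArray P (fun n i ω => Y n i ω - m.h ⟪z n i, β₀ n⟫) V ∧
    ∀ n i, ∫ ω, (Y n i ω - m.h ⟪z n i, β₀ n⟫) ^ 2 ∂(P n) = m.v ⟪z n i, β₀ n⟫ := by
  have hφ := hm.φ_pos
  have hcs : ∀ n i, m.u ⟪z n i, β₀ n⟫ ∈ m.canonicalSpace := fun n i => hm.u_mem (hD n i)
  have hmap : ∀ n i (f : ℝ → ℝ), Measurable f →
      ∫ ω, f (Y n i ω) ∂(P n) = ∫ y, f y ∂(m.law (m.u ⟪z n i, β₀ n⟫)) := by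
    intro n i f hf
    rw [← (hY n).law_eq i, integral_map ((hY n).measurable i).aemeasurable
      hf.aestronglyMeasurable]
  have hmemY : ∀ n i, MemLp (Y n i) 2 (P n) := by
    intro n i
    have h1 := hm.memLp_id_law (hcs n i)
    rw [← (hY n).law_eq i] at h1
    exact (memLp_map_measure_iff (by fun_prop) ((hY n).measurable i).aemeasurable).1 h1
  have hvar : ∀ n i, ∫ ω, (Y n i ω - m.h ⟪z n i, β₀ n⟫) ^ 2 ∂(P n) = m.v ⟪z n i, β₀ n⟫ := by
    intro n i
    have := isProbabilityMeasure_law (hcs n i)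
    rw [hmap n i (fun y => (y - m.h ⟪z n i, β₀ n⟫) ^ 2) (by fun_prop), v,
      ← hm.variance_id_law (hcs n i), variance_eq_integral (by fun_prop)]
    simp only [id, hm.integral_id_law (hcs n i), hm.mean_u (hD n i)]
  refine ⟨⟨fun n i => ((hY n).measurable i).sub_const _, fun n => ?_, fun n i =>
    (hmemY n i).sub (memLp_const _), fun n i => ?_, hV, fun ε hε => ?_⟩, hvar⟩
  · exact (hY n).indep.comp (fun i y => y - m.h ⟪z n i, β₀ n⟫) fun i => by fun_prop
  · rw [integral_sub ((hmemY n i).integrable (by norm_num)) (integrable_const _),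
      hmap n i (fun y => y) measurable_id, hm.integral_id_law (hcs n i), hm.mean_u (hD n i)]
    simp
  -- Applied to the set of all true canonical parameters in the array. The lower bound on the
  -- variance comes from `W ≤ (u' / φ)² v` and `|u'| ≤ M`.
  · obtain ⟨K, hK, htail⟩ := hm.exists_tail_bound
      (A := {θ | ∃ n i, θ = m.u ⟪z n i, β₀ n⟫}) (M := M) (c := W * m.φ ^ 2 / M ^ 2) (V := V)
      (by rintro _ ⟨n, i, rfl⟩; exact hcs n i) (by positivity)
      (by rintro _ ⟨n, i, rfl⟩; rw [hm.mean_u (hD n i)]; exact hh n i)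
      (by
        rintro _ ⟨n, i, rfl⟩
        have h1 := hw n i
        rw [hm.w_eq_v hu (hD n i), div_pow] at h1
        have h2 : deriv m.u ⟪z n i, β₀ n⟫ ^ 2 ≤ M ^ 2 := by
          rw [← sq_abs]
          gcongr
          exact hu' n i
        have hv := hm.v_pos _ (hD n i)
        rw [div_le_iff₀ (by positivity)]
        rw [div_mul_eq_mul_div, le_div_iff₀ (by positivity)] at h1
        change _ ≤ m.v ⟪z n i, β₀ n⟫ * _
        nlinarith)
      (by rintro _ ⟨n, i, rfl⟩; exact (hvar n i).ge.trans (hV n i)) hε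
    refine ⟨K, hK, fun n i => ?_⟩
    have h1 := htail _ ⟨n, i, rfl⟩
    rw [hm.mean_u (hD n i)] at h1
    rw [← hmap n i _ (Measurable.indicator (by fun_prop)
      (measurableSet_lt measurable_const (by fun_prop)))] at h1
    exact h1

end GLM

/-! ### Good responses have probability tending to one -/

namespace GLM

lemma score_eq_sum (m : GLM) {n p : ℕ} (z : Fin n → EuclideanSpace ℝ (Fin p)) (y : Fin n → ℝ)
    (β : EuclideanSpace ℝ (Fin p)) : m.score z y β =
      ∑ i, ((m.φ⁻¹ * deriv m.u ⟪z i, β⟫) * (y i - m.h ⟪z i, β⟫)) • z i := by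
  rw [score, Finset.smul_sum]
  refine Finset.sum_congr rfl fun i _ => ?_
  rw [smul_smul, mul_assoc]

/-- Quantitative regularity of a triangular array of designs with responses, on the balls of radius
`ρ n` around the true parameters. -/
structure IsRegular (m : GLM) {p : ℕ → ℕ} (z : ∀ n, Fin n → EuclideanSpace ℝ (Fin (p n)))
    (β₀ : ∀ n, EuclideanSpace ℝ (Fin (p n))) {Ω : ℕ → Type*} [∀ n, MeasurableSpace (Ω n)]
    (P : ∀ n, Measure (Ω n)) (Y : ∀ n, Fin n → Ω n → ℝ) (ρ : ℕ → ℝ) (c C W M V : ℝ) : Prop where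
  valid : m.IsValid
  u_smooth : ContDiffOn ℝ 3 m.u m.D
  w_smooth : ContDiffOn ℝ 1 m.w m.D
  errors : IsErrorArray P (fun n i ω => Y n i ω - m.h ⟪z n i, β₀ n⟫) V
  variance_eq : ∀ n i, ∫ ω, (Y n i ω - m.h ⟪z n i, β₀ n⟫) ^ 2 ∂(P n) = m.v ⟪z n i, β₀ n⟫
  c_pos : 0 < c
  C_nonneg : 0 ≤ C
  W_pos : 0 < W
  M_pos : 0 < M
  V_nonneg : 0 ≤ V
  ρ_pos : ∀ n, 0 < ρ n
  bounded : ∀ n i, m.BoundedOn ((fun β => ⟪z n i, β⟫) '' Metric.closedBall (β₀ n) (ρ n)) M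
  lower : ∀ᶠ n in atTop, ∀ x, c * n * ‖x‖ ^ 2 ≤ ∑ i, ⟪z n i, x⟫ ^ 2
  upper : ∀ᶠ n in atTop, ∀ x, ∑ i, ⟪z n i, x⟫ ^ 2 ≤ C * n * ‖x‖ ^ 2
  fourth : ∀ᶠ n in atTop, ∀ x, ∑ i, ⟪z n i, x⟫ ^ 4 ≤ C * n * ‖x‖ ^ 4
  norm_sq_le : ∀ᶠ n in atTop, ∀ i, ‖z n i‖ ^ 2 ≤ C * p n
  w_ge : ∀ n i, W ≤ m.w ⟪z n i, β₀ n⟫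
  dim : (fun n => (p n : ℝ)) =o[atTop] fun n => (n : ℝ)
  ρ_tendsto : Tendsto ρ atTop (𝓝 0)
  ρ_large : (fun n => √((p n : ℝ) / n)) =o[atTop] ρ

variable {m : GLM} {p : ℕ → ℕ} {z : ∀ n, Fin n → EuclideanSpace ℝ (Fin (p n))}
  {β₀ : ∀ n, EuclideanSpace ℝ (Fin (p n))} {Ω : ℕ → Type*} [∀ n, MeasurableSpace (Ω n)]
  {P : ∀ n, Measure (Ω n)} {Y : ∀ n, Fin n → Ω n → ℝ}
  {ρ : ℕ → ℝ} {c C W M V : ℝ}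

lemma IsRegular.center_mem (h : m.IsRegular z β₀ P Y ρ c C W M V) (n : ℕ) :
    β₀ n ∈ Metric.closedBall (β₀ n) (ρ n) := by simpa using (h.ρ_pos n).le

lemma IsRegular.measurable_response (h : m.IsRegular z β₀ P Y ρ c C W M V) (n : ℕ) :
    Measurable fun ω i => Y n i ω :=
  measurable_pi_lambda _ fun i => by
    simpa using (h.errors.measurable n i).add_const (m.h ⟪z n i, β₀ n⟫)

lemma IsRegular.abs_inv_mul_le (h : m.IsRegular z β₀ P Y ρ c C W M V) {x : ℝ} (hx : |x| ≤ M) :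
    |m.φ⁻¹ * x| ≤ m.φ⁻¹ * M := by
  have := h.valid.φ_pos
  rw [abs_mul, abs_of_pos (by positivity)]
  gcongr

variable [∀ n, IsProbabilityMeasure (P n)]

/-- Second moments of weighted sums of the design vectors with the errors as weights. -/
lemma IsRegular.integral_norm_sq_le (h : m.IsRegular z β₀ P Y ρ c C W M V) (n : ℕ)
    (k : Fin n → ℝ) {A : ℝ} (hA : ∑ i, k i ^ 2 * ‖z n i‖ ^ 2 ≤ A) :
    Integrable (fun ω => ‖∑ i, (k i * (Y n i ω - m.h ⟪z n i, β₀ n⟫)) • z n i‖ ^ 2) (P n) ∧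
    ∫ ω, ‖∑ i, (k i * (Y n i ω - m.h ⟪z n i, β₀ n⟫)) • z n i‖ ^ 2 ∂(P n) ≤ A * V := by
  have h1 := integral_norm_sq_sum (P n) (h.errors.indep n) (h.errors.memLp n)
    (h.errors.integral_eq_zero n) k (z n)
  refine ⟨h1.1, h1.2.le.trans ?_⟩
  calc _ ≤ ∑ i, k i ^ 2 * ‖z n i‖ ^ 2 * V := by
        refine Finset.sum_le_sum fun i _ => ?_
        gcongr
        exact h.errors.integral_sq_le n i
    _ = (∑ i, k i ^ 2 * ‖z n i‖ ^ 2) * V := by rw [Finset.sum_mul]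
    _ ≤ _ := by
        have := h.V_nonneg
        gcongr

/-- At the true parameter the score is a sum of `n` independent centred vectors, each with second
moment `O(p)` since `‖z n i‖ ^ 2 ≤ C * p n`. -/
lemma IsRegular.integral_score_sq_le (h : m.IsRegular z β₀ P Y ρ c C W M V) :
    ∀ᶠ n in atTop, Integrable (fun ω => ‖m.score (z n) (fun i => Y n i ω) (β₀ n)‖ ^ 2) (P n) ∧
    ∫ ω, ‖m.score (z n) (fun i => Y n i ω) (β₀ n)‖ ^ 2 ∂(P n) ≤
      (m.φ⁻¹ * M) ^ 2 * C * V * (n * p n) := by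
  filter_upwards [h.norm_sq_le] with n hn
  have h1 := h.integral_norm_sq_le n (fun i => m.φ⁻¹ * deriv m.u ⟪z n i, β₀ n⟫)
    (A := n * ((m.φ⁻¹ * M) ^ 2 * (C * p n))) (by
      calc _ ≤ ∑ _i : Fin n, (m.φ⁻¹ * M) ^ 2 * (C * p n) := by
            refine Finset.sum_le_sum fun i _ => ?_
            have h2 := h.abs_inv_mul_le
              ((h.bounded n i).u' _ (inner_mem_image (h.center_mem n) i))
            have h3 := hn i
            rw [← sq_abs (m.φ⁻¹ * deriv m.u _)]
            gcongr
        _ = _ := by simp)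
  simp_rw [score_eq_sum]
  refine ⟨h1.1, h1.2.trans_eq ?_⟩
  ring

lemma tendsto_nhdsGT_zero_of_continuous {f : ℝ → ℝ} (hf : Continuous f) (h0 : f 0 = 0) :
    Tendsto f (𝓝[>] 0) (𝓝 0) := by
  have := (hf.tendsto 0).mono_left (nhdsWithin_le_nhds (s := Set.Ioi 0))
  rwa [h0] at this

/-- Good responses have probability tending to one. -/
lemma IsRegular.eventually_isGood (h : m.IsRegular z β₀ P Y ρ c C W M V) {κ : ℝ} (hκ : 0 < κ) :
    ∀ᶠ n in atTop, (P n).real {ω | ¬ m.IsGood (z n) (β₀ n) (ρ n) (W * c / 2 * n)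
      (fun i => Y n i ω)} ≤ κ := by
  have hφ := h.valid.φ_pos
  have hc := h.c_pos
  have hC := h.C_nonneg
  have hW := h.W_pos
  have hM := h.M_pos
  have hV := h.V_nonneg
  -- The information has slope at least `2 d n`. The random form, the displacement and the error
  -- tails each cost at most `d n / 4`, so slope `d n` remains.
  set d := W * c / 2 with hd
  have hd0 : 0 < d := by positivity
  obtain ⟨σ, hσ1, hσ⟩ := (((tendsto_nhdsGT_zero_of_continuous
    (f := fun σ => 2 * (m.φ⁻¹ * M) * √(C * σ)) (by fun_prop) (by simp)).eventually_le_const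
    (show 0 < d / 4 by positivity)).and self_mem_nhdsWithin).exists
  have hσ : 0 < σ := hσ
  obtain ⟨K, hK, htail⟩ := h.errors.tail (σ * (κ / 3)) (by positivity)
  set L := m.φ⁻¹ * M * K + (m.φ⁻¹ * M ^ 2 + M) with hL
  have hρ : ∀ᶠ n in atTop, L * (2 * C * ρ n) ≤ d / 4 := by
    have : Tendsto (fun n => L * (2 * C * ρ n)) atTop (𝓝 (L * (2 * C * 0))) :=
      (h.ρ_tendsto.const_mul _).const_mul _
    simp only [mul_zero] at this
    exact this.eventually_le_const (by positivity)
  have hE1 := h.errors.eventually_quadForm z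
    (fun n i => m.φ⁻¹ * iteratedDeriv 2 m.u ⟪z n i, β₀ n⟫) (M := m.φ⁻¹ * M) (by positivity) hC
    (fun n i => h.abs_inv_mul_le ((h.bounded n i).u'' _ (inner_mem_image (h.center_mem n) i)))
    h.upper h.fourth h.dim (η := d / 4) (by positivity) (show 0 < κ / 3 by positivity)
  set A := (m.φ⁻¹ * M) ^ 2 * C * V with hA
  have hA0 : 0 ≤ A := by positivity
  -- If `√(p / n) ≤ δ ρ`, the second moment bound makes the score at the centre reach `d n ρ` with
  -- probability at most `A δ² / d²`.
  obtain ⟨δ, hδ1, hδ⟩ := (((tendsto_nhdsGT_zero_of_continuous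
    (f := fun δ => A / d ^ 2 * δ ^ 2) (by fun_prop) (by simp)).eventually_le_const
    (show 0 < κ / 3 by positivity)).and self_mem_nhdsWithin).exists
  filter_upwards [hρ, hE1, h.ρ_large.bound hδ, h.integral_score_sq_le, h.lower, h.upper, h.fourth,
    eventually_gt_atTop 0] with n h1 h2 h3 h4 h5 h6 h7 hn
  have hn' : (0 : ℝ) < n := by exact_mod_cast hn
  have hρn := h.ρ_pos n
  have hE2 := measureReal_tail_le (P n) (h.errors.measurable n) (h.errors.memLp n)
    (show 0 ≤ σ * (κ / 3) by positivity) hσ (htail n)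
  rw [mul_div_cancel_left₀ _ hσ.ne'] at hE2
  have hE3 : (P n).real {ω | (d * n * ρ n) ^ 2 ≤
      ‖m.score (z n) (fun i => Y n i ω) (β₀ n)‖ ^ 2} ≤ κ / 3 := by
    rw [Real.norm_of_nonneg (Real.sqrt_nonneg _), Real.norm_of_nonneg hρn.le] at h3
    have hδ0 : 0 < δ := hδ
    have h8 : (p n : ℝ) / n ≤ (δ * ρ n) ^ 2 := (Real.sqrt_le_left (by positivity)).1 h3
    rw [div_le_iff₀ hn'] at h8
    calc _ ≤ A * (n * p n) / (d * n * ρ n) ^ 2 :=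
          measureReal_ge_le_div (P n) h4.1 (fun ω => sq_nonneg _) h4.2 (by positivity)
      _ ≤ A * (n * ((δ * ρ n) ^ 2 * n)) / (d * n * ρ n) ^ 2 := by gcongr
      _ = A / d ^ 2 * δ ^ 2 := by field_simp
      _ ≤ κ / 3 := hδ1
  set E₁ : Set (Ω n) := {ω | ¬ ∀ x, |∑ i, m.φ⁻¹ * iteratedDeriv 2 m.u ⟪z n i, β₀ n⟫ *
    (Y n i ω - m.h ⟪z n i, β₀ n⟫) * ⟪z n i, x⟫ ^ 2| ≤ d / 4 * n * ‖x‖ ^ 2} with hE₁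
  set E₂ : Set (Ω n) := {ω | ¬ ∑ i, ({ω | K < |Y n i ω - m.h ⟪z n i, β₀ n⟫|}.indicator
    (fun ω => Y n i ω - m.h ⟪z n i, β₀ n⟫) ω) ^ 2 ≤ σ * n} with hE₂
  set E₃ : Set (Ω n) := {ω | (d * n * ρ n) ^ 2 ≤
    ‖m.score (z n) (fun i => Y n i ω) (β₀ n)‖ ^ 2} with hE₃
  have hsub : {ω | ¬ m.IsGood (z n) (β₀ n) (ρ n) (d * n) (fun i => Y n i ω)} ⊆
      (E₁ ∪ E₂) ∪ E₃ := by
    intro ω hω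
    by_contra hnot
    simp only [hE₁, hE₂, hE₃, Set.mem_union, Set.mem_ofPred_eq, not_or, not_not, not_le] at hnot
    obtain ⟨⟨g1, g2⟩, g3⟩ := hnot
    refine hω ⟨fun β₁ hβ₁ β₂ hβ₂ => ?_, lt_of_pow_lt_pow_left₀ 2 (by positivity) g3⟩
    refine (h.valid.score_strongly_monotone h.u_smooth h.w_smooth (z n) (β₀ n) hρn.le hM.le
      (h.bounded n) hC hW.le h5 h6 h7 (h.w_ge n) (K := K) (by linarith) hσ.le g1 ?_
      hβ₁ hβ₂).trans ?_
    · simpa only [Set.indicator_apply, Set.mem_ofPred_eq, not_lt] using g2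
    · refine neg_le_neg ?_
      gcongr
      linarith
  refine (measureReal_mono hsub (measure_ne_top _ _)).trans ?_
  have e1 := measureReal_union_le (μ := P n) (E₁ ∪ E₂) E₃
  have e2 := measureReal_union_le (μ := P n) E₁ E₂
  linarith

end GLM

/-! ### The estimator: roots with high probability, and consistency -/

namespace GLM

variable {m : GLM} {p : ℕ → ℕ} {z : ∀ n, Fin n → EuclideanSpace ℝ (Fin (p n))}
  {β₀ : ∀ n, EuclideanSpace ℝ (Fin (p n))} {Ω : ℕ → Type*} [∀ n, MeasurableSpace (Ω n)]
  {P : ∀ n, Measure (Ω n)} {Y : ∀ n, Fin n → Ω n → ℝ}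
  {ρ : ℕ → ℝ} {c C W M V : ℝ}

/-- Measurable functions of the responses that are roots of the score whenever the responses are
good. -/
lemma IsRegular.exists_estimator (h : m.IsRegular z β₀ P Y ρ c C W M V) :
    ∃ βhat : ∀ n, (Fin n → ℝ) → EuclideanSpace ℝ (Fin (p n)), (∀ n, Measurable (βhat n)) ∧
      ∀ n, 0 < n → ∀ y, m.IsGood (z n) (β₀ n) (ρ n) (W * c / 2 * n) y →
        βhat n y ∈ Metric.closedBall (β₀ n) (ρ n) ∧ m.score (z n) y (βhat n y) = 0 ∧
        W * c / 2 * n * ‖βhat n y - β₀ n‖ ≤ ‖m.score (z n) y (β₀ n)‖ := by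
  have hc := h.c_pos
  have hW := h.W_pos
  have hex : ∀ n, ∃ b : (Fin n → ℝ) → EuclideanSpace ℝ (Fin (p n)), Measurable b ∧
      (0 < n → ∀ y, m.IsGood (z n) (β₀ n) (ρ n) (W * c / 2 * n) y →
        b y ∈ Metric.closedBall (β₀ n) (ρ n) ∧ m.score (z n) y (b y) = 0 ∧
        W * c / 2 * n * ‖b y - β₀ n‖ ≤ ‖m.score (z n) y (β₀ n)‖) := by
    intro n
    rcases Nat.eq_zero_or_pos n with hn | hn
    -- For `n = 0` the monotonicity constant is zero and the root argument is not available; any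
    -- value will do.
    · exact ⟨fun _ => β₀ n, measurable_const, fun h0 => absurd h0 (by omega)⟩
    · have hn' : (0 : ℝ) < n := by exact_mod_cast hn
      obtain ⟨b, hb1, hb2⟩ := h.valid.exists_measurable_root h.u_smooth (z n) (β₀ n) (h.ρ_pos n)
        (show 0 < W * c / 2 * n by positivity)
        (fun β hβ i => (h.bounded n i).subset (inner_mem_image hβ i))
      exact ⟨b, hb1, fun _ => hb2⟩
  choose b hb1 hb2 using hex
  exact ⟨b, hb1, hb2⟩

lemma IsRegular.measurableSet_good (h : m.IsRegular z β₀ P Y ρ c C W M V) (n : ℕ) (d : ℝ) :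
    MeasurableSet {ω | m.IsGood (z n) (β₀ n) (ρ n) d (fun i => Y n i ω)} :=
  h.measurable_response n (measurableSet_isGood (z n) (β₀ n) (ρ n) d)

variable [∀ n, IsProbabilityMeasure (P n)]

lemma IsRegular.tendsto_good (h : m.IsRegular z β₀ P Y ρ c C W M V) :
    Tendsto (fun n => P n {ω | ¬ m.IsGood (z n) (β₀ n) (ρ n) (W * c / 2 * n)
      (fun i => Y n i ω)}) atTop (𝓝 0) := by
  rw [← ENNReal.tendsto_toReal_iff (fun n => measure_ne_top _ _) ENNReal.zero_ne_top,
    ENNReal.toReal_zero]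
  refine tendsto_order.2 ⟨fun a ha => Eventually.of_forall fun n =>
    ha.trans_le measureReal_nonneg, fun a ha => ?_⟩
  filter_upwards [h.eventually_isGood (half_pos ha)] with n hn
  exact hn.trans_lt (half_lt_self ha)

/-- The estimators are roots of the score with probability tending to one. -/
lemma IsRegular.tendsto_root (h : m.IsRegular z β₀ P Y ρ c C W M V)
    {βhat : ∀ n, (Fin n → ℝ) → EuclideanSpace ℝ (Fin (p n))}
    (hroot : ∀ n, 0 < n → ∀ y, m.IsGood (z n) (β₀ n) (ρ n) (W * c / 2 * n) y →
      m.score (z n) y (βhat n y) = 0) :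
    Tendsto (fun n => P n {ω | m.score (z n) (fun i => Y n i ω)
      (βhat n fun i => Y n i ω) = 0}) atTop (𝓝 1) := by
  have h1 : Tendsto (fun n => 1 - P n {ω | ¬ m.IsGood (z n) (β₀ n) (ρ n) (W * c / 2 * n)
      (fun i => Y n i ω)}) atTop (𝓝 1) := by
    simpa using ENNReal.Tendsto.sub tendsto_const_nhds h.tendsto_good (Or.inl ENNReal.one_ne_top)
  refine tendsto_of_tendsto_of_tendsto_of_le_of_le' h1 tendsto_const_nhds ?_
    (Eventually.of_forall fun n => prob_le_one)
  filter_upwards [eventually_gt_atTop 0] with n hn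
  -- The complement rule is applied to the good event; the root event only has to contain it, so its
  -- own measurability plays no role.
  have h3 := prob_compl_eq_one_sub (μ := P n) (h.measurableSet_good n (W * c / 2 * n)).compl
  rw [compl_compl] at h3
  refine h3.symm.le.trans (measure_mono fun ω hω => hroot n hn _ hω)

/-- The estimators are consistent. -/
lemma IsRegular.tendsto_dist (h : m.IsRegular z β₀ P Y ρ c C W M V)
    {βhat : ∀ n, (Fin n → ℝ) → EuclideanSpace ℝ (Fin (p n))}
    (hball : ∀ n, 0 < n → ∀ y, m.IsGood (z n) (β₀ n) (ρ n) (W * c / 2 * n) y →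
      βhat n y ∈ Metric.closedBall (β₀ n) (ρ n)) {ε : ℝ} (hε : 0 < ε) :
    Tendsto (fun n => P n {ω | ε ≤ ‖βhat n (fun i => Y n i ω) - β₀ n‖}) atTop (𝓝 0) := by
  refine tendsto_of_tendsto_of_tendsto_of_le_of_le' tendsto_const_nhds h.tendsto_good
    (Eventually.of_forall fun n => zero_le) ?_
  filter_upwards [eventually_gt_atTop 0, h.ρ_tendsto.eventually_lt_const hε] with n hn hρ
  refine measure_mono fun ω hω hgood => ?_
  have h3 := mem_closedBall_iff_norm.1 (hball n hn _ hgood)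
  have h4 : ε ≤ ‖βhat n (fun i => Y n i ω) - β₀ n‖ := hω
  linarith

end GLM

/-! ### Asymptotic linearity and normality -/

namespace GLM

/-- `a` represents the studentized direction `α`, that is `a = F ^ (-1/2) α`. -/
structure IsDirection (m : GLM) {n p : ℕ} (z : Fin n → EuclideanSpace ℝ (Fin p))
    (β₀ α a : EuclideanSpace ℝ (Fin p)) (k B : ℝ) : Prop where
  dotProduct_eq : ∀ x : EuclideanSpace ℝ (Fin p),
    α.ofLp ⬝ᵥ (CFC.sqrt (m.fisher z β₀)).mulVec x.ofLp =
      ∑ i, m.w ⟪z i, β₀⟫ * ⟪z i, a⟫ * ⟪z i, x⟫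
  sum_w_eq : ∑ i, m.w ⟪z i, β₀⟫ * ⟪z i, a⟫ ^ 2 = 1
  norm_sq_le : k * n * ‖a‖ ^ 2 ≤ 1
  sum_sq_le : ∑ i, ⟪z i, a⟫ ^ 2 ≤ B

variable {m : GLM} {p : ℕ → ℕ} {z : ∀ n, Fin n → EuclideanSpace ℝ (Fin (p n))}
  {β₀ : ∀ n, EuclideanSpace ℝ (Fin (p n))} {Ω : ℕ → Type*} [∀ n, MeasurableSpace (Ω n)]
  {P : ∀ n, Measure (Ω n)} {Y : ∀ n, Fin n → Ω n → ℝ}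
  {ρ : ℕ → ℝ} {c C W M V : ℝ}

lemma IsRegular.exists_isDirection (h : m.IsRegular z β₀ P Y ρ c C W M V)
    (α : ∀ n, EuclideanSpace ℝ (Fin (p n))) (hα : ∀ᶠ n in atTop, ‖α n‖ = 1) :
    ∃ a : ∀ n, EuclideanSpace ℝ (Fin (p n)), ∀ᶠ n in atTop,
      m.IsDirection (z n) (β₀ n) (α n) (a n) (W * c) (C / (W * c)) := by
  have hc := h.c_pos
  have hC := h.C_nonneg
  have hW := h.W_pos
  have hexa : ∀ᶠ n in atTop, ∃ a : EuclideanSpace ℝ (Fin (p n)),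
      m.IsDirection (z n) (β₀ n) (α n) a (W * c) (C / (W * c)) := by
    filter_upwards [hα, h.lower, h.upper, eventually_gt_atTop 0] with n hn1 hn2 hn4 hn3
    have hn' : (0 : ℝ) < n := by exact_mod_cast hn3
    have hlow : ∀ x : EuclideanSpace ℝ (Fin (p n)),
        W * c * n * ‖x‖ ^ 2 ≤ ∑ i, m.w ⟪z n i, β₀ n⟫ * ⟪z n i, x⟫ ^ 2 := by
      intro x
      calc _ = W * (c * n * ‖x‖ ^ 2) := by ring
        _ ≤ W * ∑ i, ⟪z n i, x⟫ ^ 2 := by gcongr; exact hn2 x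
        _ = ∑ i, W * ⟪z n i, x⟫ ^ 2 := Finset.mul_sum _ _ _
        _ ≤ _ := Finset.sum_le_sum fun i _ => by gcongr; exact h.w_ge n i
    obtain ⟨a, ha1, ha2⟩ := m.exists_sqrt_fisher (z n) (β₀ n)
      (show 0 < W * c * n by positivity) hlow (α n)
    rw [hn1, one_pow] at ha2
    have ha3 := (hlow a).trans ha2.le
    refine ⟨a, ha1, ha2, ha3, (hn4 a).trans ?_⟩
    rw [le_div_iff₀ (by positivity)]
    calc _ = C * (W * c * n * ‖a‖ ^ 2) := by ring
      _ ≤ C * 1 := by gcongr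
      _ = C := mul_one C
  -- A direction exists only for large `n`; `Classical.epsilon` takes an arbitrary value otherwise.
  exact ⟨fun n => Classical.epsilon _, hexa.mono fun n hn => Classical.epsilon_spec hn⟩

lemma IsRegular.sq_inv_mul_le (h : m.IsRegular z β₀ P Y ρ c C W M V) {x : ℝ} (hx : |x| ≤ M) :
    (m.φ⁻¹ * x) ^ 2 ≤ (m.φ⁻¹ * M) ^ 2 := by
  rw [← sq_abs]
  exact pow_le_pow_left₀ (abs_nonneg _) (h.abs_inv_mul_le hx) 2

/-- The weights of the leading term of the estimators are uniformly small. -/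
lemma IsRegular.eventually_abs_weight_le (h : m.IsRegular z β₀ P Y ρ c C W M V)
    {α a : ∀ n, EuclideanSpace ℝ (Fin (p n))}
    (ha : ∀ᶠ n in atTop, m.IsDirection (z n) (β₀ n) (α n) (a n) (W * c) (C / (W * c)))
    {κ : ℝ} (hκ : 0 < κ) :
    ∀ᶠ n in atTop, ∀ i, |m.φ⁻¹ * deriv m.u ⟪z n i, β₀ n⟫ * ⟪z n i, a n⟫| ≤ κ := by
  have hφ := h.valid.φ_pos
  have hc := h.c_pos
  have hC := h.C_nonneg
  have hW := h.W_pos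
  have hM := h.M_pos
  -- The squared weights are `O(‖z‖² ‖a‖²) = O(p / n)`, and `δ` is the bound on `p / n` that brings
  -- them below `κ²`. The `+ 1` keeps the denominator positive when `C = 0`.
  obtain ⟨δ, hδd, hδ0⟩ : ∃ δ : ℝ, δ = κ ^ 2 / ((m.φ⁻¹ * M) ^ 2 * (C / (W * c) + 1)) ∧ 0 < δ :=
    ⟨_, rfl, by positivity⟩
  filter_upwards [ha, h.norm_sq_le, h.dim.bound hδ0, eventually_gt_atTop 0] with n h1 h2 h3 h4 i
  have hn' : (0 : ℝ) < n := by exact_mod_cast h4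
  rw [Real.norm_natCast, Real.norm_natCast] at h3
  refine abs_le_of_sq_le_sq ?_ hκ.le
  have h5 : ⟪z n i, a n⟫ ^ 2 ≤ ‖z n i‖ ^ 2 * ‖a n‖ ^ 2 := by
    rw [← mul_pow, ← sq_abs]
    exact pow_le_pow_left₀ (abs_nonneg _) (abs_real_inner_le_norm _ _) 2
  have h6 : ‖a n‖ ^ 2 ≤ 1 / (W * c * n) := by
    rw [le_div_iff₀ (by positivity), mul_comm]
    exact h1.norm_sq_le
  have h7 : ‖z n i‖ ^ 2 ≤ C * (δ * n) := (h2 i).trans (mul_le_mul_of_nonneg_left h3 hC)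
  calc _ = (m.φ⁻¹ * deriv m.u ⟪z n i, β₀ n⟫) ^ 2 * ⟪z n i, a n⟫ ^ 2 := mul_pow _ _ _
    _ ≤ (m.φ⁻¹ * M) ^ 2 * ((C * (δ * n)) * (1 / (W * c * n))) :=
        mul_le_mul (h.sq_inv_mul_le ((h.bounded n i).u' _ (inner_mem_image (h.center_mem n) i)))
          (h5.trans (mul_le_mul h7 h6 (sq_nonneg _) (by positivity))) (sq_nonneg _) (by positivity)
    _ = (m.φ⁻¹ * M) ^ 2 * (C / (W * c)) * δ := by field_simp
    _ ≤ (m.φ⁻¹ * M) ^ 2 * (C / (W * c) + 1) * δ := by gcongr; linarith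
    _ = κ ^ 2 := by rw [hδd]; field_simp

/-- Elementary bound for the remainder in the expansion of the score. -/
lemma remainder_le {n p T d C N x R Q D : ℝ} (hn : 0 < n) (hp : 0 < p) (hT : 0 < T) (hd : 0 < d)
    (hC : 0 ≤ C) (hN : 0 ≤ N) (hD0 : 0 ≤ D) (hR : R ^ 2 ≤ T * p) (hQ : Q ≤ T)
    (hD : d * n * D ≤ x) (hx : x ^ 2 ≤ T * (n * p)) :
    R * D + N * (√Q * (√(C * n) * D ^ 2)) ≤
      (T / d + N * (√T * √C * T) / d ^ 2) * (p / √n) := by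
  have hsn0 : 0 < √n := Real.sqrt_pos.2 hn
  obtain ⟨s, hs0, rfl⟩ : ∃ s : ℝ, 0 < s ∧ n = s ^ 2 := ⟨√n, hsn0, (Real.sq_sqrt hn.le).symm⟩
  -- The rate `√(p / n)` of the estimator. Both remainder terms are then of order `p / √n`: `√p`
  -- times this rate, and `√n` times its square.
  have hDle : D ≤ √(T * p) / (d * s) := by
    rw [le_div_iff₀ (by positivity)]
    have : d * s ^ 2 * D ≤ s * √(T * p) := by
      refine hD.trans (abs_le_of_sq_le_sq' ?_ (by positivity)).2
      rw [mul_pow, Real.sq_sqrt (by positivity)]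
      linarith
    refine le_of_mul_le_mul_left ?_ hs0
    linarith
  have hRle : R ≤ √(T * p) := Real.le_sqrt_of_sq_le hR
  have hTp : √(T * p) * √(T * p) = T * p := Real.mul_self_sqrt (by positivity)
  rw [Real.sqrt_sq hs0.le] at *
  have f1 : R * D ≤ T / d * (p / s) := by
    calc _ ≤ √(T * p) * (√(T * p) / (d * s)) := mul_le_mul hRle hDle hD0 (by positivity)
      _ = √(T * p) * √(T * p) / (d * s) := by ring
      _ = _ := by rw [hTp]; field_simp
  have f2 : √Q * (√(C * s ^ 2) * D ^ 2) ≤ (√T * √C * T) / d ^ 2 * (p / s) := by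
    have g1 : D ^ 2 ≤ (√(T * p) / (d * s)) ^ 2 := pow_le_pow_left₀ hD0 hDle 2
    rw [Real.sqrt_mul hC, Real.sqrt_sq hs0.le]
    calc _ ≤ √T * (√C * s * (√(T * p) / (d * s)) ^ 2) :=
          mul_le_mul (Real.sqrt_le_sqrt hQ) (mul_le_mul_of_nonneg_left g1 (by positivity))
            (by positivity) (by positivity)
      _ = √T * (√C * s * (T * p / (d * s) ^ 2)) := by
          rw [div_pow, Real.sq_sqrt (by positivity)]
      _ = _ := by field_simp
  calc _ ≤ T / d * (p / s) + N * ((√T * √C * T) / d ^ 2 * (p / s)) :=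
        add_le_add f1 (mul_le_mul_of_nonneg_left f2 hN)
    _ = _ := by ring

variable [∀ n, IsProbabilityMeasure (P n)]

/-- Moment bound for the random part of the curvature of the score in a direction. -/
lemma IsRegular.integral_curvature_le (h : m.IsRegular z β₀ P Y ρ c C W M V) {n : ℕ}
    {a : EuclideanSpace ℝ (Fin (p n))} {B : ℝ} (hB : ∑ i, ⟪z n i, a⟫ ^ 2 ≤ B)
    (hz : ∀ i, ‖z n i‖ ^ 2 ≤ C * p n) :
    Integrable (fun ω => ‖∑ i, (m.φ⁻¹ * iteratedDeriv 2 m.u ⟪z n i, β₀ n⟫ *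
      (Y n i ω - m.h ⟪z n i, β₀ n⟫) * ⟪z n i, a⟫) • z n i‖ ^ 2) (P n) ∧
    ∫ ω, ‖∑ i, (m.φ⁻¹ * iteratedDeriv 2 m.u ⟪z n i, β₀ n⟫ *
      (Y n i ω - m.h ⟪z n i, β₀ n⟫) * ⟪z n i, a⟫) • z n i‖ ^ 2 ∂(P n) ≤
      (m.φ⁻¹ * M) ^ 2 * C * B * V * p n := by
  have hC := h.C_nonneg
  have h1 := h.integral_norm_sq_le n
    (fun i => m.φ⁻¹ * iteratedDeriv 2 m.u ⟪z n i, β₀ n⟫ * ⟪z n i, a⟫)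
    (A := (m.φ⁻¹ * M) ^ 2 * (C * p n) * B) (by
      calc _ ≤ ∑ i, (m.φ⁻¹ * M) ^ 2 * (C * p n) * ⟪z n i, a⟫ ^ 2 := by
            refine Finset.sum_le_sum fun i _ => ?_
            have h2 := h.sq_inv_mul_le
              ((h.bounded n i).u'' _ (inner_mem_image (h.center_mem n) i))
            calc _ = (m.φ⁻¹ * iteratedDeriv 2 m.u ⟪z n i, β₀ n⟫) ^ 2 * ‖z n i‖ ^ 2 *
                  ⟪z n i, a⟫ ^ 2 := by ring
              _ ≤ _ := mul_le_mul_of_nonneg_right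
                  (mul_le_mul h2 (hz i) (sq_nonneg _) (sq_nonneg _)) (sq_nonneg _)
        _ = (m.φ⁻¹ * M) ^ 2 * (C * p n) * ∑ i, ⟪z n i, a⟫ ^ 2 := (Finset.mul_sum _ _ _).symm
        _ ≤ _ := mul_le_mul_of_nonneg_left hB (by positivity))
  simp_rw [mul_right_comm _ ⟪_, a⟫] at h1
  exact ⟨h1.1, h1.2.trans_eq (by ring)⟩

/-- Moment bound for the envelope of the third order term of the score in a direction. -/
lemma IsRegular.integral_envelope_le (h : m.IsRegular z β₀ P Y ρ c C W M V) {n : ℕ}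
    {a : EuclideanSpace ℝ (Fin (p n))} {B : ℝ} (hB : ∑ i, ⟪z n i, a⟫ ^ 2 ≤ B) :
    Integrable (fun ω => ∑ i, ⟪z n i, a⟫ ^ 2 * (|Y n i ω - m.h ⟪z n i, β₀ n⟫| + 1) ^ 2) (P n) ∧
    ∫ ω, ∑ i, ⟪z n i, a⟫ ^ 2 * (|Y n i ω - m.h ⟪z n i, β₀ n⟫| + 1) ^ 2 ∂(P n) ≤
      B * (2 * (V + 1)) := by
  have hV := h.V_nonneg
  have heL := h.errors.memLp n
  have hQ : ∀ i, Integrable (fun ω => (|Y n i ω - m.h ⟪z n i, β₀ n⟫| + 1) ^ 2) (P n) := fun i =>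
    ((heL i).norm.add (memLp_const 1)).integrable_sq
  have hQi := fun i => (hQ i).const_mul (⟪z n i, a⟫ ^ 2)
  refine ⟨integrable_finsetSum _ fun i _ => hQi i, ?_⟩
  rw [integral_finsetSum _ fun i _ => hQi i]
  calc _ ≤ ∑ i, ⟪z n i, a⟫ ^ 2 * (2 * (V + 1)) := by
        refine Finset.sum_le_sum fun i _ => ?_
        rw [integral_const_mul]
        refine mul_le_mul_of_nonneg_left ?_ (sq_nonneg _)
        have h1 : ∫ ω, (2 * ((Y n i ω - m.h ⟪z n i, β₀ n⟫) ^ 2 + 1)) ∂(P n) ≤ 2 * (V + 1) := by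
          rw [integral_const_mul, integral_add (heL i).integrable_sq (integrable_const _)]
          simp only [integral_const, probReal_univ, smul_eq_mul, one_mul]
          have := h.errors.integral_sq_le n i
          linarith
        refine le_trans (integral_mono (hQ i)
          (((heL i).integrable_sq.add (integrable_const _)).const_mul 2) fun ω => ?_) h1
        simp only [Pi.add_apply]
        nlinarith [sq_abs (Y n i ω - m.h ⟪z n i, β₀ n⟫),
          sq_nonneg (|Y n i ω - m.h ⟪z n i, β₀ n⟫| - 1)]
    _ = (∑ i, ⟪z n i, a⟫ ^ 2) * (2 * (V + 1)) := (Finset.sum_mul _ _ _).symm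
    _ ≤ _ := mul_le_mul_of_nonneg_right hB (by positivity)

end GLM

namespace GLM

variable {m : GLM} {p : ℕ → ℕ} {z : ∀ n, Fin n → EuclideanSpace ℝ (Fin (p n))}
  {β₀ : ∀ n, EuclideanSpace ℝ (Fin (p n))} {Ω : ℕ → Type*} [∀ n, MeasurableSpace (Ω n)]
  {P : ∀ n, Measure (Ω n)} {Y : ∀ n, Fin n → Ω n → ℝ}
  {ρ : ℕ → ℝ} {c C W M V : ℝ}

lemma inner_score_center (m : GLM) {n p : ℕ} (z : Fin n → EuclideanSpace ℝ (Fin p))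
    (y : Fin n → ℝ) (β a : EuclideanSpace ℝ (Fin p)) :
    ⟪m.score z y β, a⟫ =
      ∑ i, m.φ⁻¹ * deriv m.u ⟪z i, β⟫ * ⟪z i, a⟫ * (y i - m.h ⟪z i, β⟫) := by
  rw [inner_score]
  refine Finset.sum_congr rfl fun i _ => ?_
  unfold psi
  ring

variable [∀ n, IsProbabilityMeasure (P n)]

/-- The estimators are asymptotically linear in the errors. -/
lemma IsRegular.tendsto_remainder (h : m.IsRegular z β₀ P Y ρ c C W M V)
    {βhat : ∀ n, (Fin n → ℝ) → EuclideanSpace ℝ (Fin (p n))}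
    (hβ : ∀ n, 0 < n → ∀ y, m.IsGood (z n) (β₀ n) (ρ n) (W * c / 2 * n) y →
      βhat n y ∈ Metric.closedBall (β₀ n) (ρ n) ∧ m.score (z n) y (βhat n y) = 0 ∧
      W * c / 2 * n * ‖βhat n y - β₀ n‖ ≤ ‖m.score (z n) y (β₀ n)‖)
    (hp : (fun n => (p n : ℝ)) =o[atTop] (fun n => √(n : ℝ)))
    {α a : ∀ n, EuclideanSpace ℝ (Fin (p n))} (hα : ∀ᶠ n in atTop, ‖α n‖ = 1)
    (ha : ∀ᶠ n in atTop, m.IsDirection (z n) (β₀ n) (α n) (a n) (W * c) (C / (W * c)))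
    {ε : ℝ} (hε : 0 < ε) :
    Tendsto (fun n => (P n).real {ω | ε ≤ |(α n).ofLp ⬝ᵥ
      (CFC.sqrt (m.fisher (z n) (β₀ n))).mulVec (βhat n (fun i => Y n i ω) - β₀ n).ofLp -
      ∑ i, m.φ⁻¹ * deriv m.u ⟪z n i, β₀ n⟫ * ⟪z n i, a n⟫ *
        (Y n i ω - m.h ⟪z n i, β₀ n⟫)|}) atTop (𝓝 0) := by
  have hφ := h.valid.φ_pos
  have hc := h.c_pos
  have hC := h.C_nonneg
  have hW := h.W_pos
  have hM := h.M_pos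
  have hV := h.V_nonneg
  obtain ⟨d, hd⟩ : ∃ d, W * c / 2 = d := ⟨_, rfl⟩
  obtain ⟨B, hBd⟩ : ∃ B, C / (W * c) = B := ⟨_, rfl⟩
  have hd0 : 0 < d := by rw [← hd]; positivity
  have hB0 : 0 ≤ B := by rw [← hBd]; positivity
  refine tendsto_order.2 ⟨fun b hb => Eventually.of_forall fun n =>
    hb.trans_le measureReal_nonneg, fun κ hκ => ?_⟩
  have hgood := h.eventually_isGood (show 0 < κ / 4 by positivity)
  have hscore := h.integral_score_sq_le
  rw [hd] at hβ hgood
  rw [hBd] at ha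
  obtain ⟨A₁, hA₁⟩ : ∃ A, (m.φ⁻¹ * M) ^ 2 * C * V = A := ⟨_, rfl⟩
  obtain ⟨A₂, hA₂⟩ : ∃ A, (m.φ⁻¹ * M) ^ 2 * C * B * V = A := ⟨_, rfl⟩
  obtain ⟨A₃, hA₃⟩ : ∃ A, B * (2 * (V + 1)) = A := ⟨_, rfl⟩
  have hA₁0 : 0 ≤ A₁ := by rw [← hA₁]; positivity
  have hA₂0 : 0 ≤ A₂ := by rw [← hA₂]; positivity
  have hA₃0 : 0 ≤ A₃ := by rw [← hA₃]; positivity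
  -- One threshold serves the three Markov bounds (score, curvature, envelope), which together cost
  -- at most `κ / 8`.
  obtain ⟨T, hT⟩ : ∃ T, 8 * (A₁ + A₂ + A₃ + 1) / κ = T := ⟨_, rfl⟩
  have hT0 : 0 < T := by rw [← hT]; positivity
  have hTle : A₁ / T + A₂ / T + A₃ / T ≤ κ / 8 := by
    rw [← add_div, ← add_div, div_le_iff₀ hT0, ← hT]
    field_simp
    linarith
  obtain ⟨N, hN⟩ : ∃ N, m.φ⁻¹ * M + (m.φ⁻¹ * M ^ 2 + M) = N := ⟨_, rfl⟩
  have hN0 : 0 < N := by rw [← hN]; positivity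
  obtain ⟨Λ, hΛ⟩ : ∃ Λ, T / d + N * (√T * √C * T) / d ^ 2 = Λ := ⟨_, rfl⟩
  have hΛ0 : 0 < Λ := by rw [← hΛ]; positivity
  filter_upwards [hgood, hscore, ha, h.norm_sq_le, h.fourth,
    hp.bound (show 0 < ε / (2 * Λ) by positivity), eventually_gt_atTop 0, hα]
    with n g1 g2 g3 g5 g6 g7 g8 g9
  have hn' : (0 : ℝ) < n := by exact_mod_cast g8
  rw [Real.norm_natCast, Real.norm_of_nonneg (Real.sqrt_nonneg _),
    ← div_le_iff₀ (Real.sqrt_pos.2 hn')] at g7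
  -- A unit vector exists only in positive dimension; the thresholds `T * (n * p)` and `T * p` must
  -- be positive.
  have hp0 : 0 < p n := by
    rcases Nat.eq_zero_or_pos (p n) with h0 | h0
    · exfalso
      have : IsEmpty (Fin (p n)) := by rw [h0]; infer_instance
      rw [Subsingleton.elim (α n) 0, norm_zero] at g9
      exact zero_ne_one g9
    · exact h0
  have hp' : (0 : ℝ) < p n := by exact_mod_cast hp0
  have hRm := h.integral_curvature_le g3.sum_sq_le g5
  have hQm := h.integral_envelope_le g3.sum_sq_le
  rw [hA₁] at g2
  rw [hA₂] at hRm
  rw [hA₃] at hQm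
  have p1 := measureReal_ge_le_div (P n) g2.1 (fun ω => sq_nonneg _) g2.2
    (show 0 < T * (n * p n) by positivity)
  have p2 := measureReal_ge_le_div (P n) hRm.1 (fun ω => sq_nonneg _) hRm.2
    (show 0 < T * p n by positivity)
  have p3 := measureReal_ge_le_div (P n) hQm.1 (fun ω => Finset.sum_nonneg fun i _ =>
    mul_nonneg (sq_nonneg _) (sq_nonneg _)) hQm.2 hT0
  rw [mul_div_mul_right _ _ (by positivity)] at p1 p2
  refine lt_of_le_of_lt (measureReal_mono (s₂ := (_ ∪ _) ∪ (_ ∪ _)) ?_ (measure_ne_top _ _))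
    (((measureReal_union_le _ _).trans (add_le_add
      ((measureReal_union_le _ _).trans (add_le_add g1 p1))
      ((measureReal_union_le _ _).trans (add_le_add p2 p3)))).trans_lt (by linarith))
  intro ω hω
  by_contra hnot
  simp only [Set.mem_union, Set.mem_ofPred_eq, not_or, not_not, not_le] at hnot
  obtain ⟨⟨q0, q1⟩, q2, q3⟩ := hnot
  obtain ⟨b1, b2, b3⟩ := hβ n g8 _ q0
  have hexp := h.valid.score_expansion h.u_smooth h.w_smooth (z n) (β₀ n) (h.ρ_pos n).le hM.le
    (h.bounded n) hC g6 (fun i => Y n i ω) b1 (a n)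
  -- At the root the score vanishes, so the expansion compares the studentized error directly with
  -- `⟪S(β₀), a⟫`.
  rw [b2, inner_zero_left, zero_sub, hN] at hexp
  have hrem := remainder_le (N := N) hn' hp' hT0 hd0 hC hN0.le (norm_nonneg _) q2.le q3.le b3
    q1.le
  rw [hΛ] at hrem
  have hlast : Λ * (p n / √n) ≤ ε / 2 := by
    calc _ ≤ Λ * (ε / (2 * Λ)) := mul_le_mul_of_nonneg_left g7 hΛ0.le
      _ = ε / 2 := by field_simp
  have hω' := Set.mem_ofPred_eq ▸ hω
  rw [g3.dotProduct_eq, ← inner_score_center, ← neg_add_eq_sub] at hω'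
  linarith [hexp.trans hrem]

/-- Asymptotic normality of the estimators. -/
lemma IsRegular.asymptotic_normality (h : m.IsRegular z β₀ P Y ρ c C W M V)
    {βhat : ∀ n, (Fin n → ℝ) → EuclideanSpace ℝ (Fin (p n))} (hmeas : ∀ n, Measurable (βhat n))
    (hβ : ∀ n, 0 < n → ∀ y, m.IsGood (z n) (β₀ n) (ρ n) (W * c / 2 * n) y →
      βhat n y ∈ Metric.closedBall (β₀ n) (ρ n) ∧ m.score (z n) y (βhat n y) = 0 ∧
      W * c / 2 * n * ‖βhat n y - β₀ n‖ ≤ ‖m.score (z n) y (β₀ n)‖)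
    (hp : (fun n => (p n : ℝ)) =o[atTop] (fun n => √(n : ℝ)))
    (α : ∀ n, EuclideanSpace ℝ (Fin (p n))) (hα : ∀ᶠ n in atTop, ‖α n‖ = 1) :
    TendstoInDistribution
      (fun n ω => (α n).ofLp ⬝ᵥ (CFC.sqrt (m.fisher (z n) (β₀ n))).mulVec
        (βhat n (fun i => Y n i ω) - β₀ n).ofLp)
      atTop (id : ℝ → ℝ) P (gaussianReal 0 1) := by
  obtain ⟨a, ha⟩ := h.exists_isDirection α hα
  refine h.errors.tendstoInDistribution
    (fun n i => m.φ⁻¹ * deriv m.u ⟪z n i, β₀ n⟫ * ⟪z n i, a n⟫)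
    (L := (m.φ⁻¹ * M) ^ 2 * (C / (W * c))) ?_ ?_ (fun κ hκ => h.eventually_abs_weight_le ha hκ)
    ?_ (fun ε hε => h.tendsto_remainder hβ hp hα ha hε)
  -- By the information identity the variance of the leading term is `aᵀ F a = 1`.
  · filter_upwards [ha] with n hn
    rw [← hn.sum_w_eq]
    refine Finset.sum_congr rfl fun i _ => ?_
    have hD : ⟪z n i, β₀ n⟫ ∈ m.D :=
      (h.bounded n i).subset (inner_mem_image (h.center_mem n) i)
    rw [h.variance_eq n i, h.valid.w_eq_v h.u_smooth hD]
    ring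
  · filter_upwards [ha] with n hn
    calc _ ≤ ∑ i, (m.φ⁻¹ * M) ^ 2 * ⟪z n i, a n⟫ ^ 2 := by
          refine Finset.sum_le_sum fun i _ => ?_
          rw [mul_pow _ ⟪_, _⟫]
          exact mul_le_mul_of_nonneg_right (h.sq_inv_mul_le
            ((h.bounded n i).u' _ (inner_mem_image (h.center_mem n) i))) (sq_nonneg _)
      _ = (m.φ⁻¹ * M) ^ 2 * ∑ i, ⟪z n i, a n⟫ ^ 2 := (Finset.mul_sum _ _ _).symm
      _ ≤ _ := mul_le_mul_of_nonneg_left hn.sum_sq_le (sq_nonneg _)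
  · intro n
    have h1 : Measurable fun ω => βhat n (fun i => Y n i ω) - β₀ n :=
      ((hmeas n).comp (h.measurable_response n)).sub_const _
    have h2 : Continuous fun x : EuclideanSpace ℝ (Fin (p n)) =>
        (α n).ofLp ⬝ᵥ (CFC.sqrt (m.fisher (z n) (β₀ n))).mulVec x.ofLp := by fun_prop
    exact h2.measurable.comp h1

end GLM

/-! ### The shrinking radius and the main theorem -/

/-- The minimum of `r` and `√x + 1 / (n + 1)` works: `x = o(√x)` as `x` vanishes, and the second
summand keeps the radius positive where `x = 0`. A vanishing radius makes the linearization error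
small and yields consistency, while staying large compared with `√(p / n)`. -/
lemma exists_vanishing_radius {x r : ℕ → ℝ} (hx0 : ∀ n, 0 ≤ x n) (hx : Tendsto x atTop (𝓝 0))
    (hr0 : ∀ n, 0 < r n) (hr : x =o[atTop] r) :
    ∃ ρ : ℕ → ℝ, (∀ n, 0 < ρ n) ∧ (∀ n, ρ n ≤ r n) ∧ Tendsto ρ atTop (𝓝 0) ∧ x =o[atTop] ρ := by
  have hs : Tendsto (fun n => √(x n)) atTop (𝓝 0) := by
    have := hx.sqrt
    rwa [Real.sqrt_zero] at this
  have hpos : ∀ n : ℕ, 0 < √(x n) + 1 / ((n : ℝ) + 1) := fun n => by positivity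
  have hρ : ∀ n, 0 < min (r n) (√(x n) + 1 / ((n : ℝ) + 1)) := fun n => lt_min (hr0 n) (hpos n)
  refine ⟨_, hρ, fun n => min_le_left _ _, ?_, ?_⟩
  · have h1 : Tendsto (fun n : ℕ => √(x n) + 1 / ((n : ℝ) + 1)) atTop (𝓝 0) := by
      simpa using hs.add tendsto_one_div_add_atTop_nhds_zero_nat
    exact squeeze_zero (fun n => (hρ n).le) (fun n => min_le_right _ _) h1
  · refine IsLittleO.of_bound fun ε hε => ?_
    filter_upwards [hr.bound hε, hs.eventually_le_const hε] with n h1 h2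
    rw [Real.norm_of_nonneg (hx0 n)] at h1 ⊢
    rw [Real.norm_of_nonneg (hr0 n).le] at h1
    rw [Real.norm_of_nonneg (hρ n).le, mul_min_of_nonneg _ _ hε.le]
    refine le_min h1 ?_
    calc x n = √(x n) * √(x n) := (Real.mul_self_sqrt (hx0 n)).symm
      _ ≤ ε * √(x n) := mul_le_mul_of_nonneg_right h2 (Real.sqrt_nonneg _)
      _ ≤ _ := mul_le_mul_of_nonneg_left (le_add_of_nonneg_right (by positivity)) hε.le

/-- A bound for a quartic form on the unit sphere extends by homogeneity. -/
lemma sum_inner_pow_four_le {E : Type*} [NormedAddCommGroup E] [InnerProductSpace ℝ E] {n : ℕ}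
    {z : Fin n → E} {A : ℝ} (h : ∀ α : E, ‖α‖ = 1 → ∑ i, |⟪α, z i⟫| ^ 4 ≤ A) (x : E) :
    ∑ i, ⟪z i, x⟫ ^ 4 ≤ A * ‖x‖ ^ 4 := by
  rcases eq_or_ne x 0 with rfl | hx
  · simp
  have hx' : 0 < ‖x‖ := norm_pos_iff.2 hx
  have h1 := h (‖x‖⁻¹ • x) (by rw [norm_smul, norm_inv, norm_norm, inv_mul_cancel₀ hx'.ne'])
  calc _ = (∑ i, |⟪‖x‖⁻¹ • x, z i⟫| ^ 4) * ‖x‖ ^ 4 := by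
        rw [Finset.sum_mul]
        refine Finset.sum_congr rfl fun i _ => ?_
        rw [real_inner_smul_left, real_inner_comm x (z i), Even.pow_abs ⟨2, rfl⟩, ← mul_pow]
        congr 1
        field_simp
    _ ≤ _ := mul_le_mul_of_nonneg_right h1 (by positivity)

theorem theorem1 (m : GLM) (hm : m.IsValid)
    -- triangular array: dimensions, design vectors, parameter spaces, true parameters, responses
    (p : ℕ → ℕ)
    (z : ∀ n, Fin n → EuclideanSpace ℝ (Fin (p n)))
    (B : ∀ n, Set (EuclideanSpace ℝ (Fin (p n))))
    (β₀ : ∀ n, EuclideanSpace ℝ (Fin (p n)))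
    {Ω : ℕ → Type*} [∀ n, MeasurableSpace (Ω n)]
    (P : ∀ n, Measure (Ω n)) [∀ n, IsProbabilityMeasure (P n)]
    (Y : ∀ n, Fin n → Ω n → ℝ)
    (hY : ∀ n, m.IsSample (P n) (z n) (β₀ n) (Y n))
    -- eigenvalues of the normalized Gram matrix
    (Cmin Cmax : ℝ) (hCmin : 0 < Cmin)
    (hgram : ∀ᶠ n in atTop, spectrum ℝ (normalizedGram (z n)) ⊆ Set.Icc Cmin Cmax)
    -- norms and fourth moments of the design vectors
    (hnorm : ∃ C : ℝ, ∀ᶠ n in atTop, ∀ i, ‖z n i‖ ^ 2 ≤ C * p n)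
    (hfourth : ∃ C : ℝ, ∀ᶠ n in atTop, ∀ α : EuclideanSpace ℝ (Fin (p n)), ‖α‖ = 1 →
      ∑ i, |⟪α, z n i⟫| ^ 4 ≤ C * n)
    -- error variances
    (herror : ∃ V : ℝ, ∀ n i, ∫ ω, (Y n i ω - m.h ⟪z n i, β₀ n⟫) ^ 2 ∂(P n) ≤ V)
    -- parameter spaces: compact, with the true parameter in the interior, at a distance from the
    -- boundary that is not too small (for instance bounded below)
    (hcompact : ∀ n, IsCompact (B n))
    (hinterior : ∃ r : ℕ → ℝ, (∀ n, 0 < r n) ∧ (∀ n, Metric.closedBall (β₀ n) (r n) ⊆ B n) ∧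
      (fun n => √((p n : ℝ) / n)) =o[atTop] r)
    (hdomain : ∀ n, ∀ β ∈ B n, ∀ i, ⟪z n i, β⟫ ∈ m.D)
    -- smoothness, with the uniform bounds over the parameter spaces
    (hu : ContDiffOn ℝ 3 m.u m.D) (hw : ContDiffOn ℝ 1 m.w m.D)
    (hbound : ∃ M : ℝ, ∀ n, ∀ β ∈ B n, ∀ i,
      |m.h ⟪z n i, β⟫| ≤ M ∧ |deriv m.h ⟪z n i, β⟫| ≤ M ∧ |deriv m.u ⟪z n i, β⟫| ≤ M ∧
      |iteratedDeriv 2 m.u ⟪z n i, β⟫| ≤ M ∧ |iteratedDeriv 3 m.u ⟪z n i, β⟫| ≤ M ∧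
      |m.w ⟪z n i, β⟫| ≤ M ∧ |deriv m.w ⟪z n i, β⟫| ≤ M)
    (hwmin : ∃ W > 0, ∀ n i, W ≤ m.w ⟪z n i, β₀ n⟫)
    -- the dimension is of smaller order than the sample size
    (hp : (fun n => (p n : ℝ)) =o[atTop] fun n => (n : ℝ)) :
    ∃ βhat : ∀ n, (Fin n → ℝ) → EuclideanSpace ℝ (Fin (p n)),
      (∀ n, Measurable (βhat n)) ∧
      -- (i) with probability tending to one `βhat` is a root of the score, and it is consistent
      Tendsto (fun n => P n {ω | m.score (z n) (fun i => Y n i ω)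
        (βhat n fun i => Y n i ω) = 0}) atTop (𝓝 1) ∧
      (∀ ε > 0, Tendsto (fun n => P n {ω | ε ≤ ‖βhat n (fun i => Y n i ω) - β₀ n‖})
        atTop (𝓝 0)) ∧
      -- (ii) asymptotic normality
      ((fun n => (p n : ℝ)) =o[atTop] (fun n => √(n : ℝ)) →
        ∀ α : ∀ n, EuclideanSpace ℝ (Fin (p n)), (∀ᶠ n in atTop, ‖α n‖ = 1) →
          TendstoInDistribution
            (fun n ω => (α n).ofLp ⬝ᵥ (CFC.sqrt (m.fisher (z n) (β₀ n))).mulVec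
              (βhat n (fun i => Y n i ω) - β₀ n).ofLp)
            atTop (id : ℝ → ℝ) P (gaussianReal 0 1)) := by
  obtain ⟨M₀, hM₀⟩ := hbound
  obtain ⟨C₁, hC₁⟩ := hnorm
  obtain ⟨C₂, hC₂⟩ := hfourth
  obtain ⟨V₀, hV₀⟩ := herror
  obtain ⟨W, hW, hwW⟩ := hwmin
  obtain ⟨r, hr0, hrB, hr⟩ := hinterior
  have hx : Tendsto (fun n => √((p n : ℝ) / n)) atTop (𝓝 0) := by
    have := hp.tendsto_div_nhds_zero.sqrt
    rwa [Real.sqrt_zero] at this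
  obtain ⟨ρ, hρ0, hρr, hρ, hρl⟩ :=
    exists_vanishing_radius (fun n => Real.sqrt_nonneg _) hx hr0 hr
  have hρB : ∀ n, Metric.closedBall (β₀ n) (ρ n) ⊆ B n := fun n =>
    (Metric.closedBall_subset_closedBall (hρr n)).trans (hrB n)
  have hβB : ∀ n, β₀ n ∈ B n := fun n => hρB n (Metric.mem_closedBall_self (hρ0 n).le)
  -- The given constants carry no sign, so they are enlarged to be positive or nonnegative, and the
  -- three design bounds are merged into one `C`.
  obtain ⟨M, hM, hM1⟩ : ∃ M, M₀ ≤ M ∧ 1 ≤ M := ⟨_, le_max_left _ _, le_max_right _ _⟩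
  have hM0 : 0 < M := one_pos.trans_le hM1
  obtain ⟨V, hV, hV0⟩ : ∃ V, V₀ ≤ V ∧ 0 ≤ V := ⟨_, le_max_left _ _, le_max_right _ _⟩
  obtain ⟨C, hC1, hC2, hC3, hC0⟩ : ∃ C, C₁ ≤ C ∧ C₂ ≤ C ∧ Cmax ≤ C ∧ 0 ≤ C :=
    ⟨max (max C₁ C₂) (max Cmax 0), (le_max_left _ _).trans (le_max_left _ _),
      (le_max_right _ _).trans (le_max_left _ _), (le_max_left _ _).trans (le_max_right _ _),
      (le_max_right _ _).trans (le_max_right _ _)⟩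
  have herr := hm.isErrorArray hY (fun n i => hdomain n _ (hβB n) i) hu
    (fun n i => (hV₀ n i).trans hV) hW hM0 hwW
    (fun n i => (hM₀ n _ (hβB n) i).1.trans hM)
    (fun n i => (hM₀ n _ (hβB n) i).2.2.1.trans hM)
  have hreg : m.IsRegular z β₀ P Y ρ Cmin C W M V :=
    { valid := hm
      u_smooth := hu
      w_smooth := hw
      errors := herr.1
      variance_eq := herr.2
      c_pos := hCmin
      C_nonneg := hC0
      W_pos := hW
      M_pos := hM0
      V_nonneg := hV0
      ρ_pos := hρ0
      bounded := fun n i =>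
        { subset := by
            rintro _ ⟨β, hβ, rfl⟩
            exact hdomain n β (hρB n hβ) i
          convex := (convex_closedBall (β₀ n) (ρ n)).linear_image
            (innerSL ℝ (z n i)).toLinearMap
          h' := by
            rintro _ ⟨β, hβ, rfl⟩
            exact (hM₀ n β (hρB n hβ) i).2.1.trans hM
          u' := by
            rintro _ ⟨β, hβ, rfl⟩
            exact (hM₀ n β (hρB n hβ) i).2.2.1.trans hM
          u'' := by
            rintro _ ⟨β, hβ, rfl⟩
            exact (hM₀ n β (hρB n hβ) i).2.2.2.1.trans hM
          u''' := by
            rintro _ ⟨β, hβ, rfl⟩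
            exact (hM₀ n β (hρB n hβ) i).2.2.2.2.1.trans hM
          w' := by
            rintro _ ⟨β, hβ, rfl⟩
            exact (hM₀ n β (hρB n hβ) i).2.2.2.2.2.2.trans hM }
      lower := by
        filter_upwards [hgram, eventually_gt_atTop 0] with n h1 hn x
        exact (quadForm_bounds_of_spectrum hn (z n) h1 x).1
      upper := by
        filter_upwards [hgram, eventually_gt_atTop 0] with n h1 hn x
        refine (quadForm_bounds_of_spectrum hn (z n) h1 x).2.trans ?_
        gcongr
      fourth := by
        filter_upwards [hC₂] with n h1 x
        refine (sum_inner_pow_four_le h1 x).trans ?_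
        gcongr
      norm_sq_le := by
        filter_upwards [hC₁] with n h1 i
        refine (h1 i).trans ?_
        gcongr
      w_ge := hwW
      dim := hp
      ρ_tendsto := hρ
      ρ_large := hρl }
  obtain ⟨βhat, hmeas, hβ⟩ := hreg.exists_estimator
  exact ⟨βhat, hmeas, hreg.tendsto_root fun n hn y hy => (hβ n hn y hy).2.1,
    fun ε hε => hreg.tendsto_dist (fun n hn y hy => (hβ n hn y hy).1) hε,
    fun hp2 α hα => hreg.asymptotic_normality hmeas hβ hp2 α hα⟩
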